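/- Let $X$ be a complete separable metric space and $d\in\mathbb N_0$. Write $\mathcal M_1(X)$ for the Borel probability measures on $X$ with the weak topology, and $\mathcal M_{\le 1}(X\times\mathbb R^d)$ for the sub-probability measures on $X\times\mathbb R^d$. For $\lambda\in\mathcal M_{\le1}(X\times\mathbb R^d)$ let $\lambda\star\delta_a$ be its image under $(x,y)\mapsto(x,y+a)$, let $\widetilde\lambda=\{\lambda\star\delta_a: a\in\mathbb R^d\}$ be its orbit, and let $\widetilde\lambda^{(1)}$ be the common marginal on $X$ of the measures in the orbit. Let $\mathscr X$ be the set of all pairs $\Theta=[\xi,\beta]$, where $\beta\in\mathcal M_1(X)$ and $\xi=\{\widetilde\lambda_j\}_j$ is an empty, finite or countable collection, with repetitions allowed (a multiset), of orbits of non-zero elements of $\mathcal M_{\le1}(X\times\mathbb R^d)$ such that $\sum_{j}\widetilde\lambda_j^{(1)}(A)\le\beta(A)$ for every Borel set $A\subset X$. For $k\ge2$ let $\mathfrak C_k$ be the space of continuous $W:(\mathbb R^d)^k\to\mathbb R$ with $W(y_1+a,\dots,y_k+a)=W(y_1,\dots,y_k)$ for all $a\in\mathbb R^d$ and $W(y_1,\dots,y_k)\to0$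 as $\sup_{i,j}|y_i-y_j|\to\infty$. A *test family* consists of: a countable set $\mathfrak F=\{f_j\}_{j\ge1}$ of continuous functions on $X$ with $|f_j|\le1$ such that, for probability measures, $\int f_j\,d\beta_n\to\int f_j\,d\beta$ for every $j$ if and only if $\beta_n\Rightarrow\beta$ weakly; for each $k\ge2$ a countable set $\mathcal W_k\subset\mathfrak C_k$ of functions bounded by $1$ whose linear span is dense in $\mathfrak C_k$ in the uniform norm; and an enumeration $(f_r,W_r)_{r\ge1}$ of all pairs $(f,W)$ with $f\in\mathfrak F$ and $W\in\mathcal W=\bigcup_{k\ge2}\mathcal W_k$, where $W_r$ is a function of $k(r)$ variables. (The listing of each countable set, and the enumeration of pairs, may repeat elements.) Given a test family, put $$\Lambda_{f_r,W_r}(\xi)=\sum_{\widetilde\lambda\in\xi}\int f_r(x_1)\cdots f_r(x_{k(r)})\,W_r(y_1,\dots,y_{k(r)})\prod_{i=1}^{k(r)}\lambda(dx_i,dy_i)$$ (summed with multiplicity), and $$\mathscr D(\Theta_1,\Theta_2)=\sum_{r\ge1}2^{-r}\big|\Lambda_{f_r,W_r}(\xi_1)-\Lambda_{f_r,W_r}(\xi_2)\big|+\sum_{j\ge1}2^{-j}\Big|\int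 f_j\,d\beta_1-\int f_j\,d\beta_2\Big|$$ for $\Theta_i=[\xi_i,\beta_i]\in\mathscr X$; this is a finite pseudometric on $\mathscr X$. Then: 1. There are test families for which $\mathfrak F$ contains the constant function $1$ and is closed under midpoints $(f,g)\mapsto\frac12(f+g)$; and for every such test family, $\mathscr D$ is a metric on $\mathscr X$, that is, $\mathscr D(\Theta_1,\Theta_2)=0$ if and only if $\Theta_1=\Theta_2$. 2. For every test family: if $K\subset\mathscr X$ is such that $\{\beta:[\xi,\beta]\in K\}$ is a uniformly tight family in $\mathcal M_1(X)$, then every sequence in $K$ has a subsequence that converges with respect to $\mathscr D$ to an element of $\mathscr X$. 3. For every test family: if $(\Pi_n)_n$ is a sequence of Borel probability measures on $(\mathscr X,\mathscr D)$ such that the laws $\widehat\Pi_n$ of $\beta$ under $\Pi_n$ form a uniformly tight family of probability measures on $\mathcal M_1(X)$, then $(\Pi_n)_n$ is a uniformly tight family of probability measures on $(\mathscr X,\mathscr D)$. -/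

import Mathlib

open MeasureTheory Filter Topology
open scoped ENNReal BoundedContinuousFunction

noncomputable section

namespace OrbitCompactification

/-- The Euclidean space `ℝᵈ`. -/
abbrev E (d : ℕ) : Type := EuclideanSpace ℝ (Fin d)

section Orbits

/-- Sub-probability measures on `X × ℝᵈ` (with the product σ-algebra). -/
def SubProb (X : Type*) [MeasurableSpace X] (d : ℕ) : Type _ :=
  {μ : Measure (X × E d) // μ Set.univ ≤ 1}

variable {X : Type*} [MeasurableSpace X] {d : ℕ}

instance (l : SubProb X d) : IsFiniteMeasure l.1 :=
  ⟨lt_of_le_of_lt l.2 ENNReal.one_lt_top⟩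

/-- The translation `(x, y) ↦ (x, y + a)` of `X × ℝᵈ`. -/
def shift (a : E d) : (X × E d) ≃ᵐ (X × E d) :=
  (MeasurableEquiv.refl X).prodCongr (MeasurableEquiv.addRight a)

@[simp] lemma shift_apply (a : E d) (p : X × E d) : shift a p = (p.1, p.2 + a) := rfl

/-- The translate `λ ⋆ δ_a` of a sub-probability measure `λ`. -/
def SubProb.translate (l : SubProb X d) (a : E d) : SubProb X d :=
  ⟨l.1.map (shift a), by
    rw [MeasurableEquiv.map_apply]
    exact l.2⟩

/-- Two measures are equivalent if one is a translate of the other. -/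
def orbitSetoid (X : Type*) [MeasurableSpace X] (d : ℕ) : Setoid (SubProb X d) where
  r l m := ∃ a : E d, m = l.translate a
  iseqv :=
    { refl := fun l => ⟨0, by
        apply Subtype.ext
        have h : ((shift (0 : E d) : (X × E d) ≃ᵐ (X × E d)) : X × E d → X × E d) = id := by
          funext p
          simp
        simp [SubProb.translate, h]⟩
      symm := by
        rintro l _ ⟨a, rfl⟩
        refine ⟨-a, ?_⟩
        apply Subtype.ext
        have h : ((shift (-a) : (X × E d) ≃ᵐ (X × E d)) : X × E d → X × E d) ∘ shift a = id := by
          funext p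
          simp
        simp only [SubProb.translate]
        rw [Measure.map_map (shift (-a)).measurable (shift a).measurable, h, Measure.map_id]
      trans := by
        rintro l _ _ ⟨a, rfl⟩ ⟨b, rfl⟩
        refine ⟨a + b, ?_⟩
        apply Subtype.ext
        have h : ((shift b : (X × E d) ≃ᵐ (X × E d)) : X × E d → X × E d) ∘ shift a
            = shift (a + b) := by
          funext p
          simp [add_assoc]
        simp only [SubProb.translate]
        rw [Measure.map_map (shift b).measurable (shift a).measurable, h] }

/-- The space of orbits of sub-probability measures on `X × ℝᵈ` under translations of `ℝᵈ`. -/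
def Orbit (X : Type*) [MeasurableSpace X] (d : ℕ) : Type _ := Quotient (orbitSetoid X d)

/-- The orbit of `λ`. -/
def orbit (l : SubProb X d) : Orbit X d := Quotient.mk (orbitSetoid X d) l

/-- The orbit of the zero measure. -/
def zeroOrbit : Orbit X d := orbit ⟨0, by simp⟩

/-- The common marginal on `X` of the measures in an orbit. -/
def Orbit.marginal (o : Orbit X d) : Measure X :=
  Quotient.lift (s := orbitSetoid X d) (fun l => l.1.map Prod.fst) (by
    rintro l _ ⟨a, rfl⟩
    simp only [SubProb.translate]
    rw [Measure.map_map measurable_fst (shift a).measurable]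
    rfl) o

end Orbits

/-- The set of all pairs `[ξ, β]`: `ξ` is an (empty, finite or countable) collection of orbits,
with repetitions allowed, described by the multiplicity `mult o` of each orbit `o`; the orbit of
the zero measure, which carries no mass, is never a member. -/
@[ext] structure Configuration (X : Type*) [MeasurableSpace X] (d : ℕ) where
  mult : Orbit X d → ℕ
  mult_zero : mult zeroOrbit = 0
  countable_support : (Function.support mult).Countable
  β : ProbabilityMeasure X
  sum_marginal_le : ∀ A : Set X, MeasurableSet A →
    ∑' o : Orbit X d, (mult o : ℝ≥0∞) * o.marginal A ≤ (β : Measure X) A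

lemma Configuration.summable_mass {X : Type*} [MeasurableSpace X] {d : ℕ}
    (T : Configuration X d) :
    Summable (fun o : Orbit X d => (T.mult o : ℝ) * (o.marginal Set.univ).toReal) ∧
    ∑' o : Orbit X d, (T.mult o : ℝ) * (o.marginal Set.univ).toReal ≤ 1 := by
  have h := T.sum_marginal_le Set.univ MeasurableSet.univ
  rw [measure_univ] at h
  have hne : ∑' o : Orbit X d, (T.mult o : ℝ≥0∞) * o.marginal Set.univ ≠ ∞ :=
    ne_top_of_le_ne_top ENNReal.one_ne_top h
  have he : ∀ o : Orbit X d, (T.mult o : ℝ) * (o.marginal Set.univ).toReal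
      = ((T.mult o : ℝ≥0∞) * o.marginal Set.univ).toReal := fun o => by
    rw [ENNReal.toReal_mul, ENNReal.toReal_natCast]
  simp only [he]
  refine ⟨ENNReal.summable_toReal hne, ?_⟩
  rw [← ENNReal.tsum_toReal_eq (fun o => ENNReal.ne_top_of_tsum_ne_top hne o)]
  simpa using ENNReal.toReal_mono ENNReal.one_ne_top h

/-- The space `ℭ_k` of continuous functions `W(y₁, …, y_k)` of `k` variables in `ℝᵈ` that are
invariant under simultaneous translation and tend to `0` as `sup_{i,j} |y_i - y_j| → ∞`.
(For `k ≥ 1` such functions are automatically bounded.) -/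
def transInv (d k : ℕ) : Submodule ℝ ((Fin k → E d) →ᵇ ℝ) where
  carrier := {W | (∀ (a : E d) (y : Fin k → E d), W (fun i => y i + a) = W y) ∧
    ∀ ε : ℝ, 0 < ε → ∃ R : ℝ, ∀ y : Fin k → E d, (∃ i j, R ≤ ‖y i - y j‖) → |W y| ≤ ε}
  zero_mem' := ⟨fun _ _ => rfl, fun ε hε => ⟨0, fun _ _ => by simpa using hε.le⟩⟩
  add_mem' := by
    rintro V W ⟨hV, hV'⟩ ⟨hW, hW'⟩
    refine ⟨fun a y => by simp [hV a y, hW a y], fun ε hε => ?_⟩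
    obtain ⟨R, hR⟩ := hV' (ε / 2) (by positivity)
    obtain ⟨R', hR'⟩ := hW' (ε / 2) (by positivity)
    refine ⟨max R R', ?_⟩
    rintro y ⟨i, j, hij⟩
    have h1 := hR y ⟨i, j, (le_max_left _ _).trans hij⟩
    have h2 := hR' y ⟨i, j, (le_max_right _ _).trans hij⟩
    have h3 := abs_add_le (V y) (W y)
    simp only [BoundedContinuousFunction.coe_add, Pi.add_apply]
    linarith
  smul_mem' := by
    rintro c W ⟨hW, hW'⟩
    refine ⟨fun a y => by simp [hW a y], fun ε hε => ?_⟩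
    obtain ⟨R, hR⟩ := hW' (ε / (|c| + 1)) (by positivity)
    refine ⟨R, fun y hy => ?_⟩
    have h := hR y hy
    simp only [BoundedContinuousFunction.coe_smul, smul_eq_mul, abs_mul]
    have hc : (0 : ℝ) < |c| + 1 := by positivity
    rw [le_div_iff₀ hc] at h
    nlinarith [abs_nonneg (W y), abs_nonneg c]

/-- The choices on which the metric depends.

* `f` lists a countable set of continuous functions on `X`, bounded by `1`, that determines
  weak convergence of probability measures;
* for `k ≥ 2`, `W k` lists a countable subset of `ℭ_k`, bounded by `1`, whose linear span is
  uniformly dense in `ℭ_k`;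
* `enum` enumerates all combinations of some `f j` with some `W k l` as a single sequence. -/
structure TestFamily (X : Type*) [TopologicalSpace X] [MeasurableSpace X]
    [OpensMeasurableSpace X] (d : ℕ) where
  f : ℕ → X →ᵇ ℝ
  abs_f_le : ∀ j x, |f j x| ≤ 1
  f_convergence : ∀ (b : ℕ → ProbabilityMeasure X) (b₀ : ProbabilityMeasure X),
    (∀ j, Tendsto (fun n => ∫ x, f j x ∂(b n : Measure X)) atTop
      (𝓝 (∫ x, f j x ∂(b₀ : Measure X)))) ↔ Tendsto b atTop (𝓝 b₀)
  W : (k : {k : ℕ // 2 ≤ k}) → ℕ → (Fin k.1 → E d) →ᵇ ℝ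
  W_mem : ∀ k l, W k l ∈ transInv d k.1
  abs_W_le : ∀ k l y, |W k l y| ≤ 1
  W_dense : ∀ k, transInv d k.1 ≤ (Submodule.span ℝ (Set.range (W k))).topologicalClosure
  enum : ℕ → ℕ × {k : ℕ // 2 ≤ k} × ℕ
  enum_surjective : Function.Surjective enum

section Functional

variable {X : Type*} [TopologicalSpace X] [MeasurableSpace X] {d : ℕ}

/-- `∫ f(x₁) ⋯ f(x_k) W(y₁, …, y_k) ∏ λ(dx_i, dy_i)` for a measure `λ`. -/
def SubProb.integral (f : X →ᵇ ℝ) {k : ℕ} (W : (Fin k → E d) →ᵇ ℝ) (l : SubProb X d) : ℝ :=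
  ∫ z : Fin k → X × E d, (∏ i, f (z i).1) * W (fun i => (z i).2)
    ∂(Measure.pi fun _ : Fin k => l.1)

/-- The integral does not change under translations. -/
lemma SubProb.integral_translate (f : X →ᵇ ℝ) {k : ℕ} {W : (Fin k → E d) →ᵇ ℝ}
    (hW : W ∈ transInv d k) (l : SubProb X d) (a : E d) :
    (l.translate a).integral f W = l.integral f W := by
  have hpi : (Measure.pi fun _ : Fin k => (l.translate a).1)
      = (Measure.pi fun _ : Fin k => l.1).map
          (MeasurableEquiv.piCongrRight fun _ : Fin k => shift (X := X) a) := by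
    have h := Measure.pi_map_pi (μ := fun _ : Fin k => l.1)
      (f := fun _ : Fin k => (shift (X := X) a : X × E d → X × E d))
      (hμ := fun _ => inferInstanceAs (SigmaFinite (l.translate a).1))
      (fun _ => (shift (X := X) a).measurable.aemeasurable)
    exact h.symm
  unfold SubProb.integral
  rw [hpi, integral_map_equiv]
  congr 1
  funext z
  have h2 := hW.1 a (fun i => (z i).2)
  simp only [MeasurableEquiv.piCongrRight, MeasurableEquiv.coe_mk, Equiv.piCongrRight_apply,
    Pi.map_apply, MeasurableEquiv.coe_toEquiv, shift_apply]
  rw [h2]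

/-- The integral as a function of the orbit. -/
def Orbit.integral (f : X →ᵇ ℝ) {k : ℕ} (W : transInv d k) (o : Orbit X d) : ℝ :=
  Quotient.lift (s := orbitSetoid X d) (fun l => l.integral f W.1) (by
    rintro l _ ⟨a, rfl⟩
    exact (SubProb.integral_translate f W.2 l a).symm) o

/-- `Λ_{f,W}(ξ)`: the sum of the integrals over all members of `ξ`, with multiplicity. -/
def Configuration.functional (f : X →ᵇ ℝ) {k : ℕ} (W : transInv d k)
    (T : Configuration X d) : ℝ :=
  ∑' o : Orbit X d, (T.mult o : ℝ) * o.integral f W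

lemma Orbit.abs_integral_le {f : X →ᵇ ℝ} (hf : ∀ x, |f x| ≤ 1) {k : ℕ} (hk : 1 ≤ k)
    (W : transInv d k) (hW : ∀ y, |W.1 y| ≤ 1) (o : Orbit X d) :
    |o.integral f W| ≤ (o.marginal Set.univ).toReal := by
  induction o using Quotient.inductionOn with
  | h l =>
    change |l.integral f W.1| ≤ ((l.1.map Prod.fst) Set.univ).toReal
    rw [Measure.map_apply measurable_fst MeasurableSet.univ, Set.preimage_univ]
    have h1 : ‖l.integral f W.1‖ ≤ 1 * (Measure.pi fun _ : Fin k => l.1).real Set.univ := by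
      unfold SubProb.integral
      refine norm_integral_le_of_norm_le_const (ae_of_all _ fun z => ?_)
      rw [Real.norm_eq_abs, abs_mul, Finset.abs_prod]
      have h2 : ∏ i : Fin k, |f (z i).1| ≤ 1 :=
        Finset.prod_le_one (fun i _ => abs_nonneg _) (fun i _ => hf _)
      exact mul_le_one₀ h2 (abs_nonneg _) (hW _)
    rw [Real.norm_eq_abs, one_mul, measureReal_def, Measure.pi_univ] at h1
    refine h1.trans ?_
    simp only [Finset.prod_const, Finset.card_univ, Fintype.card_fin]
    refine ENNReal.toReal_mono (measure_ne_top _ _) ?_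
    calc l.1 Set.univ ^ k ≤ l.1 Set.univ ^ 1 := pow_le_pow_right_of_le_one' l.2 hk
      _ = l.1 Set.univ := pow_one _

lemma Configuration.abs_functional_le {f : X →ᵇ ℝ} (hf : ∀ x, |f x| ≤ 1) {k : ℕ} (hk : 1 ≤ k)
    (W : transInv d k) (hW : ∀ y, |W.1 y| ≤ 1) (T : Configuration X d) :
    |T.functional f W| ≤ 1 := by
  have h := T.summable_mass
  unfold Configuration.functional
  rw [← Real.norm_eq_abs]
  refine le_trans (tsum_of_norm_bounded h.1.hasSum fun o => ?_) h.2
  rw [Real.norm_eq_abs, abs_mul, Nat.abs_cast]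
  exact mul_le_mul_of_nonneg_left (o.abs_integral_le hf hk W hW) (Nat.cast_nonneg _)

end Functional

namespace TestFamily

variable {X : Type*} [TopologicalSpace X] [MeasurableSpace X] [OpensMeasurableSpace X] {d : ℕ}

/-- `Λ_{f_r, W_r}(ξ)` for the `r`-th combination `(f_r, W_r)`. -/
def term (S : TestFamily X d) (r : ℕ) (T : Configuration X d) : ℝ :=
  T.functional (S.f (S.enum r).1)
    (⟨S.W (S.enum r).2.1 (S.enum r).2.2, S.W_mem _ _⟩ : transInv d (S.enum r).2.1.1)

/-- The distance `𝐃⋆` between the collections of orbits. -/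
def orbitDist (S : TestFamily X d) (T₁ T₂ : Configuration X d) : ℝ :=
  ∑' r : ℕ, (1 / 2 : ℝ) ^ (r + 1) * |S.term r T₁ - S.term r T₂|

/-- The distance between probability measures on `X`. -/
def probDist (S : TestFamily X d) (b₁ b₂ : ProbabilityMeasure X) : ℝ :=
  ∑' j : ℕ, (1 / 2 : ℝ) ^ (j + 1) *
    |∫ x, S.f j x ∂(b₁ : Measure X) - ∫ x, S.f j x ∂(b₂ : Measure X)|

/-- The distance `𝒟` between pairs `[ξ, β]`. -/
def pairDist (S : TestFamily X d) (T₁ T₂ : Configuration X d) : ℝ :=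
  S.orbitDist T₁ T₂ + S.probDist T₁.β T₂.β

/-- The listed set of functions on `X` contains the constant `1` and is closed under midpoints. -/
def MidpointClosed (S : TestFamily X d) : Prop :=
  (∃ j, ∀ x, S.f j x = 1) ∧ ∀ i j, ∃ l, ∀ x, S.f l x = (S.f i x + S.f j x) / 2

lemma abs_term_le (S : TestFamily X d) (r : ℕ) (T : Configuration X d) : |S.term r T| ≤ 1 :=
  T.abs_functional_le (S.abs_f_le _) (by have := (S.enum r).2.1.2; omega) _ (S.abs_W_le _ _)

lemma abs_integral_le (S : TestFamily X d) (j : ℕ) (b : ProbabilityMeasure X) :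
    |∫ x, S.f j x ∂(b : Measure X)| ≤ 1 := by
  have h := norm_integral_le_of_norm_le_const (μ := (b : Measure X)) (f := fun x => S.f j x)
    (C := 1) (ae_of_all _ fun x => by simpa using S.abs_f_le j x)
  simpa using h

lemma summable_weighted {u v : ℕ → ℝ} (hu : ∀ r, |u r| ≤ 1) (hv : ∀ r, |v r| ≤ 1) :
    Summable fun r : ℕ => (1 / 2 : ℝ) ^ (r + 1) * |u r - v r| := by
  have hs : Summable fun r : ℕ => (1 / 2 : ℝ) ^ (r + 1) * 2 :=
    ((summable_nat_add_iff 1).2 summable_geometric_two).mul_right 2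
  refine Summable.of_nonneg_of_le (fun r => by positivity) (fun r => ?_) hs
  refine mul_le_mul_of_nonneg_left ?_ (by positivity)
  have h := abs_sub (u r) (v r)
  linarith [hu r, hv r]

lemma weighted_triangle {u v w : ℕ → ℝ} (hu : ∀ r, |u r| ≤ 1) (hv : ∀ r, |v r| ≤ 1)
    (hw : ∀ r, |w r| ≤ 1) :
    ∑' r : ℕ, (1 / 2 : ℝ) ^ (r + 1) * |u r - w r| ≤
      ∑' r : ℕ, (1 / 2 : ℝ) ^ (r + 1) * |u r - v r| +
      ∑' r : ℕ, (1 / 2 : ℝ) ^ (r + 1) * |v r - w r| := by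
  rw [← (summable_weighted hu hv).tsum_add (summable_weighted hv hw)]
  refine (summable_weighted hu hw).tsum_le_tsum (fun r => ?_)
    ((summable_weighted hu hv).add (summable_weighted hv hw))
  rw [← mul_add]
  exact mul_le_mul_of_nonneg_left (abs_sub_le _ _ _) (by positivity)

/-- The space `𝒳` of pairs `[ξ, β]`, equipped with the distance `𝒟` of the family `S`. -/
def Space (_S : TestFamily X d) : Type _ := Configuration X d

/-- The component `β` of an element `[ξ, β]`. -/
def Space.β {S : TestFamily X d} (T : S.Space) : ProbabilityMeasure X := Configuration.β T

/-- `𝒟` is a finite pseudometric for every test family. Whether points at distance `0` are equal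
is not part of this instance. -/
instance (S : TestFamily X d) : PseudoMetricSpace S.Space where
  dist T₁ T₂ := S.pairDist T₁ T₂
  dist_self T := by simp [pairDist, orbitDist, probDist]
  dist_comm T₁ T₂ := by
    simp only [pairDist, orbitDist, probDist]
    congr 2
    · funext r
      rw [abs_sub_comm]
    · funext r
      rw [abs_sub_comm]
  dist_triangle T₁ T₂ T₃ := by
    have h1 := weighted_triangle (S.abs_term_le · T₁) (S.abs_term_le · T₂) (S.abs_term_le · T₃)
    have h2 := weighted_triangle (S.abs_integral_le · (Configuration.β T₁))
      (S.abs_integral_le · (Configuration.β T₂)) (S.abs_integral_le · (Configuration.β T₃))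
    simp only [pairDist, orbitDist, probDist]
    linarith

/-- `𝒳` carries its Borel σ-algebra. -/
instance (S : TestFamily X d) : MeasurableSpace S.Space := borel S.Space

instance (S : TestFamily X d) : BorelSpace S.Space := ⟨rfl⟩

end TestFamily

end OrbitCompactification

end

/-! Separation of points. If `𝒟` vanishes, the functionals agree on the listed kernels, hence on
`ℭ_k` by density and on all bounded continuous invariant kernels by truncation
(`tsum_integral_eq_of_transInv`). Fix a weight `f ≥ 0` of the family. To a point `y` chosen by `f(x)
λ(dx, dy)` attach the image of `f λ` on `ℝᵈ`, translated so that `y` becomes the origin and recorded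
by its characteristic function. Summed over the collection, the law of this profile has moments that
are functionals of products of functions of differences, so it is determined (`profileLaw_eq`). The
profiles of one measure `r` form an orbit, and the mass of that orbit counts, with factor `(∫ f
dr)²`, the members whose `f`-image is a translate of that of `r` (`tsum_weightEquiv_eq`).

It remains to choose `f` so that this equivalence singles out the orbit of `r`. If two measures are
equivalent for infinitely many weights on a segment, one translation serves the whole segment
(`exists_common_character`): the relation `χ(2u) = χ(u)²` eliminates the unknown characters and
leaves a polynomial identity. Hence distinct orbits are separated by some weight, and all but
finitely many dyadic points between two weights separate whatever either endpoint separates. Closure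
under midpoints keeps these points in the family (`exists_separating_finset`), and only finitely
many members are heavy enough to need separating.

Compactness is a concentration-compactness argument along an ultrafilter. In each collection a
greedy choice of centres leaves a residual with little mass in any unit ball (`exists_greedy`,
`exists_centres`). Recentred measures have vague limits, obtained from Prokhorov's theorem after
compactifying `ℝᵈ` (`exists_vague_limit`). Centres in the same measure at bounded distance are
identified, and one limit measure is kept per class. A kernel of finite range barely sees the
residual, and its remaining pieces live near single centres, so the functionals converge
(`tendsto_tsum_integral`). Separated centres occupy disjoint balls, which preserves the bound by `β`
(`tsum_limitFamily_marginal_le`).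

The statement on laws follows because `β` is continuous on `𝒳` and preimages of compact sets under
it are compact. Suitable test families are built from separability of `ℭ_k` and the midpoint closure
of a countable convergence-determining set. -/

noncomputable section

set_option linter.unusedSectionVars false

namespace OrbitCompactification

/-! ### Integrals of kernels against powers of a measure -/

section TensorIntegral

variable {X : Type*} [TopologicalSpace X] [MeasurableSpace X] [OpensMeasurableSpace X] {d : ℕ}

/-- The total mass of a sub-probability measure. -/
def SubProb.mass (l : SubProb X d) : ℝ := l.1.real Set.univ

lemma SubProb.mass_nonneg (l : SubProb X d) : 0 ≤ l.mass := measureReal_nonneg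

lemma SubProb.mass_le_one (l : SubProb X d) : l.mass ≤ 1 := by
  unfold SubProb.mass Measure.real
  simpa using ENNReal.toReal_mono ENNReal.one_ne_top l.2

lemma SubProb.integrable_tensor (f : X →ᵇ ℝ) {k : ℕ} (W : (Fin k → E d) →ᵇ ℝ)
    (l : SubProb X d) :
    Integrable (fun z : Fin k → X × E d => (∏ i, f (z i).1) * W (fun i => (z i).2))
      (Measure.pi fun _ : Fin k => l.1) := by
  refine Integrable.of_bound (C := ‖f‖ ^ k * ‖W‖) ?_ (ae_of_all _ fun z => ?_)
  · have h1 : Measurable fun z : Fin k → X × E d => ∏ i, f (z i).1 :=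
      Finset.measurable_prod _ fun i _ =>
        f.continuous.measurable.comp (measurable_fst.comp (measurable_pi_apply i))
    have h2 : Measurable fun z : Fin k → X × E d => W (fun i => (z i).2) :=
      W.continuous.measurable.comp
        (measurable_pi_lambda _ fun i => measurable_snd.comp (measurable_pi_apply i))
    exact (h1.mul h2).aestronglyMeasurable
  · rw [norm_mul, norm_prod]
    refine mul_le_mul ?_ (W.norm_coe_le_norm _) (norm_nonneg _) (by positivity)
    refine (Finset.prod_le_prod (fun _ _ => norm_nonneg _)
      (fun i _ => f.norm_coe_le_norm _)).trans ?_
    simp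

lemma SubProb.integral_add (f : X →ᵇ ℝ) {k : ℕ} (V W : (Fin k → E d) →ᵇ ℝ) (l : SubProb X d) :
    l.integral f (V + W) = l.integral f V + l.integral f W := by
  unfold SubProb.integral
  rw [← MeasureTheory.integral_add (l.integrable_tensor f V) (l.integrable_tensor f W)]
  simp [mul_add]

lemma SubProb.integral_smul (f : X →ᵇ ℝ) {k : ℕ} (c : ℝ) (W : (Fin k → E d) →ᵇ ℝ)
    (l : SubProb X d) : l.integral f (c • W) = c * l.integral f W := by
  unfold SubProb.integral
  rw [← integral_const_mul]
  congr 1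
  funext z
  simp
  ring

/-- The integral against a fixed measure, as a linear functional of the kernel. -/
def SubProb.integralₗ (f : X →ᵇ ℝ) (k : ℕ) (l : SubProb X d) : ((Fin k → E d) →ᵇ ℝ) →ₗ[ℝ] ℝ where
  toFun W := l.integral f W
  map_add' V W := l.integral_add f V W
  map_smul' c W := l.integral_smul f c W

lemma SubProb.integral_sub (f : X →ᵇ ℝ) {k : ℕ} (V W : (Fin k → E d) →ᵇ ℝ) (l : SubProb X d) :
    l.integral f (V - W) = l.integral f V - l.integral f W :=
  map_sub (l.integralₗ f k) V W

lemma SubProb.integral_zero (f : X →ᵇ ℝ) {k : ℕ} (l : SubProb X d) :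
    l.integral f (0 : (Fin k → E d) →ᵇ ℝ) = 0 :=
  map_zero (l.integralₗ f k)

lemma SubProb.integral_sum (f : X →ᵇ ℝ) {k : ℕ} {ι : Type*} (s : Finset ι)
    (W : ι → (Fin k → E d) →ᵇ ℝ) (l : SubProb X d) :
    l.integral f (∑ i ∈ s, W i) = ∑ i ∈ s, l.integral f (W i) :=
  map_sum (l.integralₗ f k) W s

lemma SubProb.mass_pi_le (l : SubProb X d) {k : ℕ} (hk : 0 < k) :
    (Measure.pi fun _ : Fin k => l.1).real Set.univ ≤ l.mass := by
  unfold SubProb.mass Measure.real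
  refine ENNReal.toReal_mono (measure_ne_top _ _) ?_
  rw [Measure.pi_univ]
  simp only [Finset.prod_const, Finset.card_univ, Fintype.card_fin]
  calc l.1 Set.univ ^ k ≤ l.1 Set.univ ^ 1 := pow_le_pow_right_of_le_one' l.2 hk
    _ = l.1 Set.univ := pow_one _

lemma SubProb.abs_integral_le {f : X →ᵇ ℝ} (hf : ∀ x, |f x| ≤ 1) {k : ℕ} (hk : 0 < k)
    {W : (Fin k → E d) →ᵇ ℝ} {C : ℝ} (hW : ∀ y, |W y| ≤ C) (l : SubProb X d) :
    |l.integral f W| ≤ C * l.mass := by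
  have hC : 0 ≤ C := (abs_nonneg _).trans (hW 0)
  have h1 : ‖l.integral f W‖ ≤ C * (Measure.pi fun _ : Fin k => l.1).real Set.univ := by
    unfold SubProb.integral
    refine norm_integral_le_of_norm_le_const (ae_of_all _ fun z => ?_)
    rw [Real.norm_eq_abs, abs_mul, Finset.abs_prod]
    have h2 : ∏ i : Fin k, |f (z i).1| ≤ 1 :=
      Finset.prod_le_one (fun i _ => abs_nonneg _) (fun i _ => hf _)
    calc _ ≤ 1 * C := mul_le_mul h2 (hW _) (abs_nonneg _) zero_le_one
      _ = C := one_mul C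
  exact h1.trans (mul_le_mul_of_nonneg_left (l.mass_pi_le hk) hC)

end TensorIntegral

/-! ### Collections of orbits as sequences of measures -/

section Orbits

variable {X : Type*} [MeasurableSpace X] {d : ℕ}

instance : Zero (SubProb X d) := ⟨⟨0, by simp⟩⟩

@[simp] lemma SubProb.coe_zero : ((0 : SubProb X d).1 : Measure (X × E d)) = 0 := rfl

lemma orbit_eq_iff {l m : SubProb X d} : orbit l = orbit m ↔ ∃ a, m = l.translate a :=
  Quotient.eq (r := orbitSetoid X d)

lemma orbit_eq_zeroOrbit_iff {l : SubProb X d} : orbit l = zeroOrbit ↔ l = 0 := by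
  constructor
  · intro h
    obtain ⟨a, ha⟩ := orbit_eq_iff.1 h.symm
    rw [ha]
    apply Subtype.ext
    simp [SubProb.translate]
  · rintro rfl
    rfl

lemma marginal_orbit (l : SubProb X d) : (orbit l).marginal = l.1.map Prod.fst := rfl

lemma marginal_orbit_univ (l : SubProb X d) : (orbit l).marginal Set.univ = l.1 Set.univ := by
  rw [marginal_orbit, Measure.map_apply measurable_fst MeasurableSet.univ, Set.preimage_univ]

lemma marginal_zeroOrbit : (zeroOrbit : Orbit X d).marginal = 0 := by
  change Measure.map Prod.fst (0 : Measure (X × E d)) = 0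
  simp

/-- The sequence `ℓ` of sub-probability measures lists the members of the collection of orbits
of `T`, possibly interspersed with zero measures. -/
def Represents (T : Configuration X d) (l : ℕ → SubProb X d) : Prop :=
  ∀ o : Orbit X d, o ≠ zeroOrbit →
    {j | orbit (l j) = o}.Finite ∧ T.mult o = {j | orbit (l j) = o}.ncard

lemma tsum_const_fiber {α : Type*} (s : Set α) (hs : s.Finite) (c : ℝ≥0∞) :
    ∑' _ : s, c = (s.ncard : ℝ≥0∞) * c := by
  have := hs.fintype
  rw [tsum_fintype, Finset.sum_const, Set.ncard_eq_toFinset_card', nsmul_eq_mul]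
  simp

/-- The fibre over the zero orbit may be infinite; it contributes nothing because `F` vanishes
there. -/
lemma Represents.tsum_mul {T : Configuration X d} {l : ℕ → SubProb X d} (h : Represents T l)
    {F : Orbit X d → ℝ≥0∞} (hF : F zeroOrbit = 0) :
    ∑' o, (T.mult o : ℝ≥0∞) * F o = ∑' j, F (orbit (l j)) := by
  rw [← ENNReal.tsum_fiberwise (fun j => F (orbit (l j))) (fun j => orbit (l j))]
  refine tsum_congr fun o => ?_
  have h1 : ∀ b : (fun j => orbit (l j)) ⁻¹' {o}, F (orbit (l b)) = F o := fun b => by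
    rw [show orbit (l b) = o from b.2]
  simp only [h1]
  by_cases ho : o = zeroOrbit
  · simp [ho, hF]
  · rw [(h o ho).2]
    exact (tsum_const_fiber _ (h o ho).1 _).symm

lemma Represents.tsum_mul_real {T : Configuration X d} {l : ℕ → SubProb X d} (h : Represents T l)
    {F : Orbit X d → ℝ} (hF : F zeroOrbit = 0) (hs : Summable fun j => F (orbit (l j))) :
    ∑' o, (T.mult o : ℝ) * F o = ∑' j, F (orbit (l j)) := by
  have h2 := (hs.hasSum.tsum_fiberwise (fun j => orbit (l j))).tsum_eq
  rw [← h2]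
  refine tsum_congr fun o => ?_
  have h1 : ∀ b : (fun j => orbit (l j)) ⁻¹' {o}, F (orbit (l b)) = F o := fun b => by
    rw [show orbit (l b) = o from b.2]
  simp only [h1]
  by_cases ho : o = zeroOrbit
  · simp [ho, hF]
  · have := (h o ho).1.fintype
    rw [(h o ho).2]
    have h3 : ((fun j => orbit (l j)) ⁻¹' {o}) = {j | orbit (l j) = o} := rfl
    rw [h3, tsum_fintype, Finset.sum_const, Set.ncard_eq_toFinset_card', nsmul_eq_mul]
    simp

lemma Represents.tsum_marginal_le {T : Configuration X d} {l : ℕ → SubProb X d}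
    (h : Represents T l) {A : Set X} (hA : MeasurableSet A) :
    ∑' j, (l j).1.map Prod.fst A ≤ (T.β : Measure X) A := by
  refine le_trans (le_of_eq ?_) (T.sum_marginal_le A hA)
  exact (h.tsum_mul (F := fun o => o.marginal A) (by simp [marginal_zeroOrbit])).symm

lemma tsum_mass_le {l : ℕ → SubProb X d} {b : ProbabilityMeasure X}
    (h : ∀ A, MeasurableSet A → ∑' j, (l j).1.map Prod.fst A ≤ (b : Measure X) A) :
    ∑' j, (l j).1 Set.univ ≤ 1 := by
  have h := h _ MeasurableSet.univ
  simpa [Measure.map_apply measurable_fst MeasurableSet.univ] using h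

/-- Each orbit is repeated according to its multiplicity; all remaining indices receive the zero
measure, so finite collections are sequences as well. -/
lemma exists_represents (T : Configuration X d) : ∃ l, Represents T l := by
  classical
  let ι := Σ o : Function.support T.mult, Fin (T.mult o)
  have : Countable (Function.support T.mult) := T.countable_support
  have : Countable ι := inferInstance
  obtain ⟨e, he⟩ := exists_injective_nat ι
  let rep : ι → SubProb X d := fun p => Quotient.out p.1.1
  have hrep : ∀ p : ι, orbit (rep p) = p.1.1 := fun p => Quotient.out_eq p.1.1
  refine ⟨Function.extend e rep 0, fun o ho => ?_⟩
  have h0 : ∀ j, j ∉ Set.range e → orbit (Function.extend e rep 0 j) = (zeroOrbit : Orbit X d) := by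
    intro j hj
    rw [Function.extend_apply' _ _ _ (by simpa using hj)]
    rfl
  by_cases hm : T.mult o = 0
  · have : {j | orbit (Function.extend e rep 0 j) = o} = ∅ := by
      ext j
      simp only [Set.mem_ofPred_eq, Set.mem_empty_iff_false, iff_false]
      intro hj
      by_cases hr : j ∈ Set.range e
      · obtain ⟨p, rfl⟩ := hr
        rw [he.extend_apply, hrep] at hj
        exact p.1.2 (by rw [hj]; exact hm)
      · exact ho (hj ▸ h0 j hr)
    rw [this]
    simp [hm]
  · have : {j | orbit (Function.extend e rep 0 j) = o}
        = Set.range fun i : Fin (T.mult o) => e ⟨⟨o, hm⟩, i⟩ := by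
      ext j
      simp only [Set.mem_ofPred_eq, Set.mem_range]
      constructor
      · intro hj
        by_cases hr : j ∈ Set.range e
        · obtain ⟨⟨⟨o', ho'⟩, i⟩, rfl⟩ := hr
          rw [he.extend_apply, hrep] at hj
          obtain rfl : o' = o := hj
          exact ⟨i, rfl⟩
        · exact absurd (hj ▸ h0 j hr) ho
      · rintro ⟨i, rfl⟩
        rw [he.extend_apply, hrep]
    rw [this]
    refine ⟨Set.finite_range _, ?_⟩
    rw [← Set.image_univ, Set.ncard_image_of_injective _ (fun i j hij => by
      injection he hij)]
    simp

/-- Multiplicities are finite because all occurrences of a non-zero orbit have the same positive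
mass and the total mass is at most `1`. -/
lemma exists_configuration (l : ℕ → SubProb X d) (b : ProbabilityMeasure X)
    (h : ∀ A, MeasurableSet A → ∑' j, (l j).1.map Prod.fst A ≤ (b : Measure X) A) :
    ∃ T : Configuration X d, T.β = b ∧ Represents T l := by
  classical
  have hfin : ∀ o : Orbit X d, o ≠ zeroOrbit → {j | orbit (l j) = o}.Finite := by
    intro o ho
    have h1 : ∑' j, (l j).1 Set.univ ≠ ∞ := ne_top_of_le_ne_top ENNReal.one_ne_top (tsum_mass_le h)
    have h2 : o.marginal Set.univ ≠ 0 := by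
      obtain ⟨m, rfl⟩ : ∃ m, orbit m = o := ⟨Quotient.out o, Quotient.out_eq o⟩
      rw [marginal_orbit_univ]
      intro h3
      refine ho (orbit_eq_zeroOrbit_iff.2 (Subtype.ext ?_))
      exact Measure.measure_univ_eq_zero.1 h3
    refine (ENNReal.finite_const_le_of_tsum_ne_top h1 h2).subset fun j hj => ?_
    simp only [Set.mem_ofPred_eq] at hj ⊢
    rw [← marginal_orbit_univ, hj]
  let m : Orbit X d → ℕ := fun o => if o = zeroOrbit then 0 else {j | orbit (l j) = o}.ncard
  have hsupp : (Function.support m).Countable := by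
    refine (Set.countable_range fun j => orbit (l j)).mono fun o ho => ?_
    by_contra hc
    apply ho
    by_cases hz : o = zeroOrbit
    · simp [m, hz]
    · have : {j | orbit (l j) = o} = ∅ := by
        ext j
        simp only [Set.mem_ofPred_eq, Set.mem_empty_iff_false, iff_false]
        exact fun hj => hc ⟨j, hj⟩
      simp [m, this]
  have hle : ∀ A : Set X, MeasurableSet A →
      ∑' o : Orbit X d, (m o : ℝ≥0∞) * o.marginal A ≤ (b : Measure X) A := by
    intro A hA
    refine le_trans (le_of_eq ?_) (h A hA)
    rw [← ENNReal.tsum_fiberwise (fun j => (l j).1.map Prod.fst A) (fun j => orbit (l j))]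
    refine tsum_congr fun o => ?_
    have h1 : ∀ j : (fun j => orbit (l j)) ⁻¹' {o}, (l j).1.map Prod.fst A = o.marginal A :=
      fun j => congrArg (fun o : Orbit X d => o.marginal A) (show orbit (l j) = o from j.2)
    simp only [h1]
    by_cases ho : o = zeroOrbit
    · simp [ho, marginal_zeroOrbit]
    · simp only [m, if_neg ho]
      exact (tsum_const_fiber _ (hfin o ho) _).symm
  refine ⟨⟨m, by simp [m], hsupp, b, hle⟩, rfl, fun o ho => ⟨hfin o ho, ?_⟩⟩
  simp [m, ho]

end Orbits

/-! ### The functionals in terms of representing sequences -/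

section Functional

variable {X : Type*} [TopologicalSpace X] [MeasurableSpace X] [OpensMeasurableSpace X] {d : ℕ}

lemma SubProb.ofReal_mass (l : SubProb X d) : ENNReal.ofReal l.mass = l.1 Set.univ :=
  ENNReal.ofReal_toReal (measure_ne_top _ _)

lemma summable_mass {l : ℕ → SubProb X d} (h : ∑' j, (l j).1 Set.univ ≤ 1) :
    Summable (fun j => (l j).mass) ∧ ∑' j, (l j).mass ≤ 1 := by
  have hne : ∑' j, (l j).1 Set.univ ≠ ∞ := ne_top_of_le_ne_top ENNReal.one_ne_top h
  refine ⟨ENNReal.summable_toReal hne, ?_⟩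
  change ∑' j, ((l j).1 Set.univ).toReal ≤ 1
  rw [← ENNReal.tsum_toReal_eq (fun j => measure_ne_top _ _)]
  simpa using ENNReal.toReal_mono ENNReal.one_ne_top h

lemma abs_le_norm_apply {k : ℕ} (W : (Fin k → E d) →ᵇ ℝ) (y : Fin k → E d) : |W y| ≤ ‖W‖ :=
  W.norm_coe_le_norm y

lemma summable_integral {l : ℕ → SubProb X d} (h : ∑' j, (l j).1 Set.univ ≤ 1) {f : X →ᵇ ℝ}
    (hf : ∀ x, |f x| ≤ 1) {k : ℕ} (hk : 0 < k) (W : (Fin k → E d) →ᵇ ℝ) :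
    Summable fun j => (l j).integral f W :=
  Summable.of_norm_bounded ((summable_mass h).1.mul_left ‖W‖) fun j =>
    (l j).abs_integral_le hf hk (abs_le_norm_apply W)

lemma abs_tsum_integral_le {l : ℕ → SubProb X d} (h : ∑' j, (l j).1 Set.univ ≤ 1) {f : X →ᵇ ℝ}
    (hf : ∀ x, |f x| ≤ 1) {k : ℕ} (hk : 0 < k) {W : (Fin k → E d) →ᵇ ℝ} {C : ℝ}
    (hW : ∀ y, |W y| ≤ C) : |∑' j, (l j).integral f W| ≤ C := by
  have hC : 0 ≤ C := (abs_nonneg _).trans (hW 0)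
  have h1 := tsum_of_norm_bounded (f := fun j => (l j).integral f W)
    ((summable_mass h).1.mul_left C).hasSum fun j => (l j).abs_integral_le hf hk hW
  rw [tsum_mul_left] at h1
  exact h1.trans (by nlinarith [(summable_mass h).2])

lemma Represents.functional_eq {T : Configuration X d} {l : ℕ → SubProb X d}
    (h : Represents T l) {f : X →ᵇ ℝ} (hf : ∀ x, |f x| ≤ 1) {k : ℕ} (hk : 0 < k)
    (W : transInv d k) : T.functional f W = ∑' j, (l j).integral f W.1 := by
  refine h.tsum_mul_real (F := fun o => o.integral f W) ?_ ?_
  · have h1 := (0 : SubProb X d).abs_integral_le hf hk (abs_le_norm_apply W.1)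
    have h2 : (0 : SubProb X d).mass = 0 := by simp [SubProb.mass]
    rw [h2, mul_zero] at h1
    exact abs_eq_zero.1 (le_antisymm h1 (abs_nonneg _))
  · exact summable_integral (tsum_mass_le fun A hA => h.tsum_marginal_le hA) hf hk W.1

end Functional

/-! ### Characters of `ℝᵈ` along segments of functions -/

section Characters

variable {d : ℕ}

/-- The character `t ↦ exp (i ⟨c, t⟩)` of `ℝᵈ`. -/
def expInner (c t : E d) : ℂ := Complex.exp ((inner ℝ c t : ℝ) * Complex.I)

lemma continuous_expInner (c : E d) : Continuous (expInner c) := by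
  unfold expInner
  fun_prop

lemma expInner_add_left (b c t : E d) : expInner (b + c) t = expInner b t * expInner c t := by
  unfold expInner
  rw [← Complex.exp_add, inner_add_left]
  push_cast
  ring_nf

lemma expInner_add_right (c s t : E d) : expInner c (s + t) = expInner c s * expInner c t := by
  unfold expInner
  rw [← Complex.exp_add, inner_add_right]
  push_cast
  ring_nf

@[simp] lemma expInner_zero_left (t : E d) : expInner 0 t = 1 := by simp [expInner]

@[simp] lemma expInner_zero_right (c : E d) : expInner c 0 = 1 := by simp [expInner]

lemma expInner_neg_mul (c t : E d) : expInner (-c) t * expInner c t = 1 := by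
  rw [← expInner_add_left]
  simp

lemma norm_expInner (c t : E d) : ‖expInner c t‖ = 1 := Complex.norm_exp_ofReal_mul_I _

lemma expInner_nsmul_right (c t : E d) (n : ℕ) : expInner c (n • t) = expInner c t ^ n := by
  induction n with
  | zero => simp
  | succ n ih => rw [succ_nsmul, expInner_add_right, ih, pow_succ]

/-- A character that is trivial near the origin is trivial. -/
lemma eq_zero_of_expInner_eq_one {w : E d} (h : ∀ᶠ u in 𝓝 (0 : E d), expInner w u = 1) :
    w = 0 := by
  by_contra hw
  have hw2 : ‖w‖ ^ 2 ≠ 0 := by positivity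
  -- The character takes the value `-1` at `(π / ‖w‖²) • w`, but a small fraction of this vector has
  -- value `1`, and so have its multiples.
  have hlim : Tendsto (fun n : ℕ => ((n : ℝ)⁻¹) • ((Real.pi / ‖w‖ ^ 2) • w)) atTop (𝓝 0) := by
    have h1 : Tendsto (fun n : ℕ => ((n : ℝ)⁻¹)) atTop (𝓝 0) := tendsto_inv_atTop_nhds_zero_nat
    simpa using h1.smul_const ((Real.pi / ‖w‖ ^ 2) • w)
  obtain ⟨n, hn, hn0⟩ := ((hlim.eventually h).and (eventually_gt_atTop 0)).exists
  have h2 := expInner_nsmul_right w (((n : ℝ)⁻¹) • ((Real.pi / ‖w‖ ^ 2) • w)) n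
  have h3 : n • (((n : ℝ)⁻¹) • ((Real.pi / ‖w‖ ^ 2) • w)) = (Real.pi / ‖w‖ ^ 2) • w := by
    have : (n : ℝ) ≠ 0 := by positivity
    rw [← Nat.cast_smul_eq_nsmul ℝ, smul_smul, mul_inv_cancel₀ this, one_smul]
  rw [hn, one_pow, h3] at h2
  unfold expInner at h2
  rw [inner_smul_right, real_inner_self_eq_norm_sq, div_mul_cancel₀ _ hw2, Complex.exp_pi_mul_I]
    at h2
  norm_num at h2

/-- The cubic identity `(N₁ + h D₁')² (N₂ + h D₂) = (N₁ + h D₁)² (N₂ + h D₂')`, holding for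
infinitely many `h`, forces `D₁' = D₁`. -/
lemma eq_of_cubic_identity {N₁ N₂ D₁ D₁' D₂ D₂' : ℂ} (h₁ : N₁ ≠ 0) (h₂ : N₂ ≠ 0) {H : Set ℂ}
    (hH : H.Infinite)
    (h : ∀ x ∈ H, (N₁ + x * D₁') ^ 2 * (N₂ + x * D₂) = (N₁ + x * D₁) ^ 2 * (N₂ + x * D₂')) :
    D₁' = D₁ := by
  open Polynomial in
  have hpoly : ((C N₁ + X * C D₁') ^ 2 * (C N₂ + X * C D₂) : ℂ[X])
      = (C N₁ + X * C D₁) ^ 2 * (C N₂ + X * C D₂') := by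
    refine Polynomial.eq_of_infinite_eval_eq _ _ (hH.mono fun x hx => ?_)
    simp only [Polynomial.eval_mul, Polynomial.eval_add, Polynomial.eval_pow, Polynomial.eval_C,
      Polynomial.eval_X]
    exact h x hx
  have hall : ∀ x : ℂ, (N₁ + x * D₁') ^ 2 * (N₂ + x * D₂)
      = (N₁ + x * D₁) ^ 2 * (N₂ + x * D₂') := fun x => by
    simpa only [Polynomial.eval_mul, Polynomial.eval_add, Polynomial.eval_pow, Polynomial.eval_C,
      Polynomial.eval_X] using congrArg (Polynomial.eval x) hpoly
  -- Normalising by `N₁` and `N₂` leaves `(1 + x p')² (1 + x q) = (1 + x p)² (1 + x q')`.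
  obtain ⟨p, rfl⟩ : ∃ p, D₁ = N₁ * p := ⟨D₁ / N₁, by field_simp⟩
  obtain ⟨p', rfl⟩ : ∃ p, D₁' = N₁ * p := ⟨D₁' / N₁, by field_simp⟩
  obtain ⟨q, rfl⟩ : ∃ p, D₂ = N₂ * p := ⟨D₂ / N₂, by field_simp⟩
  obtain ⟨q', rfl⟩ : ∃ p, D₂' = N₂ * p := ⟨D₂' / N₂, by field_simp⟩
  have hN : N₁ ^ 2 * N₂ ≠ 0 := mul_ne_zero (pow_ne_zero _ h₁) h₂
  have hall' : ∀ x : ℂ, (1 + x * p') ^ 2 * (1 + x * q) = (1 + x * p) ^ 2 * (1 + x * q') :=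
    fun x => mul_left_cancel₀ hN (by linear_combination hall x)
  have e1 := hall' 1
  have e2 := hall' (-1)
  have e3 := hall' 2
  -- `a1`, `a2`, `a3` compare the coefficients of `x`, `x²`, `x³`, recovered from the values at `1`,
  -- `-1`, `2`.
  have a2 : p' ^ 2 + 2 * p' * q = p ^ 2 + 2 * p * q' := by linear_combination (e1 + e2) / 2
  have a3 : p' ^ 2 * q = p ^ 2 * q' := by
    linear_combination e3 / 6 - (e1 + e2) / 3 - (e1 - e2) / 6
  have a1 : 2 * p' + q = 2 * p + q' := by linear_combination (e1 - e2) / 2 - a3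
  by_contra hne
  have hne' : p' - p ≠ 0 := fun h0 => hne (by rw [sub_eq_zero.1 h0])
  -- Modulo `a1`, the relation `a2` factors as `(p' - p) (p' - 3p + 2q) = 0`; substituting into `a3`
  -- then leaves the perfect cube `b3`.
  have b1 : p' = 3 * p - 2 * q := by
    refine sub_eq_zero.1 (mul_left_cancel₀ hne' ?_)
    linear_combination a2 - 2 * p * a1
  have b2 : q' = 4 * p - 3 * q := by linear_combination -a1 + 2 * b1
  rw [b1, b2] at a3
  have b3 : (p - q) ^ 3 = 0 := by linear_combination -a3 / 4
  have b4 : p - q = 0 := pow_eq_zero_iff (by norm_num) |>.1 b3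
  exact hne' (by rw [b1]; linear_combination 2 * b4)

/-- If two segments of functions are related by characters at infinitely many points, they are
related by one character throughout. -/
lemma exists_common_character {A B A' B' : E d → ℂ} (hA : Continuous A) (hB : Continuous B)
    {S : Set ℝ} (hS : S.Infinite)
    (h0 : ∀ s ∈ S, (1 - (s : ℂ)) * A 0 + s * B 0 ≠ 0)
    (h : ∀ s ∈ S, ∃ c : E d, ∀ t, (1 - (s : ℂ)) * A' t + s * B' t
      = expInner c t * ((1 - (s : ℂ)) * A t + s * B t)) :
    ∃ c : E d, ∀ t, A' t = expInner c t * A t ∧ B' t = expInner c t * B t := by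
  choose! c hc using h
  obtain ⟨s₀, hs₀⟩ := hS.nonempty
  obtain ⟨s₁, hs₁, hne⟩ := (hS.sdiff (Set.finite_singleton s₀)).nonempty
  have hne : s₁ ≠ s₀ := hne
  -- `N` is the value at the base point `s₀`, `D` the direction of the segment, and `D'` the
  -- direction of the primed segment after the character at `s₀` has been undone.
  set N : E d → ℂ := fun t => (1 - (s₀ : ℂ)) * A t + s₀ * B t with hN
  set D : E d → ℂ := fun t => B t - A t with hD
  set D' : E d → ℂ := fun t => expInner (-(c s₀)) t * (B' t - A' t) with hD'
  have key : ∀ s ∈ S, ∀ t, N t + ((s - s₀ : ℝ) : ℂ) * D' t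
      = expInner (c s - c s₀) t * (N t + ((s - s₀ : ℝ) : ℂ) * D t) := by
    intro s hs t
    have h1 := hc s hs t
    have h2 := hc s₀ hs₀ t
    have h3 := expInner_neg_mul (c s₀) t
    rw [sub_eq_add_neg (c s), expInner_add_left]
    simp only [hN, hD, hD']
    push_cast
    linear_combination expInner (-(c s₀)) t * h1 - expInner (-(c s₀)) t * h2
      - ((1 - (s₀ : ℂ)) * A t + s₀ * B t) * h3
  have hNc : Continuous N := by fun_prop
  have hev : ∀ᶠ u in 𝓝 (0 : E d), N u ≠ 0 := hNc.continuousAt.eventually_ne (h0 s₀ hs₀)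
  have hev2 : ∀ᶠ u in 𝓝 (0 : E d), N (u + u) ≠ 0 := by
    have : Tendsto (fun u : E d => u + u) (𝓝 0) (𝓝 0) := by
      have h1 : Continuous fun u : E d => u + u := by fun_prop
      simpa using h1.tendsto 0
    exact this.eventually hev
  -- The character at `u + u` is the square of the one at `u`, so `key` at these two points
  -- eliminates `c s` and gives the cubic identity.
  have hDD : ∀ᶠ u in 𝓝 (0 : E d), D' u = D u := by
    filter_upwards [hev, hev2] with u hu hu2
    have hinj : Function.Injective fun s : ℝ => ((s - s₀ : ℝ) : ℂ) := by
      intro s t hst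
      have := Complex.ofReal_injective hst
      linarith
    refine eq_of_cubic_identity (N₁ := N u) (N₂ := N (u + u)) (D₂ := D (u + u))
      (D₂' := D' (u + u)) hu hu2 (hS.image hinj.injOn) ?_
    rintro _ ⟨s, hs, rfl⟩
    have h1 := key s hs u
    have h2 := key s hs (u + u)
    rw [expInner_add_right] at h2
    simp only
    rw [h1, h2]
    ring
  have hev3 : ∀ᶠ u in 𝓝 (0 : E d), N u + ((s₁ - s₀ : ℝ) : ℂ) * D u ≠ 0 := by
    have hcont : Continuous fun u => N u + ((s₁ - s₀ : ℝ) : ℂ) * D u := by fun_prop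
    refine hcont.continuousAt.eventually_ne ?_
    have := h0 s₁ hs₁
    simp only [hN, hD]
    push_cast
    intro h1
    exact this (by linear_combination h1)
  -- Once `D' = D` near the origin, `key` at `s₁` makes the character of `c s₁ - c s₀` trivial
  -- there.
  have hw : c s₁ - c s₀ = 0 := by
    refine eq_zero_of_expInner_eq_one ?_
    filter_upwards [hDD, hev3] with u h1 h2
    have h3 := key s₁ hs₁ u
    rw [h1] at h3
    exact (mul_right_cancel₀ h2 (by rw [one_mul]; exact h3)).symm
  have hx : ((s₁ - s₀ : ℝ) : ℂ) ≠ 0 := by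
    rw [Ne, Complex.ofReal_eq_zero]
    exact sub_ne_zero.2 hne
  refine ⟨c s₀, fun t => ?_⟩
  have h1 := key s₁ hs₁ t
  rw [hw, expInner_zero_left, one_mul] at h1
  have h2 : D' t = D t := mul_left_cancel₀ hx (add_left_cancel h1)
  have h3 := expInner_neg_mul (c s₀) t
  have h4 : B' t - A' t = expInner (c s₀) t * (B t - A t) := by
    simp only [hD, hD'] at h2
    linear_combination expInner (c s₀) t * h2 - (B' t - A' t) * h3
  have h5 := hc s₀ hs₀ t
  exact ⟨by linear_combination h5 - (s₀ : ℂ) * h4,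
    by linear_combination h5 + (1 - (s₀ : ℂ)) * h4⟩

end Characters

/-! ### Weighted characteristic functions and equivalence under a weight -/

section WeightedTransform

variable {X : Type*} [TopologicalSpace X] [MeasurableSpace X] [OpensMeasurableSpace X] {d : ℕ}

/-- The characteristic function of the image on `ℝᵈ` of `f(x) μ(dx, dy)`. -/
def weightedCharFun (μ : Measure (X × E d)) (f : X →ᵇ ℝ) (t : E d) : ℂ :=
  ∫ z, (f z.1 : ℂ) * expInner z.2 t ∂μ

lemma measurable_weight_mul (f : X →ᵇ ℝ) (t : E d) :
    Measurable fun z : X × E d => (f z.1 : ℂ) * expInner z.2 t := by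
  have h1 : Measurable fun z : X × E d => f z.1 := f.continuous.measurable.comp measurable_fst
  have h2 : Measurable fun z : X × E d => expInner z.2 t := by
    have h3 : Continuous fun y : E d => expInner y t := by
      unfold expInner
      fun_prop
    exact h3.measurable.comp measurable_snd
  exact (Complex.measurable_ofReal.comp h1).mul h2

lemma norm_weight_mul_le (f : X →ᵇ ℝ) (t : E d) (z : X × E d) :
    ‖(f z.1 : ℂ) * expInner z.2 t‖ ≤ ‖f‖ := by
  rw [norm_mul, norm_expInner, mul_one, Complex.norm_real]
  exact f.norm_coe_le_norm _

lemma integrable_weight_mul (μ : Measure (X × E d)) [IsFiniteMeasure μ] (f : X →ᵇ ℝ) (t : E d) :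
    Integrable (fun z : X × E d => (f z.1 : ℂ) * expInner z.2 t) μ :=
  Integrable.of_bound (measurable_weight_mul f t).aestronglyMeasurable ‖f‖
    (ae_of_all _ (norm_weight_mul_le f t))

lemma continuous_weightedCharFun (μ : Measure (X × E d)) [IsFiniteMeasure μ] (f : X →ᵇ ℝ) :
    Continuous (weightedCharFun μ f) := by
  refine continuous_of_dominated (bound := fun _ => ‖f‖)
    (fun t => (measurable_weight_mul f t).aestronglyMeasurable)
    (fun t => ae_of_all _ (norm_weight_mul_le f t)) (integrable_const _) (ae_of_all _ fun z => ?_)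
  exact continuous_const.mul (continuous_expInner z.2)

lemma weightedCharFun_segment (μ : Measure (X × E d)) [IsFiniteMeasure μ] {f g h : X →ᵇ ℝ} {s : ℝ}
    (hh : ∀ x, h x = (1 - s) * f x + s * g x) (t : E d) :
    weightedCharFun μ h t
      = (1 - (s : ℂ)) * weightedCharFun μ f t + s * weightedCharFun μ g t := by
  unfold weightedCharFun
  rw [← integral_const_mul, ← integral_const_mul,
    ← integral_add ((integrable_weight_mul μ f t).const_mul _)
      ((integrable_weight_mul μ g t).const_mul _)]
  congr 1
  funext z
  rw [hh]
  push_cast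
  ring

lemma weightedCharFun_zero (μ : Measure (X × E d)) (f : X →ᵇ ℝ) :
    weightedCharFun μ f 0 = ((∫ z, f z.1 ∂μ : ℝ) : ℂ) := by
  unfold weightedCharFun
  simp only [expInner_zero_right, mul_one]
  exact integral_ofReal

lemma integrable_weight (μ : Measure (X × E d)) [IsFiniteMeasure μ] (f : X →ᵇ ℝ) :
    Integrable (fun z : X × E d => f z.1) μ :=
  Integrable.of_bound (f.continuous.measurable.comp measurable_fst).aestronglyMeasurable ‖f‖
    (ae_of_all _ fun _ => f.norm_coe_le_norm _)

lemma weightedCharFun_translate (l : SubProb X d) (a : E d) (f : X →ᵇ ℝ) (t : E d) :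
    weightedCharFun (l.translate a).1 f t = expInner a t * weightedCharFun l.1 f t := by
  unfold weightedCharFun
  change ∫ z, (f z.1 : ℂ) * expInner z.2 t ∂(l.1.map (shift a)) = _
  rw [integral_map_equiv, ← integral_const_mul]
  congr 1
  funext z
  rw [shift_apply, expInner_add_left]
  ring

/-- The measure `f(x) μ(dx, dy)`. -/
def weighted (f : X →ᵇ ℝ) (μ : Measure (X × E d)) : Measure (X × E d) :=
  μ.withDensity fun z => ENNReal.ofReal (f z.1)

lemma measurable_weight (f : X →ᵇ ℝ) :
    Measurable fun z : X × E d => ENNReal.ofReal (f z.1) :=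
  ENNReal.measurable_ofReal.comp (f.continuous.measurable.comp measurable_fst)

instance (f : X →ᵇ ℝ) (μ : Measure (X × E d)) [IsFiniteMeasure μ] :
    IsFiniteMeasure (weighted f μ) :=
  isFiniteMeasure_withDensity_ofReal (integrable_weight μ f).2

lemma integral_weighted {F : Type*} [NormedAddCommGroup F] [NormedSpace ℝ F] {f : X →ᵇ ℝ}
    (hf : ∀ x, 0 ≤ f x) (μ : Measure (X × E d)) (g : X × E d → F) :
    ∫ z, g z ∂(weighted f μ) = ∫ z, f z.1 • g z ∂μ := by
  unfold weighted
  rw [integral_withDensity_eq_integral_toReal_smul (measurable_weight f)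
    (ae_of_all _ fun _ => ENNReal.ofReal_lt_top)]
  simp only [ENNReal.toReal_ofReal (hf _)]

lemma charFun_weighted {f : X →ᵇ ℝ} (hf : ∀ x, 0 ≤ f x) (μ : Measure (X × E d)) (t : E d) :
    charFun ((weighted f μ).map Prod.snd) t = weightedCharFun μ f t := by
  have hc : Continuous fun y : E d => Complex.exp ((inner ℝ y t : ℝ) * Complex.I) := by fun_prop
  rw [charFun_apply, integral_map measurable_snd.aemeasurable hc.aestronglyMeasurable,
    integral_weighted hf]
  rfl

lemma map_weighted_eq {f : X →ᵇ ℝ} (hf : ∀ x, 0 ≤ f x) {μ ν : Measure (X × E d)}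
    [IsFiniteMeasure μ] [IsFiniteMeasure ν]
    (h : ∀ t, weightedCharFun μ f t = weightedCharFun ν f t) :
    (weighted f μ).map Prod.snd = (weighted f ν).map Prod.snd := by
  refine Measure.ext_of_charFun ?_
  funext t
  rw [charFun_weighted hf, charFun_weighted hf, h]

/-- Two sub-probability measures are equivalent with respect to `f` if the images of
`f(x) λ(dx, dy)` on `ℝᵈ` are translates of each other. -/
def WeightEquiv (f : X →ᵇ ℝ) (l m : SubProb X d) : Prop :=
  ∃ c : E d, ∀ t, weightedCharFun m.1 f t = expInner c t * weightedCharFun l.1 f t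

lemma weightEquiv_of_orbit_eq (f : X →ᵇ ℝ) {l m : SubProb X d} (h : orbit l = orbit m) :
    WeightEquiv f l m := by
  obtain ⟨a, rfl⟩ := orbit_eq_iff.1 h
  exact ⟨a, weightedCharFun_translate l a f⟩

lemma WeightEquiv.integral_eq {f : X →ᵇ ℝ} {l m : SubProb X d} (h : WeightEquiv f l m) :
    ∫ z, f z.1 ∂m.1 = ∫ z, f z.1 ∂l.1 := by
  obtain ⟨c, hc⟩ := h
  have := hc 0
  rw [weightedCharFun_zero, weightedCharFun_zero, expInner_zero_right, one_mul] at this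
  exact_mod_cast this

lemma half_mass_le {f : X →ᵇ ℝ} (hf : ∀ x, 1 / 2 ≤ f x) (l : SubProb X d) :
    l.mass / 2 ≤ ∫ z, f z.1 ∂l.1 := by
  have h := integral_mono (μ := l.1) (integrable_const (1 / 2 : ℝ)) (integrable_weight l.1 f)
    (fun z => hf z.1)
  simp only [integral_const, smul_eq_mul] at h
  unfold SubProb.mass
  linarith

lemma integral_le_mass {f : X →ᵇ ℝ} (hf : ∀ x, |f x| ≤ 1) (l : SubProb X d) :
    ∫ z, f z.1 ∂l.1 ≤ l.mass := by
  have h := integral_mono (μ := l.1) (integrable_weight l.1 f) (integrable_const (1 : ℝ))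
    (fun z => (le_abs_self _).trans (hf z.1))
  simp only [integral_const, smul_eq_mul] at h
  unfold SubProb.mass
  linarith

lemma mass_pos {l : SubProb X d} (hl : l ≠ 0) : 0 < l.mass := by
  refine lt_of_le_of_ne l.mass_nonneg fun h => hl (Subtype.ext ?_)
  have h1 : l.1 Set.univ = 0 := by
    rw [← l.ofReal_mass, ← h, ENNReal.ofReal_zero]
  exact Measure.measure_univ_eq_zero.1 h1

/-- Equivalence at infinitely many points of a segment of weights. -/
lemma exists_common_shift {f g : X →ᵇ ℝ} (hf : ∀ x, 1 / 2 ≤ f x) (hg : ∀ x, 1 / 2 ≤ g x)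
    {l m : SubProb X d} (hl : l ≠ 0) {h : ℕ → X →ᵇ ℝ}
    (hh : ∀ n x, h n x = (1 - (1 / 2 : ℝ) ^ n) * f x + (1 / 2 : ℝ) ^ n * g x)
    (hinf : {n | WeightEquiv (h n) l m}.Infinite) :
    ∃ c : E d, ∀ t, weightedCharFun m.1 f t = expInner c t * weightedCharFun l.1 f t ∧
      weightedCharFun m.1 g t = expInner c t * weightedCharFun l.1 g t := by
  have hinj : Function.Injective fun n : ℕ => (1 / 2 : ℝ) ^ n :=
    pow_right_injective₀ (by norm_num) (by norm_num)
  refine exists_common_character (continuous_weightedCharFun _ _) (continuous_weightedCharFun _ _)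
    (hinf.image hinj.injOn) ?_ ?_
  · rintro _ ⟨n, -, rfl⟩
    have h1 := half_mass_le hf l
    have h2 := half_mass_le hg l
    have h3 := mass_pos hl
    have h4 : (0 : ℝ) < (1 / 2) ^ n := by positivity
    have h5 : (1 / 2 : ℝ) ^ n ≤ 1 := pow_le_one₀ (by norm_num) (by norm_num)
    rw [weightedCharFun_zero, weightedCharFun_zero]
    have h6 : (1 - (1 / 2 : ℝ) ^ n) * ∫ z, f z.1 ∂l.1 + (1 / 2 : ℝ) ^ n * ∫ z, g z.1 ∂l.1 ≠ 0 := by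
      refine ne_of_gt (add_pos_of_nonneg_of_pos ?_ ?_)
      · exact mul_nonneg (by linarith) (by linarith)
      · exact mul_pos h4 (by linarith)
    exact_mod_cast h6
  · rintro _ ⟨n, ⟨c, hc⟩, rfl⟩
    refine ⟨c, fun t => ?_⟩
    rw [← weightedCharFun_segment _ (hh n), ← weightedCharFun_segment _ (hh n)]
    exact hc t

end WeightedTransform

/-! ### Separating orbits by weights of the family -/

section Separation

variable {X : Type*} [MetricSpace X] [MeasurableSpace X] [BorelSpace X] {d : ℕ}

/-- After normalisation, equal integrals make a constant sequence converge to the other measure, and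
weak limits are unique. -/
lemma TestFamily.measure_ext (S : TestFamily X d) {μ ν : Measure X} [IsFiniteMeasure μ]
    [IsFiniteMeasure ν] (h0 : μ Set.univ = ν Set.univ)
    (h : ∀ j, ∫ x, S.f j x ∂μ = ∫ x, S.f j x ∂ν) : μ = ν := by
  by_cases hz : μ Set.univ = 0
  · have hz' : ν Set.univ = 0 := by rw [← h0, hz]
    rw [Measure.measure_univ_eq_zero.1 hz, Measure.measure_univ_eq_zero.1 hz']
  have hn : ∀ ρ : Measure X, ρ Set.univ = μ Set.univ →
      IsProbabilityMeasure ((μ Set.univ)⁻¹ • ρ) := fun ρ hρ => ⟨by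
    rw [Measure.smul_apply, hρ, smul_eq_mul, ENNReal.inv_mul_cancel hz (measure_ne_top _ _)]⟩
  let b : ProbabilityMeasure X := ⟨(μ Set.univ)⁻¹ • μ, hn μ rfl⟩
  let b' : ProbabilityMeasure X := ⟨(μ Set.univ)⁻¹ • ν, hn ν h0.symm⟩
  have h1 : Tendsto (fun _ : ℕ => b) atTop (𝓝 b') := by
    refine (S.f_convergence _ _).1 fun j => ?_
    have : ∫ x, S.f j x ∂(b : Measure X) = ∫ x, S.f j x ∂(b' : Measure X) := by
      change ∫ x, S.f j x ∂((μ Set.univ)⁻¹ • μ) = ∫ x, S.f j x ∂((μ Set.univ)⁻¹ • ν)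
      rw [integral_smul_measure, integral_smul_measure, h]
    rw [this]
    exact tendsto_const_nhds
  have h2 : b = b' := tendsto_nhds_unique tendsto_const_nhds h1
  have h3 : (μ Set.univ)⁻¹ • μ = (μ Set.univ)⁻¹ • ν := congrArg Subtype.val h2
  have h4 := congrArg (fun ρ : Measure X => μ Set.univ • ρ) h3
  simpa only [smul_smul, ENNReal.mul_inv_cancel hz (measure_ne_top _ _), one_smul] using h4

/-- `map_weighted_eq` needs a non-negative weight, so `1 + f_j` is used in place of `f_j`. This
gives the integrals of `f_j` over slices `X × B`, whose marginals are then identified by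
`measure_ext`. -/
lemma TestFamily.measure_prod_ext (S : TestFamily X d) (h1 : ∃ j, ∀ x, S.f j x = 1)
    {μ ν : Measure (X × E d)} [IsFiniteMeasure μ] [IsFiniteMeasure ν]
    (h : ∀ j t, weightedCharFun μ (S.f j) t = weightedCharFun ν (S.f j) t) : μ = ν := by
  obtain ⟨j₀, hj₀⟩ := h1
  have hset : ∀ (B : Set (E d)), MeasurableSet B → ∀ j,
      ∫ z in Prod.snd ⁻¹' B, (1 + S.f j z.1) ∂μ = ∫ z in Prod.snd ⁻¹' B, (1 + S.f j z.1) ∂ν := by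
    intro B hB j
    have hpos : ∀ x, 0 ≤ (S.f j₀ + S.f j) x := fun x => by
      have := neg_abs_le (S.f j x)
      have := S.abs_f_le j x
      simp only [BoundedContinuousFunction.coe_add, Pi.add_apply, hj₀]
      linarith
    have hadd : ∀ ρ : Measure (X × E d), [IsFiniteMeasure ρ] → ∀ t,
        weightedCharFun ρ (S.f j₀ + S.f j) t
          = weightedCharFun ρ (S.f j₀) t + weightedCharFun ρ (S.f j) t := by
      intro ρ _ t
      unfold weightedCharFun
      rw [← integral_add (integrable_weight_mul ρ _ t) (integrable_weight_mul ρ _ t)]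
      congr 1
      funext z
      simp [add_mul]
    have h2 := map_weighted_eq (μ := μ) (ν := ν) hpos fun t => by
      rw [hadd, hadd, h, h]
    have h3 : ∀ ρ : Measure (X × E d), [IsFiniteMeasure ρ] →
        ∫ z in Prod.snd ⁻¹' B, (1 + S.f j z.1) ∂ρ
          = ∫ y, B.indicator (fun _ => (1 : ℝ)) y ∂((weighted (S.f j₀ + S.f j) ρ).map Prod.snd) := by
      intro ρ _
      rw [integral_map measurable_snd.aemeasurable
        (measurable_const.indicator hB).aestronglyMeasurable, integral_weighted hpos,
        ← integral_indicator (measurable_snd hB)]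
      congr 1
      funext z
      by_cases hz : z.2 ∈ B
      · simp [Set.indicator, hz, hj₀]
      · simp [Set.indicator, hz]
    rw [h3 μ, h3 ν, h2]
  refine Measure.ext_prod fun {A B} hA hB => ?_
  have hmass : μ.real (Prod.snd ⁻¹' B) = ν.real (Prod.snd ⁻¹' B) := by
    have := hset B hB j₀
    simp only [hj₀, integral_const, measureReal_restrict_apply_univ, smul_eq_mul] at this
    linarith
  have hmass' : μ (Prod.snd ⁻¹' B) = ν (Prod.snd ⁻¹' B) :=
    (ENNReal.toReal_eq_toReal_iff' (measure_ne_top _ _) (measure_ne_top _ _)).1 hmass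
  have hmarg : (μ.restrict (Prod.snd ⁻¹' B)).map Prod.fst
      = (ν.restrict (Prod.snd ⁻¹' B)).map Prod.fst := by
    refine S.measure_ext ?_ fun j => ?_
    · rw [Measure.map_apply measurable_fst MeasurableSet.univ,
        Measure.map_apply measurable_fst MeasurableSet.univ]
      simpa using hmass'
    · have hsplit : ∀ ρ : Measure (X × E d), [IsFiniteMeasure ρ] →
          ∫ x, S.f j x ∂((ρ.restrict (Prod.snd ⁻¹' B)).map Prod.fst)
            = ∫ z in Prod.snd ⁻¹' B, (1 + S.f j z.1) ∂ρ - ρ.real (Prod.snd ⁻¹' B) := by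
        intro ρ _
        rw [integral_map measurable_fst.aemeasurable
          (S.f j).continuous.measurable.aestronglyMeasurable,
          integral_add (integrable_const _) (integrable_weight _ _)]
        simp
      rw [hsplit μ, hsplit ν, hset B hB, hmass]
  have hfin : ∀ ρ : Measure (X × E d), ρ (A ×ˢ B)
      = (ρ.restrict (Prod.snd ⁻¹' B)).map Prod.fst A := by
    intro ρ
    rw [Measure.map_apply measurable_fst hA, Measure.restrict_apply (measurable_fst hA)]
    rfl
  rw [hfin, hfin, hmarg]

lemma exists_dyadic {S : TestFamily X d} (hS : S.MidpointClosed) (i j : ℕ) (n : ℕ) :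
    ∃ l, ∀ x, S.f l x = (1 - (1 / 2 : ℝ) ^ n) * S.f i x + (1 / 2 : ℝ) ^ n * S.f j x := by
  induction n with
  | zero => exact ⟨j, fun x => by simp⟩
  | succ n ih =>
    obtain ⟨l, hl⟩ := ih
    obtain ⟨l', hl'⟩ := hS.2 i l
    exact ⟨l', fun x => by rw [hl', hl, pow_succ]; ring⟩

lemma half_le_dyadic {f g : ℝ} (hf : 1 / 2 ≤ f) (hg : 1 / 2 ≤ g) (n : ℕ) :
    1 / 2 ≤ (1 - (1 / 2 : ℝ) ^ n) * f + (1 / 2 : ℝ) ^ n * g := by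
  have h4 : (0 : ℝ) < (1 / 2) ^ n := by positivity
  have h5 : (1 / 2 : ℝ) ^ n ≤ 1 := pow_le_one₀ (by norm_num) (by norm_num)
  nlinarith

/-- If no weight separated, the segments from the constant `1` to all other admissible weights would
share the translation found for `1`, and this translation would carry one measure to the other. -/
lemma exists_separating {S : TestFamily X d} (hS : S.MidpointClosed) {l m : SubProb X d}
    (hl : l ≠ 0) (h : orbit l ≠ orbit m) :
    ∃ j, (∀ x, 1 / 2 ≤ S.f j x) ∧ ¬ WeightEquiv (S.f j) l m := by
  by_contra! hcon
  obtain ⟨j₀, hj₀⟩ := hS.1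
  have hhalf₀ : ∀ x, 1 / 2 ≤ S.f j₀ x := fun x => by rw [hj₀]; norm_num
  obtain ⟨c, hc⟩ := hcon j₀ hhalf₀
  have hA0 : weightedCharFun l.1 (S.f j₀) 0 ≠ 0 := by
    rw [weightedCharFun_zero]
    have := half_mass_le hhalf₀ l
    have := mass_pos hl
    exact_mod_cast (by linarith : (0 : ℝ) < ∫ z, S.f j₀ z.1 ∂l.1).ne'
  have hev : ∀ᶠ u in 𝓝 (0 : E d), weightedCharFun l.1 (S.f j₀) u ≠ 0 :=
    (continuous_weightedCharFun _ _).continuousAt.eventually_ne hA0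
  have key : ∀ j, (∀ x, 1 / 2 ≤ S.f j x) → ∀ t,
      weightedCharFun m.1 (S.f j) t = expInner c t * weightedCharFun l.1 (S.f j) t := by
    intro j hj
    choose r hr using exists_dyadic hS j₀ j
    have hr2 : ∀ n x, 1 / 2 ≤ S.f (r n) x := fun n x => by
      rw [hr]
      exact half_le_dyadic (hhalf₀ x) (hj x) n
    obtain ⟨c', hc'⟩ := exists_common_shift hhalf₀ hj (m := m) hl (h := fun n => S.f (r n)) hr (by
      have : {n | WeightEquiv (S.f (r n)) l m} = Set.univ :=
        Set.eq_univ_of_forall fun n => hcon _ (hr2 n)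
      rw [this]
      exact Set.infinite_univ)
    have hcc : c' - c = 0 := by
      refine eq_zero_of_expInner_eq_one ?_
      filter_upwards [hev] with u hu
      have h1 := (hc' u).1
      rw [hc u] at h1
      have h2 := mul_right_cancel₀ hu h1
      rw [sub_eq_add_neg, expInner_add_left, ← h2, mul_comm]
      exact expInner_neg_mul c u
    rw [sub_eq_zero.1 hcc] at hc'
    exact fun t => (hc' t).2
  refine h (orbit_eq_iff.2 ⟨c, Subtype.ext (S.measure_prod_ext hS.1 fun j t => ?_)⟩)
  rw [weightedCharFun_translate]
  -- An arbitrary `f_j ≥ -1` enters through `3/4 + f_j / 4`, which is at least `1/2`.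
  obtain ⟨r, hr⟩ := exists_dyadic hS j₀ j 2
  have hr2 : ∀ x, 1 / 2 ≤ S.f r x := fun x => by
    have := neg_abs_le (S.f j x)
    have := S.abs_f_le j x
    rw [hr, hj₀]
    norm_num
    linarith
  have h1 := key r hr2 t
  have hr' : ∀ x, S.f r x = (1 - ((1 / 2 : ℝ) ^ 2)) * S.f j₀ x + ((1 / 2 : ℝ) ^ 2) * S.f j x := hr
  rw [weightedCharFun_segment _ hr', weightedCharFun_segment _ hr', hc t] at h1
  push_cast at h1
  linear_combination 4 * h1

/-- Finitely many orbits can be separated from a given one by a single weight of the family. -/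
lemma exists_separating_finset {S : TestFamily X d} (hS : S.MidpointClosed) {l : SubProb X d}
    (hl : l ≠ 0) (s : Set (SubProb X d)) (hs : s.Finite) (h : ∀ m ∈ s, orbit l ≠ orbit m) :
    ∃ j, (∀ x, 1 / 2 ≤ S.f j x) ∧ ∀ m ∈ s, ¬ WeightEquiv (S.f j) l m := by
  induction s, hs using Set.Finite.induction_on with
  | empty =>
    obtain ⟨j₀, hj₀⟩ := hS.1
    exact ⟨j₀, fun x => by rw [hj₀]; norm_num, by simp⟩
  | @insert m s _ hs ih =>
    obtain ⟨i, hi, hi'⟩ := ih fun m' hm' => h m' (Set.mem_insert_of_mem _ hm')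
    obtain ⟨j, hj, hj'⟩ := exists_separating hS hl (h m (Set.mem_insert _ _))
    choose r hr using exists_dyadic hS i j
    -- Infinitely many equivalences along the segment give equivalence at both endpoints, but each
    -- `m'` is separated at one of them.
    have hfin : ∀ m' ∈ insert m s, {n | WeightEquiv (S.f (r n)) l m'}.Finite := by
      intro m' hm'
      by_contra hinf
      obtain ⟨c, hc⟩ := exists_common_shift hi hj (m := m') hl (h := fun n => S.f (r n)) hr hinf
      rcases Set.mem_insert_iff.1 hm' with rfl | hm'
      · exact hj' ⟨c, fun t => (hc t).2⟩
      · exact hi' m' hm' ⟨c, fun t => (hc t).1⟩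
    obtain ⟨n, hn⟩ := ((hs.insert m).biUnion hfin).infinite_compl.nonempty
    refine ⟨r n, fun x => by rw [hr]; exact half_le_dyadic (hi x) (hj x) n, fun m' hm' hw => ?_⟩
    exact hn (Set.mem_biUnion hm' hw)

end Separation

/-! ### Moments determine the law of the profile -/

section Moments

variable {X : Type*} [TopologicalSpace X] [MeasurableSpace X] [OpensMeasurableSpace X] {d : ℕ}

/-- The translation invariant kernel `y ↦ ∏ h_i (y_{i+1} - y₀)`. -/
def diffKernel {n : ℕ} (h : Fin n → E d →ᵇ ℝ) : (Fin (n + 1) → E d) →ᵇ ℝ :=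
  ∏ i, (h i).compContinuous ⟨fun y => y i.succ - y 0, by fun_prop⟩

lemma diffKernel_apply {n : ℕ} (h : Fin n → E d →ᵇ ℝ) (y : Fin (n + 1) → E d) :
    diffKernel h y = ∏ i, h i (y i.succ - y 0) := by
  simp [diffKernel]

lemma diffKernel_translate {n : ℕ} (h : Fin n → E d →ᵇ ℝ) (a : E d) (y : Fin (n + 1) → E d) :
    diffKernel h (fun i => y i + a) = diffKernel h y := by
  simp [diffKernel_apply]

/-- The average of `f(x) h(y - a)`. -/
def shiftedMean (f : X →ᵇ ℝ) (h : E d →ᵇ ℝ) (l : SubProb X d) (a : E d) : ℝ :=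
  ∫ w, f w.1 * h (w.2 - a) ∂l.1

lemma measurable_weight_shift (f : X →ᵇ ℝ) (h : E d →ᵇ ℝ) (a : E d) :
    Measurable fun w : X × E d => f w.1 * h (w.2 - a) := by
  have h1 : Continuous fun y : E d => h (y - a) := by fun_prop
  exact (f.continuous.measurable.comp measurable_fst).mul (h1.measurable.comp measurable_snd)

lemma continuous_shiftedMean (f : X →ᵇ ℝ) (h : E d →ᵇ ℝ) (l : SubProb X d) :
    Continuous (shiftedMean f h l) := by
  refine continuous_of_dominated (bound := fun _ => ‖f‖ * ‖h‖)
    (fun t => (measurable_weight_shift f h t).aestronglyMeasurable)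
    (fun t => ae_of_all _ fun z => ?_) (integrable_const _) (ae_of_all _ fun z => ?_)
  · rw [norm_mul]
    exact mul_le_mul (f.norm_coe_le_norm _) (h.norm_coe_le_norm _) (norm_nonneg _) (norm_nonneg _)
  · fun_prop

lemma abs_shiftedMean_le {f : X →ᵇ ℝ} (hf : ∀ x, |f x| ≤ 1) {h : E d →ᵇ ℝ} (hh : ∀ x, |h x| ≤ 1)
    (l : SubProb X d) (a : E d) : |shiftedMean f h l a| ≤ 1 := by
  have h1 := norm_integral_le_of_norm_le_const (μ := l.1) (f := fun w => f w.1 * h (w.2 - a))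
    (C := 1) (ae_of_all _ fun w => by
      rw [norm_mul]
      exact mul_le_one₀ (hf _) (norm_nonneg _) (hh _))
  rw [one_mul] at h1
  exact h1.trans l.mass_le_one

/-- Fubini: for a fixed zeroth point the integral over the others factorises. -/
lemma integral_prod_shiftedMean (f : X →ᵇ ℝ) {n : ℕ} (h : Fin n → E d →ᵇ ℝ) (l : SubProb X d) :
    ∫ z, f z.1 * ∏ i, shiftedMean f (h i) l z.2 ∂l.1 = l.integral f (diffKernel h) := by
  unfold SubProb.integral
  have hmp := (measurePreserving_piFinSuccAbove (fun _ : Fin (n + 1) => l.1) 0).symm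
  have hint := l.integrable_tensor f (diffKernel h)
  rw [← hmp.integral_comp', integral_prod]
  · congr 1
    funext z
    have h1 : ∀ w : Fin n → X × E d,
        (∏ i, f ((MeasurableEquiv.piFinSuccAbove (fun _ : Fin (n + 1) => X × E d) 0).symm
          (z, w) i).1) * diffKernel h (fun i =>
          ((MeasurableEquiv.piFinSuccAbove (fun _ : Fin (n + 1) => X × E d) 0).symm (z, w) i).2)
        = f z.1 * ∏ i, (f (w i).1 * h i ((w i).2 - z.2)) := by
      intro w
      rw [diffKernel_apply, Fin.prod_univ_succ, Finset.prod_mul_distrib]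
      simp [MeasurableEquiv.piFinSuccAbove_symm_apply, mul_assoc]
    simp only [h1]
    rw [integral_const_mul]
    congr 1
    exact (integral_fintype_prod_eq_prod (μ := fun _ : Fin n => l.1)
      (fun i (w : X × E d) => f w.1 * h i (w.2 - z.2))).symm
  · exact (hmp.integrable_comp_emb (MeasurableEquiv.measurableEmbedding _)).2 hint

variable {J : Type*}

/-- The function `a ↦ (∫ f(x) h_j(y - a) λ(dx, dy))_j`. -/
def profile (f : X →ᵇ ℝ) (hf : ∀ x, |f x| ≤ 1) (h : J → E d →ᵇ ℝ) (hh : ∀ j x, |h j x| ≤ 1)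
    (l : SubProb X d) (a : E d) : J → Set.Icc (-1 : ℝ) 1 :=
  fun j => ⟨shiftedMean f (h j) l a, abs_le.1 (abs_shiftedMean_le hf (hh j) l a)⟩

lemma continuous_profile (f : X →ᵇ ℝ) (hf : ∀ x, |f x| ≤ 1) (h : J → E d →ᵇ ℝ)
    (hh : ∀ j x, |h j x| ≤ 1) (l : SubProb X d) : Continuous (profile f hf h hh l) :=
  continuous_pi fun j => (continuous_shiftedMean f (h j) l).subtype_mk _

/-- The law of the profile of a random element of the family, weighted by `f` and the mass. -/
def profileLaw (f : X →ᵇ ℝ) (hf : ∀ x, |f x| ≤ 1) (h : J → E d →ᵇ ℝ) (hh : ∀ j x, |h j x| ≤ 1)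
    (l : ℕ → SubProb X d) : Measure (J → Set.Icc (-1 : ℝ) 1) :=
  Measure.sum fun j => ENNReal.ofReal (∫ z, f z.1 ∂(l j).1) •
    (weighted f (l j).1).map fun z => profile f hf h hh (l j) z.2

lemma weighted_univ {f : X →ᵇ ℝ} (hf : ∀ x, 0 ≤ f x) (l : SubProb X d) :
    weighted f l.1 Set.univ = ENNReal.ofReal (∫ z, f z.1 ∂l.1) := by
  unfold weighted
  rw [withDensity_apply _ MeasurableSet.univ, setLIntegral_univ,
    ofReal_integral_eq_lintegral_ofReal (integrable_weight _ f) (ae_of_all _ fun z => hf z.1)]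

variable [Countable J]

lemma measurable_profile (f : X →ᵇ ℝ) (hf : ∀ x, |f x| ≤ 1) (h : J → E d →ᵇ ℝ)
    (hh : ∀ j x, |h j x| ≤ 1) (l : SubProb X d) :
    Measurable fun z : X × E d => profile f hf h hh l z.2 :=
  (continuous_profile f hf h hh l).measurable.comp measurable_snd

lemma profileLaw_apply {f : X →ᵇ ℝ} (hf : ∀ x, |f x| ≤ 1) (h : J → E d →ᵇ ℝ)
    (hh : ∀ j x, |h j x| ≤ 1) (l : ℕ → SubProb X d) {A : Set (J → Set.Icc (-1 : ℝ) 1)}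
    (hA : MeasurableSet A) :
    profileLaw f hf h hh l A = ∑' j, ENNReal.ofReal (∫ z, f z.1 ∂(l j).1) *
      weighted f (l j).1 ((fun z => profile f hf h hh (l j) z.2) ⁻¹' A) := by
  unfold profileLaw
  rw [Measure.sum_apply _ hA]
  refine tsum_congr fun j => ?_
  rw [Measure.smul_apply, Measure.map_apply (measurable_profile f hf h hh (l j)) hA, smul_eq_mul]

lemma isFiniteMeasure_profileLaw {f : X →ᵇ ℝ} (hf0 : ∀ x, 0 ≤ f x) (hf : ∀ x, |f x| ≤ 1)
    (h : J → E d →ᵇ ℝ) (hh : ∀ j x, |h j x| ≤ 1) {l : ℕ → SubProb X d}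
    (hl : ∑' j, (l j).1 Set.univ ≤ 1) : IsFiniteMeasure (profileLaw f hf h hh l) := by
  refine ⟨lt_of_le_of_lt ?_ ENNReal.one_lt_top⟩
  rw [profileLaw_apply hf h hh l MeasurableSet.univ]
  refine le_trans (ENNReal.tsum_le_tsum fun j => ?_) hl
  rw [Set.preimage_univ, weighted_univ hf0, ← (l j).ofReal_mass]
  have h1 := integral_le_mass hf (l j)
  have h2 : ENNReal.ofReal (∫ z, f z.1 ∂(l j).1) ≤ 1 := by
    rw [ENNReal.ofReal_le_one]
    exact h1.trans (l j).mass_le_one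
  calc _ ≤ 1 * ENNReal.ofReal (∫ z, f z.1 ∂(l j).1) := mul_le_mul_left h2 _
    _ ≤ _ := by rw [one_mul]; exact ENNReal.ofReal_le_ofReal h1

/-- The prefactor `∫ f dλ_j` in `profileLaw` is the shifted mean of the constant `1`. It supplies
one more variable, so a monomial of degree `n` uses `n + 2` points, and even degree `0` falls under
`k ≥ 2`. -/
lemma integral_profileLaw_monomial {f : X →ᵇ ℝ} (hf0 : ∀ x, 0 ≤ f x) (hf : ∀ x, |f x| ≤ 1)
    (h : J → E d →ᵇ ℝ) (hh : ∀ j x, |h j x| ≤ 1) {l : ℕ → SubProb X d}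
    (hl : ∑' j, (l j).1 Set.univ ≤ 1) {n : ℕ} (idx : Fin n → J) :
    ∫ v, ∏ i, (v (idx i) : ℝ) ∂(profileLaw f hf h hh l)
      = ∑' j, (l j).integral f (diffKernel (Fin.cons 1 fun i => h (idx i))) := by
  have hm : Continuous fun v : J → Set.Icc (-1 : ℝ) 1 => ∏ i, (v (idx i) : ℝ) := by fun_prop
  have := isFiniteMeasure_profileLaw hf0 hf h hh hl
  have hint : Integrable (fun v : J → Set.Icc (-1 : ℝ) 1 => ∏ i, (v (idx i) : ℝ))
      (profileLaw f hf h hh l) := by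
    refine Integrable.of_bound hm.measurable.aestronglyMeasurable 1 (ae_of_all _ fun v => ?_)
    rw [Real.norm_eq_abs, Finset.abs_prod]
    exact Finset.prod_le_one (fun _ _ => abs_nonneg _) fun i _ => abs_le.2 (v (idx i)).2
  unfold profileLaw at hint ⊢
  rw [integral_sum_measure hint]
  refine tsum_congr fun j => ?_
  rw [integral_smul_measure, integral_map (measurable_profile f hf h hh (l j)).aemeasurable
    hm.measurable.aestronglyMeasurable, integral_weighted hf0, ← integral_prod_shiftedMean,
    ENNReal.toReal_ofReal (integral_nonneg fun z => hf0 _), smul_eq_mul, ← integral_const_mul]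
  congr 1
  funext z
  rw [Fin.prod_univ_succ]
  simp only [Fin.cons_zero, Fin.cons_succ, smul_eq_mul]
  have h1 : shiftedMean f (1 : E d →ᵇ ℝ) (l j) z.2 = ∫ z, f z.1 ∂(l j).1 := by
    simp [shiftedMean]
  rw [h1]
  simp only [profile]
  ring

-- The coordinates generate a point-separating algebra on the cube, which determines finite
-- measures; integrals of its monomials are functionals at invariant kernels.
open BoundedContinuousFunction in
lemma profileLaw_eq {f : X →ᵇ ℝ} (hf0 : ∀ x, 0 ≤ f x) (hf : ∀ x, |f x| ≤ 1)
    (h : J → E d →ᵇ ℝ) (hh : ∀ j x, |h j x| ≤ 1) {l m : ℕ → SubProb X d}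
    (hl : ∑' j, (l j).1 Set.univ ≤ 1) (hm : ∑' j, (m j).1 Set.univ ≤ 1)
    (heq : ∀ (k : ℕ), 2 ≤ k → ∀ G : (Fin k → E d) →ᵇ ℝ, (∀ a y, G (fun i => y i + a) = G y) →
      ∑' j, (l j).integral f G = ∑' j, (m j).integral f G) :
    profileLaw f hf h hh l = profileLaw f hf h hh m := by
  have := isFiniteMeasure_profileLaw hf0 hf h hh hl
  have := isFiniteMeasure_profileLaw hf0 hf h hh hm
  let coord : J → ((J → Set.Icc (-1 : ℝ) 1) →ᵇ ℝ) := fun j =>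
    BoundedContinuousFunction.ofNormedAddCommGroup (fun v => (v j : ℝ)) (by fun_prop) 1
      fun v => abs_le.2 (v j).2
  let A : StarSubalgebra ℝ ((J → Set.Icc (-1 : ℝ) 1) →ᵇ ℝ) :=
    { Algebra.adjoin ℝ (Set.range coord) with
      star_mem' := fun {a} ha => by
        have : star a = a := by
          ext v
          simp
        rw [this]
        exact ha }
  have : PolishSpace (Set.Icc (-1 : ℝ) 1) := isClosed_Icc.polishSpace
  refine ext_of_forall_mem_subalgebra_integral_eq_of_polish (𝕜 := ℝ) (A := A) ?_ ?_
  · intro v w hvw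
    obtain ⟨j, hj⟩ := Function.ne_iff.1 hvw
    refine ⟨_, ⟨_, ⟨coord j, Algebra.subset_adjoin (Set.mem_range_self j), rfl⟩, rfl⟩, ?_⟩
    exact fun h0 => hj (Subtype.ext h0)
  · intro g hg
    have hg' : g ∈ Submodule.span ℝ (Submonoid.closure (Set.range coord) : Set _) := by
      rw [← Algebra.adjoin_eq_span]
      exact hg
    induction hg' using Submodule.span_induction with
    | mem g hgm =>
      obtain ⟨L, hL, rfl⟩ := Submonoid.exists_list_of_mem_closure hgm
      choose idx hidx using fun i : Fin L.length => hL L[i] (List.getElem_mem _)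
      have h1 : ∀ v, L.prod v = ∏ i : Fin L.length, ((v (idx i) : Set.Icc (-1 : ℝ) 1) : ℝ) := by
        intro v
        have h2 : L.prod = ∏ i : Fin L.length, coord (idx i) := by
          rw [← Fin.prod_univ_getElem]
          exact Finset.prod_congr rfl fun i _ => (hidx i).symm
        rw [h2]
        simp [coord]
      simp only [h1]
      rw [integral_profileLaw_monomial hf0 hf h hh hl idx,
        integral_profileLaw_monomial hf0 hf h hh hm idx]
      exact heq _ (by omega) _ (diffKernel_translate _)
    | zero => simp
    | add g g' hg hg' ih ih' =>
      simp only [BoundedContinuousFunction.coe_add, Pi.add_apply]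
      rw [integral_add (g.integrable _) (g'.integrable _),
        integral_add (g.integrable _) (g'.integrable _)]
      rw [ih, ih']
      all_goals
        change _ ∈ Algebra.adjoin ℝ (Set.range coord)
        rw [← Subalgebra.mem_toSubmodule, Algebra.adjoin_eq_span]
        assumption
    | smul c g hg ih =>
      simp only [BoundedContinuousFunction.coe_smul]
      rw [integral_smul, integral_smul, ih]
      change _ ∈ Algebra.adjoin ℝ (Set.range coord)
      rw [← Subalgebra.mem_toSubmodule, Algebra.adjoin_eq_span]
      assumption

end Moments

/-! ### Counting equivalent members through trigonometric profiles -/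

section Trigonometric

variable {X : Type*} [TopologicalSpace X] [MeasurableSpace X] [OpensMeasurableSpace X] {d : ℕ}

/-- Cosines and sines with frequencies from a dense sequence. -/
def trig (d : ℕ) (p : ℕ × Bool) : E d →ᵇ ℝ :=
  BoundedContinuousFunction.ofNormedAddCommGroup
    (fun y => if p.2 then (expInner y (TopologicalSpace.denseSeq (E d) p.1)).re
      else (expInner y (TopologicalSpace.denseSeq (E d) p.1)).im)
    (by
      unfold expInner
      split_ifs <;> fun_prop) 1
    (fun y => by
      rw [← norm_expInner y (TopologicalSpace.denseSeq (E d) p.1)]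
      split_ifs
      · exact Complex.abs_re_le_norm _
      · exact Complex.abs_im_le_norm _)

lemma abs_trig_le (p : ℕ × Bool) (y : E d) : |trig d p y| ≤ 1 := by
  rw [← norm_expInner y (TopologicalSpace.denseSeq (E d) p.1)]
  simp only [trig, BoundedContinuousFunction.coe_ofNormedAddCommGroup]
  split_ifs
  · exact Complex.abs_re_le_norm _
  · exact Complex.abs_im_le_norm _

lemma expInner_mul_weightedCharFun (f : X →ᵇ ℝ) (l : SubProb X d) (a t : E d) :
    expInner (-a) t * weightedCharFun l.1 f t = ∫ w, (f w.1 : ℂ) * expInner (w.2 - a) t ∂l.1 := by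
  unfold weightedCharFun
  rw [← integral_const_mul]
  congr 1
  funext w
  rw [sub_eq_add_neg, expInner_add_left]
  ring

lemma shiftedMean_trig (f : X →ᵇ ℝ) (l : SubProb X d) (a : E d) (n : ℕ) :
    expInner (-a) (TopologicalSpace.denseSeq (E d) n) *
        weightedCharFun l.1 f (TopologicalSpace.denseSeq (E d) n)
      = ⟨shiftedMean f (trig d (n, true)) l a, shiftedMean f (trig d (n, false)) l a⟩ := by
  set t := TopologicalSpace.denseSeq (E d) n with ht
  rw [expInner_mul_weightedCharFun]
  have hint : Integrable (fun w : X × E d => (f w.1 : ℂ) * expInner (w.2 - a) t) l.1 := by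
    have := (integrable_weight_mul l.1 f t).const_mul (expInner (-a) t)
    refine this.congr (ae_of_all _ fun w => ?_)
    simp only
    rw [sub_eq_add_neg, expInner_add_left]
    ring
  apply Complex.ext
  · refine (integral_re (𝕜 := ℂ) hint).symm.trans ?_
    simp [shiftedMean, trig, ht]
  · refine (integral_im (𝕜 := ℂ) hint).symm.trans ?_
    simp [shiftedMean, trig, ht]

/-- By continuity a dense sequence of frequencies determines the transform; having countably many
coordinates keeps the cube Polish. -/
lemma profile_trig_eq_iff {f : X →ᵇ ℝ} (hf : ∀ x, |f x| ≤ 1) (l m : SubProb X d) (a b : E d) :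
    profile f hf (trig d) abs_trig_le l a = profile f hf (trig d) abs_trig_le m b ↔
      ∀ t, expInner (-a) t * weightedCharFun l.1 f t
        = expInner (-b) t * weightedCharFun m.1 f t := by
  constructor
  · intro h
    have hc : ∀ (l : SubProb X d) (a : E d),
        Continuous fun t => expInner (-a) t * weightedCharFun l.1 f t := fun l a =>
      (continuous_expInner _).mul (continuous_weightedCharFun _ _)
    refine congrFun ((TopologicalSpace.denseRange_denseSeq (E d)).equalizer (hc l a) (hc m b) ?_)
    funext n
    have h1 : ∀ p, shiftedMean f (trig d p) l a = shiftedMean f (trig d p) m b := fun p =>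
      congrArg Subtype.val (congrFun h p)
    simp only [Function.comp]
    rw [shiftedMean_trig, shiftedMean_trig, h1, h1]
  · intro h
    funext p
    apply Subtype.ext
    have h1 := h (TopologicalSpace.denseSeq (E d) p.1)
    rw [shiftedMean_trig, shiftedMean_trig] at h1
    obtain ⟨n, _ | _⟩ := p
    · exact congrArg Complex.im h1
    · exact congrArg Complex.re h1

/-- The weighted number of members equivalent to a given measure is determined by the integrals
against translation invariant kernels. -/
lemma tsum_weightEquiv_eq {f : X →ᵇ ℝ} (hf0 : ∀ x, 0 ≤ f x) (hf : ∀ x, |f x| ≤ 1)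
    {l m : ℕ → SubProb X d}
    (hl : ∑' j, (l j).1 Set.univ ≤ 1) (hm : ∑' j, (m j).1 Set.univ ≤ 1)
    (heq : ∀ (k : ℕ), 2 ≤ k → ∀ G : (Fin k → E d) →ᵇ ℝ, (∀ a y, G (fun i => y i + a) = G y) →
      ∑' j, (l j).integral f G = ∑' j, (m j).integral f G) (r : SubProb X d) :
    ∑' _ : {j | WeightEquiv f r (l j)}, ENNReal.ofReal (∫ z, f z.1 ∂r.1) ^ 2
      = ∑' _ : {j | WeightEquiv f r (m j)}, ENNReal.ofReal (∫ z, f z.1 ∂r.1) ^ 2 := by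
  classical
  have hlaw := profileLaw_eq hf0 hf (trig d) abs_trig_le hl hm heq
  -- A continuous image of `ℝᵈ` is σ-compact.
  have hA : MeasurableSet (Set.range (profile f hf (trig d) abs_trig_le r)) := by
    rw [← Set.image_univ, ← iUnion_compactCovering (E d), Set.image_iUnion]
    exact MeasurableSet.iUnion fun n => ((isCompact_compactCovering (E d) n).image
      (continuous_profile f hf (trig d) abs_trig_le r)).isClosed.measurableSet
  -- The profiles of a member lie either all in the range for `r` or all outside. An equivalent
  -- member has mass and prefactor both equal to `∫ f dr`, whence the square.
  have key : ∀ l : ℕ → SubProb X d,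
      profileLaw f hf (trig d) abs_trig_le l (Set.range (profile f hf (trig d) abs_trig_le r))
        = ∑' _ : {j | WeightEquiv f r (l j)}, ENNReal.ofReal (∫ z, f z.1 ∂r.1) ^ 2 := by
    intro l
    rw [profileLaw_apply hf _ _ l hA, tsum_subtype {j | WeightEquiv f r (l j)}
      fun _ => ENNReal.ofReal (∫ z, f z.1 ∂r.1) ^ 2]
    refine tsum_congr fun j => ?_
    by_cases hj : WeightEquiv f r (l j)
    · rw [Set.indicator_of_mem (show j ∈ {j | WeightEquiv f r (l j)} from hj)]
      have hpre : (fun z : X × E d => profile f hf (trig d) abs_trig_le (l j) z.2) ⁻¹'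
          (Set.range (profile f hf (trig d) abs_trig_le r)) = Set.univ := by
        obtain ⟨c, hc⟩ := hj
        refine Set.eq_univ_of_forall fun z => ⟨z.2 - c, ?_⟩
        rw [profile_trig_eq_iff]
        intro t
        rw [hc, ← mul_assoc, ← expInner_add_left]
        congr 2
        abel
      rw [hpre, weighted_univ hf0, hj.integral_eq, sq]
    · rw [Set.indicator_of_notMem (show j ∉ {j | WeightEquiv f r (l j)} from hj)]
      have hpre : (fun z : X × E d => profile f hf (trig d) abs_trig_le (l j) z.2) ⁻¹'
          (Set.range (profile f hf (trig d) abs_trig_le r)) = ∅ := by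
        refine Set.eq_empty_of_forall_notMem fun z => ?_
        rintro ⟨a, ha⟩
        rw [profile_trig_eq_iff] at ha
        refine hj ⟨z.2 - a, fun t => ?_⟩
        rw [sub_eq_add_neg, expInner_add_left, mul_assoc, ha t, ← mul_assoc, mul_comm (expInner _ _),
          expInner_neg_mul, one_mul]
      rw [hpre, measure_empty, mul_zero]
  rw [← key l, ← key m, hlaw]

end Trigonometric

/-! ### From kernels vanishing at infinity to all invariant kernels -/

section Extension

variable {X : Type*} [TopologicalSpace X] [MeasurableSpace X] [OpensMeasurableSpace X] {d : ℕ}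

/-- The sum of the integrals over a family, as a functional of the kernel. -/
def totalIntegral (f : X →ᵇ ℝ) (hf : ∀ x, |f x| ≤ 1) {k : ℕ} (hk : 0 < k) (l : ℕ → SubProb X d)
    (hl : ∑' j, (l j).1 Set.univ ≤ 1) : ((Fin k → E d) →ᵇ ℝ) →L[ℝ] ℝ :=
  LinearMap.mkContinuous
    { toFun := fun W => ∑' j, (l j).integral f W
      map_add' := fun V W => by
        simp only [SubProb.integral_add]
        exact (summable_integral hl hf hk V).tsum_add (summable_integral hl hf hk W)
      map_smul' := fun c W => by
        simp only [SubProb.integral_smul, RingHom.id_apply, smul_eq_mul]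
        exact tsum_mul_left } 1
    (fun W => by
      rw [one_mul]
      exact abs_tsum_integral_le hl hf hk (abs_le_norm_apply W))

/-- A continuous function on `ℝᵈ` that is `1` on the unit ball, vanishes outside the ball of
radius `2` and takes values in `[0, 1]`. -/
def bump (d : ℕ) : E d →ᵇ ℝ :=
  BoundedContinuousFunction.ofNormedAddCommGroup (fun y => max 0 (min 1 (2 - ‖y‖)))
    (by fun_prop) 1 (fun y => by
      rw [Real.norm_eq_abs, abs_of_nonneg (le_max_left _ _)]
      exact max_le zero_le_one (min_le_left _ _))

lemma bump_apply (y : E d) : bump d y = max 0 (min 1 (2 - ‖y‖)) := rfl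

lemma bump_nonneg (y : E d) : 0 ≤ bump d y := le_max_left _ _

lemma bump_le_one (y : E d) : bump d y ≤ 1 := max_le zero_le_one (min_le_left _ _)

lemma abs_bump_le (y : E d) : |bump d y| ≤ 1 := by
  rw [abs_of_nonneg (bump_nonneg y)]
  exact bump_le_one y

lemma bump_eq_one {y : E d} (h : ‖y‖ ≤ 1) : bump d y = 1 := by
  rw [bump_apply, min_eq_left (by linarith), max_eq_right zero_le_one]

lemma bump_eq_zero {y : E d} (h : 2 ≤ ‖y‖) : bump d y = 0 := by
  rw [bump_apply, max_eq_left]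
  exact (min_le_right _ _).trans (by linarith)

/-- The restriction of a kernel to configurations whose points are at distance at most of order
`n + 1` from the first one. -/
def truncate {k : ℕ} (G : (Fin (k + 1) → E d) →ᵇ ℝ) (n : ℕ) : (Fin (k + 1) → E d) →ᵇ ℝ :=
  G * ∏ i, (bump d).compContinuous ⟨fun y => ((n : ℝ) + 1)⁻¹ • (y i - y 0), by fun_prop⟩

lemma truncate_apply {k : ℕ} (G : (Fin (k + 1) → E d) →ᵇ ℝ) (n : ℕ) (y : Fin (k + 1) → E d) :
    truncate G n y = G y * ∏ i, bump d (((n : ℝ) + 1)⁻¹ • (y i - y 0)) := by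
  simp [truncate]

lemma abs_truncate_le {k : ℕ} (G : (Fin (k + 1) → E d) →ᵇ ℝ) (n : ℕ) (y : Fin (k + 1) → E d) :
    |truncate G n y| ≤ |G y| := by
  rw [truncate_apply, abs_mul, Finset.abs_prod]
  exact mul_le_of_le_one_right (abs_nonneg _)
    (Finset.prod_le_one (fun _ _ => abs_nonneg _) fun _ _ => abs_bump_le _)

lemma truncate_mem {k : ℕ} {G : (Fin (k + 1) → E d) →ᵇ ℝ}
    (hG : ∀ a y, G (fun i => y i + a) = G y) (n : ℕ) : truncate G n ∈ transInv d (k + 1) := by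
  -- Two points `4 (n + 1)` apart cannot both be closer than `2 (n + 1)` to `y 0`, where the bump
  -- factors live.
  refine ⟨fun a y => ?_, fun ε hε => ⟨4 * ((n : ℝ) + 1), ?_⟩⟩
  · rw [truncate_apply, truncate_apply, hG]
    simp
  · rintro y ⟨i, j, hij⟩
    suffices h : truncate G n y = 0 by rw [h, abs_zero]; exact hε.le
    have hn : (0 : ℝ) < (n : ℝ) + 1 := by positivity
    have h1 : ‖y i - y j‖ ≤ ‖y i - y 0‖ + ‖y j - y 0‖ := by
      rw [← sub_sub_sub_cancel_right (y i) (y j) (y 0)]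
      exact norm_sub_le _ _
    have h2 : ∃ m, 2 * ((n : ℝ) + 1) ≤ ‖y m - y 0‖ := by
      by_contra! hcon
      have := hcon i
      have := hcon j
      linarith
    obtain ⟨m, hm⟩ := h2
    rw [truncate_apply, Finset.prod_eq_zero (Finset.mem_univ m), mul_zero]
    apply bump_eq_zero
    rw [norm_smul, norm_inv, Real.norm_of_nonneg hn.le, le_inv_mul_iff₀ hn]
    linarith

lemma tendsto_truncate {k : ℕ} (G : (Fin (k + 1) → E d) →ᵇ ℝ) (y : Fin (k + 1) → E d) :
    Tendsto (fun n => truncate G n y) atTop (𝓝 (G y)) := by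
  refine tendsto_const_nhds.congr' ?_
  obtain ⟨C, hC⟩ := (Set.finite_range fun i => ‖y i - y 0‖).bddAbove
  filter_upwards [eventually_ge_atTop ⌈C⌉₊] with n hn
  rw [truncate_apply, Finset.prod_eq_one, mul_one]
  intro i _
  have hn' : (0 : ℝ) < (n : ℝ) + 1 := by positivity
  apply bump_eq_one
  rw [norm_smul, norm_inv, Real.norm_of_nonneg hn'.le, inv_mul_le_iff₀ hn', mul_one]
  have h1 := hC (Set.mem_range_self i)
  have h2 : C ≤ n := (Nat.le_ceil C).trans (by exact_mod_cast hn)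
  linarith

lemma SubProb.tendsto_integral {f : X →ᵇ ℝ} {k : ℕ} {C : ℝ} {W : ℕ → (Fin k → E d) →ᵇ ℝ}
    {V : (Fin k → E d) →ᵇ ℝ} (hC : ∀ n y, |W n y| ≤ C)
    (h : ∀ y, Tendsto (fun n => W n y) atTop (𝓝 (V y))) (l : SubProb X d) :
    Tendsto (fun n => l.integral f (W n)) atTop (𝓝 (l.integral f V)) := by
  refine tendsto_integral_of_dominated_convergence (fun _ => ‖f‖ ^ k * C)
    (fun n => (l.integrable_tensor f (W n)).aestronglyMeasurable) (integrable_const _)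
    (fun n => ae_of_all _ fun z => ?_) (ae_of_all _ fun z => (h _).const_mul _)
  rw [norm_mul, norm_prod]
  refine mul_le_mul ?_ (hC n _) (norm_nonneg _) (by positivity)
  refine (Finset.prod_le_prod (fun _ _ => norm_nonneg _)
    (fun i _ => f.norm_coe_le_norm _)).trans ?_
  simp

/-- Equality of the functionals for kernels vanishing at infinity extends to all bounded
continuous translation invariant kernels. -/
lemma tsum_integral_eq_of_transInv {f : X →ᵇ ℝ} (hf : ∀ x, |f x| ≤ 1) {l m : ℕ → SubProb X d}
    (hl : ∑' j, (l j).1 Set.univ ≤ 1) (hm : ∑' j, (m j).1 Set.univ ≤ 1) {k : ℕ} (hk : 0 < k)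
    (h : ∀ W ∈ transInv d k, ∑' j, (l j).integral f W = ∑' j, (m j).integral f W)
    (G : (Fin k → E d) →ᵇ ℝ) (hG : ∀ a y, G (fun i => y i + a) = G y) :
    ∑' j, (l j).integral f G = ∑' j, (m j).integral f G := by
  obtain ⟨k, rfl⟩ : ∃ n, k = n + 1 := ⟨k - 1, by omega⟩
  have hlim : ∀ r : ℕ → SubProb X d, ∑' j, (r j).1 Set.univ ≤ 1 →
      Tendsto (fun n => ∑' j, (r j).integral f (truncate G n)) atTop
        (𝓝 (∑' j, (r j).integral f G)) := by
    intro r hr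
    have hb : ∀ n y, |truncate G n y| ≤ ‖G‖ := fun n y =>
      (abs_truncate_le G n y).trans (abs_le_norm_apply G y)
    exact tendsto_tsum_of_dominated_convergence ((summable_mass hr).1.mul_left ‖G‖)
      (fun j => (r j).tendsto_integral hb (tendsto_truncate G))
      (Eventually.of_forall fun n j => (r j).abs_integral_le hf hk (hb n))
  have h2 := hlim m hm
  simp only [← h _ (truncate_mem hG _)] at h2
  exact tendsto_nhds_unique (hlim l hl) h2

end Extension

/-! ### Points at distance zero coincide -/

section Metric

variable {X : Type*} [MetricSpace X] [MeasurableSpace X] [BorelSpace X] {d : ℕ}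

lemma Represents.tsum_univ_le {T : Configuration X d} {l : ℕ → SubProb X d}
    (h : Represents T l) : ∑' j, (l j).1 Set.univ ≤ 1 :=
  tsum_mass_le fun _ hA => h.tsum_marginal_le hA

lemma TestFamily.dist_def (S : TestFamily X d) (T₁ T₂ : S.Space) :
    dist T₁ T₂ = S.orbitDist T₁ T₂ + S.probDist T₁.β T₂.β := rfl

lemma weighted_tsum_eq_zero {u v : ℕ → ℝ} (hu : ∀ r, |u r| ≤ 1) (hv : ∀ r, |v r| ≤ 1)
    (h : ∑' r : ℕ, (1 / 2 : ℝ) ^ (r + 1) * |u r - v r| = 0) (r : ℕ) : u r = v r := by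
  have h1 := ((TestFamily.summable_weighted hu hv).hasSum_iff.2 h)
  rw [hasSum_zero_iff_of_nonneg (fun r => by positivity)] at h1
  have h2 := congrFun h1 r
  simp only [Pi.zero_apply, mul_eq_zero, abs_eq_zero] at h2
  rcases h2 with h2 | h2
  · exact absurd h2 (by positivity)
  · linarith

lemma TestFamily.eq_of_dist_eq_zero (S : TestFamily X d) {T₁ T₂ : S.Space}
    (h : dist T₁ T₂ = 0) :
    (∀ r, S.term r T₁ = S.term r T₂) ∧
      ∀ j, ∫ x, S.f j x ∂(T₁.β : Measure X) = ∫ x, S.f j x ∂(T₂.β : Measure X) := by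
  rw [S.dist_def] at h
  have h1 : 0 ≤ S.orbitDist T₁ T₂ := tsum_nonneg fun r => by positivity
  have h2 : 0 ≤ S.probDist T₁.β T₂.β := tsum_nonneg fun r => by positivity
  exact ⟨weighted_tsum_eq_zero (S.abs_term_le · T₁) (S.abs_term_le · T₂)
      (by change S.orbitDist T₁ T₂ = 0; linarith),
    weighted_tsum_eq_zero (S.abs_integral_le · T₁.β) (S.abs_integral_le · T₂.β)
      (by change S.probDist T₁.β T₂.β = 0; linarith)⟩

/-- Both sides are continuous in the kernel, so agreement passes from the listed kernels to `ℭ_k` by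
density and then to all invariant kernels by truncation. -/
lemma TestFamily.tsum_integral_eq (S : TestFamily X d) {T₁ T₂ : Configuration X d}
    (h : ∀ r, S.term r T₁ = S.term r T₂) {l m : ℕ → SubProb X d} (hl : Represents T₁ l)
    (hm : Represents T₂ m) (j : ℕ) {k : ℕ} (hk : 2 ≤ k) (G : (Fin k → E d) →ᵇ ℝ)
    (hG : ∀ a y, G (fun i => y i + a) = G y) :
    ∑' i, (l i).integral (S.f j) G = ∑' i, (m i).integral (S.f j) G := by
  have hk0 : 0 < k := by omega
  refine tsum_integral_eq_of_transInv (S.abs_f_le j) hl.tsum_univ_le hm.tsum_univ_le hk0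
    (fun W hW => ?_) G hG
  let L := totalIntegral (S.f j) (S.abs_f_le j) hk0 l hl.tsum_univ_le
    - totalIntegral (S.f j) (S.abs_f_le j) hk0 m hm.tsum_univ_le
  have hle : (Submodule.span ℝ (Set.range (S.W ⟨k, hk⟩))).topologicalClosure
      ≤ LinearMap.ker L.toLinearMap := by
    refine Submodule.topologicalClosure_minimal _ (Submodule.span_le.2 ?_) L.isClosed_ker
    rintro _ ⟨i, rfl⟩
    obtain ⟨r, hr⟩ := S.enum_surjective (j, ⟨k, hk⟩, i)
    have h1 : ∀ p, S.enum r = p → T₁.functional (S.f p.1) ⟨S.W p.2.1 p.2.2, S.W_mem _ _⟩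
        = T₂.functional (S.f p.1) ⟨S.W p.2.1 p.2.2, S.W_mem _ _⟩ := by
      rintro _ rfl
      exact h r
    have h1 := h1 _ hr
    rw [hl.functional_eq (S.abs_f_le j) hk0, hm.functional_eq (S.abs_f_le j) hk0] at h1
    exact sub_eq_zero.2 h1
  exact sub_eq_zero.1 (hle (S.W_dense ⟨k, hk⟩ hW))

lemma setOf_weightEquiv_eq {f : X →ᵇ ℝ} {r : SubProb X d} {l : ℕ → SubProb X d}
    (h : ∀ j, orbit r ≠ orbit (l j) → ¬ WeightEquiv f r (l j)) :
    {j | WeightEquiv f r (l j)} = {j | orbit (l j) = orbit r} := by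
  ext j
  constructor
  · intro hj
    by_contra hne
    exact h j (fun h0 => hne h0.symm) hj
  · intro hj
    exact weightEquiv_of_orbit_eq f (Eq.symm hj)

/-- For a weight with values in `[1/2, 1]`, members equivalent to `r` have at least half its mass.
Only finitely many members qualify, so one weight separates `r` from all of them with a different
orbit; the count of equivalent members is then the multiplicity. -/
lemma TestFamily.configuration_ext (S : TestFamily X d) (hS : S.MidpointClosed)
    {T₁ T₂ : Configuration X d} (h1 : ∀ r, S.term r T₁ = S.term r T₂)
    (h2 : ∀ j, ∫ x, S.f j x ∂(T₁.β : Measure X) = ∫ x, S.f j x ∂(T₂.β : Measure X)) :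
    T₁ = T₂ := by
  obtain ⟨l, hl⟩ := exists_represents T₁
  obtain ⟨m, hm⟩ := exists_represents T₂
  refine Configuration.ext ?_ ?_
  · funext o
    by_cases ho : o = zeroOrbit
    · rw [ho, Configuration.mult_zero, Configuration.mult_zero]
    obtain ⟨r, rfl⟩ : ∃ r, orbit r = o := ⟨Quotient.out o, Quotient.out_eq o⟩
    have hr : r ≠ 0 := fun h0 => ho (orbit_eq_zeroOrbit_iff.2 h0)
    have hpos := mass_pos hr
    have hfin : ∀ q : ℕ → SubProb X d, ∑' j, (q j).1 Set.univ ≤ 1 →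
        {j | ENNReal.ofReal (r.mass / 2) ≤ (q j).1 Set.univ}.Finite := fun q hq =>
      ENNReal.finite_const_le_of_tsum_ne_top (ne_top_of_le_ne_top ENNReal.one_ne_top hq)
        (by simpa using hpos)
    let s : Set (SubProb X d) :=
      {q | orbit r ≠ orbit q} ∩ (l '' {j | ENNReal.ofReal (r.mass / 2) ≤ (l j).1 Set.univ} ∪
        m '' {j | ENNReal.ofReal (r.mass / 2) ≤ (m j).1 Set.univ})
    have hs : s.Finite := (((hfin l hl.tsum_univ_le).image l).union
      ((hfin m hm.tsum_univ_le).image m)).inter_of_right _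
    obtain ⟨j, hj, hj'⟩ := exists_separating_finset hS hr s hs fun q hq => hq.1
    have hlarge : ∀ q : SubProb X d, WeightEquiv (S.f j) r q →
        ENNReal.ofReal (r.mass / 2) ≤ q.1 Set.univ := by
      intro q hq
      rw [← q.ofReal_mass]
      refine ENNReal.ofReal_le_ofReal ?_
      have h3 := half_mass_le hj r
      have h4 := integral_le_mass (S.abs_f_le j) q
      rw [hq.integral_eq] at h4
      exact h3.trans h4
    have hcount := tsum_weightEquiv_eq (fun x => le_trans (by norm_num) (hj x)) (S.abs_f_le j)
      hl.tsum_univ_le hm.tsum_univ_le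
      (fun k hk G hG => S.tsum_integral_eq h1 hl hm j hk G hG) r
    rw [setOf_weightEquiv_eq (l := l) fun i hi hw =>
        hj' _ ⟨hi, Or.inl ⟨i, hlarge _ hw, rfl⟩⟩ hw,
      setOf_weightEquiv_eq (l := m) fun i hi hw =>
        hj' _ ⟨hi, Or.inr ⟨i, hlarge _ hw, rfl⟩⟩ hw,
      tsum_const_fiber _ (hl _ ho).1, tsum_const_fiber _ (hm _ ho).1] at hcount
    rw [(hl _ ho).2, (hm _ ho).2]
    have h5 : ENNReal.ofReal (∫ z, S.f j z.1 ∂r.1) ^ 2 ≠ 0 := by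
      have := half_mass_le hj r
      refine pow_ne_zero _ ?_
      rw [Ne, ENNReal.ofReal_eq_zero, not_le]
      linarith
    have h6 : ENNReal.ofReal (∫ z, S.f j z.1 ∂r.1) ^ 2 ≠ ∞ :=
      ENNReal.pow_ne_top ENNReal.ofReal_ne_top
    exact_mod_cast (ENNReal.mul_left_inj h5 h6).1 hcount
  · exact ProbabilityMeasure.toMeasure_injective (S.measure_ext (by simp) h2)

/-- For test families that are closed under midpoints and contain the constant `1`, points at
distance `0` are equal. -/
theorem TestFamily.eq_of_dist_zero {S : TestFamily X d} (hS : S.MidpointClosed) {T₁ T₂ : S.Space}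
    (h : dist T₁ T₂ = 0) : T₁ = T₂ :=
  S.configuration_ext hS (S.eq_of_dist_eq_zero h).1 (S.eq_of_dist_eq_zero h).2

end Metric

/-! ### Vague limits through compactification of `ℝᵈ` -/

section Compactification

variable {X : Type*} [MetricSpace X] [SecondCountableTopology X] [MeasurableSpace X]
  [BorelSpace X] {d : ℕ}

/-- Inverse stereographic projection onto the sphere `‖u‖² + t² = t`; the point at infinity is
the origin. -/
def stereo (y : E d) : E d × ℝ := ((1 + ‖y‖ ^ 2)⁻¹ • y, (1 + ‖y‖ ^ 2)⁻¹)

lemma continuous_stereo : Continuous (stereo : E d → E d × ℝ) := by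
  unfold stereo
  have h : ∀ y : E d, 1 + ‖y‖ ^ 2 ≠ 0 := fun y => by positivity
  have h1 : Continuous fun y : E d => (1 + ‖y‖ ^ 2)⁻¹ := by
    refine Continuous.inv₀ (by fun_prop) h
  fun_prop

lemma norm_stereo_le (y : E d) : ‖stereo y‖ ≤ 1 := by
  have h : 0 < 1 + ‖y‖ ^ 2 := by positivity
  refine max_le ?_ ?_
  · simp only [stereo]
    rw [norm_smul, norm_inv, Real.norm_of_nonneg h.le, inv_mul_le_iff₀ h]
    nlinarith [sq_nonneg (‖y‖ - 1), norm_nonneg y]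
  · simp only [stereo]
    rw [norm_inv, Real.norm_of_nonneg h.le]
    exact inv_le_one_of_one_le₀ (by nlinarith [sq_nonneg ‖y‖])

lemma stereo_sphere (y : E d) : ‖(stereo y).1‖ ^ 2 + (stereo y).2 ^ 2 = (stereo y).2 := by
  have h : 0 < 1 + ‖y‖ ^ 2 := by positivity
  simp only [stereo]
  rw [norm_smul, norm_inv, Real.norm_of_nonneg h.le]
  field_simp
  ring

/-- The inverse of `stereo`, extended by a junk value outside of the sphere. -/
def unstereo (z : X × (E d × ℝ)) : X × E d := (z.1, z.2.2⁻¹ • z.2.1)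

lemma measurable_unstereo : Measurable (unstereo : X × (E d × ℝ) → X × E d) := by
  unfold unstereo
  fun_prop

/-- The preimage of `ℝᵈ` in the compactification. -/
def finitePart (X : Type*) (d : ℕ) : Set (X × (E d × ℝ)) := {z | 0 < z.2.2}

lemma measurableSet_finitePart : MeasurableSet (finitePart X d) :=
  measurableSet_lt measurable_const (measurable_snd.comp measurable_snd)

/-- A cutoff that is `1` on `[c, ∞)` and `0` on `(-∞, c/2]`. -/
def ramp (c t : ℝ) : ℝ := max 0 (min 1 (2 * t / c - 1))

lemma ramp_eq_one {c t : ℝ} (hc : 0 < c) (h : c ≤ t) : ramp c t = 1 := by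
  unfold ramp
  rw [min_eq_left, max_eq_right zero_le_one]
  rw [le_sub_iff_add_le, le_div_iff₀ hc]
  linarith

lemma ramp_eq_zero {c t : ℝ} (hc : 0 < c) (h : t ≤ c / 2) : ramp c t = 0 := by
  unfold ramp
  rw [max_eq_left]
  refine (min_le_right _ _).trans ?_
  rw [sub_nonpos, div_le_one hc]
  linarith

lemma abs_ramp_le (c t : ℝ) : |ramp c t| ≤ 1 := by
  unfold ramp
  rw [abs_of_nonneg (le_max_left _ _)]
  exact max_le zero_le_one (min_le_left _ _)

/-- The extension of `∏ f(x_i) Ψ(y)` to the compactification. -/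
def extendKernel (f : X →ᵇ ℝ) {k : ℕ} (Ψ : (Fin k → E d) →ᵇ ℝ) {c : ℝ} (hc : 0 < c) :
    (Fin k → X × (E d × ℝ)) →ᵇ ℝ :=
  BoundedContinuousFunction.ofNormedAddCommGroup
    (fun v => (∏ i, f (v i).1) * (Ψ (fun i => (max (v i).2.2 (c / 2))⁻¹ • (v i).2.1)
      * ∏ i, ramp c (v i).2.2))
    (by
      have h : ∀ t : ℝ, max t (c / 2) ≠ 0 := fun t =>
        (lt_of_lt_of_le (by positivity) (le_max_right _ _)).ne'
      have h1 : Continuous fun v : Fin k → X × (E d × ℝ) =>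
          Ψ (fun i => (max (v i).2.2 (c / 2))⁻¹ • (v i).2.1) := by
        refine Ψ.continuous.comp (continuous_pi fun i => ?_)
        exact Continuous.smul (Continuous.inv₀ (by fun_prop) fun v => h _) (by fun_prop)
      have h2 : Continuous fun v : Fin k → X × (E d × ℝ) => ∏ i, ramp c (v i).2.2 := by
        unfold ramp
        fun_prop
      exact (by fun_prop : Continuous fun v : Fin k → X × (E d × ℝ) => ∏ i, f (v i).1).mul
        (h1.mul h2)) (‖f‖ ^ k * (‖Ψ‖ * 1))
    (fun v => by
      rw [norm_mul, norm_prod, norm_mul]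
      refine mul_le_mul ?_ ?_ (by positivity) (by positivity)
      · refine (Finset.prod_le_prod (fun _ _ => norm_nonneg _)
          (fun i _ => f.norm_coe_le_norm _)).trans ?_
        simp
      · refine mul_le_mul (Ψ.norm_coe_le_norm _) ?_ (norm_nonneg _) (norm_nonneg _)
        rw [norm_prod]
        exact Finset.prod_le_one (fun _ _ => norm_nonneg _) fun i _ => abs_ramp_le _ _)

lemma extendKernel_apply (f : X →ᵇ ℝ) {k : ℕ} (Ψ : (Fin k → E d) →ᵇ ℝ) {c : ℝ} (hc : 0 < c)
    (v : Fin k → X × (E d × ℝ)) : extendKernel f Ψ hc v = (∏ i, f (v i).1) *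
      (Ψ (fun i => (max (v i).2.2 (c / 2))⁻¹ • (v i).2.1) * ∏ i, ramp c (v i).2.2) := rfl

/-- The point of the sphere over `y` has height `1 / (1 + ‖y‖²)`. Heights below `c` thus mean `‖y‖ >
R`, where `Ψ` vanishes, so the cutoffs `max` and `ramp`, needed for continuity at infinity, do not
alter the kernel. -/
lemma extendKernel_eq_indicator (f : X →ᵇ ℝ) {k : ℕ} {Ψ : (Fin k → E d) →ᵇ ℝ} {R : ℝ}
    (hΨ : ∀ y i, R < ‖y i‖ → Ψ y = 0) {c : ℝ} (hc : 0 < c) (hcR : c = (1 + R ^ 2)⁻¹)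
    {v : Fin k → X × (E d × ℝ)}
    (hv : ∀ i, ‖(v i).2.1‖ ^ 2 + (v i).2.2 ^ 2 = (v i).2.2) :
    extendKernel f Ψ hc v = (Set.univ.pi fun _ => finitePart X d).indicator
      (fun v => (∏ i, f (unstereo (v i)).1) * Ψ (fun i => (unstereo (v i)).2)) v := by
  have hR1 : 0 < 1 + R ^ 2 := by positivity
  have hsmall : ∀ i, 0 < (v i).2.2 → (v i).2.2 < c → R < ‖(unstereo (v i)).2‖ := by
    intro i h0 h1
    by_contra! h2
    simp only [unstereo] at h2
    rw [norm_smul, norm_inv, Real.norm_of_nonneg h0.le, inv_mul_le_iff₀ h0] at h2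
    have h3 := pow_le_pow_left₀ (norm_nonneg _) h2 2
    have h4 := hv i
    have h5 : (v i).2.2 * (1 + R ^ 2) < 1 := by
      rw [hcR] at h1
      rwa [← one_div, lt_div_iff₀ hR1] at h1
    nlinarith
  by_cases hlow : ∃ i, (v i).2.2 ≤ c / 2
  · obtain ⟨i, hi⟩ := hlow
    have h0 : ∏ i, ramp c (v i).2.2 = 0 :=
      Finset.prod_eq_zero (Finset.mem_univ i) (ramp_eq_zero hc hi)
    rw [extendKernel_apply, h0, mul_zero, mul_zero]
    symm
    by_cases hmem : v ∈ Set.univ.pi fun _ => finitePart X d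
    · have h1 := hΨ (fun i => (unstereo (v i)).2) i
        (hsmall i ((Set.mem_univ_pi.1 hmem) i) (by linarith))
      rw [Set.indicator_of_mem hmem, h1, mul_zero]
    · rw [Set.indicator_of_notMem hmem]
  · push Not at hlow
    have hpos : ∀ i, 0 < (v i).2.2 := fun i => (half_pos hc).trans (hlow i)
    have hmem : v ∈ Set.univ.pi fun _ => finitePart X d := by
      rw [Set.mem_univ_pi]
      exact hpos
    rw [Set.indicator_of_mem hmem, extendKernel_apply]
    have hmax : (fun i => (max (v i).2.2 (c / 2))⁻¹ • (v i).2.1)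
        = fun i => (unstereo (v i)).2 := by
      funext i
      rw [max_eq_left (hlow i).le]
      rfl
    rw [hmax]
    congr 1
    by_cases h0 : Ψ (fun i => (unstereo (v i)).2) = 0
    · rw [h0, zero_mul]
    · rw [Finset.prod_eq_one, mul_one]
      intro i _
      refine ramp_eq_one hc ?_
      by_contra! h1
      exact h0 (hΨ _ i (hsmall i (hpos i) h1))

/-- The part of a measure on the compactification that lives on `X × ℝᵈ`. -/
def uncompactify (Q : Measure (X × (E d × ℝ))) : Measure (X × E d) :=
  (Q.restrict (finitePart X d)).map unstereo

instance (Q : Measure (X × (E d × ℝ))) [IsFiniteMeasure Q] : IsFiniteMeasure (uncompactify Q) := by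
  unfold uncompactify
  infer_instance

lemma integral_extendKernel (f : X →ᵇ ℝ) {k : ℕ} {Ψ : (Fin k → E d) →ᵇ ℝ} {R : ℝ}
    (hΨ : ∀ y i, R < ‖y i‖ → Ψ y = 0) {c : ℝ} (hc : 0 < c) (hcR : c = (1 + R ^ 2)⁻¹)
    (Q : Measure (X × (E d × ℝ))) [IsFiniteMeasure Q]
    (hQ : ∀ᵐ z ∂Q, ‖z.2.1‖ ^ 2 + z.2.2 ^ 2 = z.2.2) :
    ∫ v, extendKernel f Ψ hc v ∂(Measure.pi fun _ => Q)
      = ∫ z : Fin k → X × E d, (∏ i, f (z i).1) * Ψ (fun i => (z i).2)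
        ∂(Measure.pi fun _ => uncompactify Q) := by
  have hae : ∀ᵐ v ∂(Measure.pi fun _ : Fin k => Q),
      ∀ i, ‖(v i).2.1‖ ^ 2 + (v i).2.2 ^ 2 = (v i).2.2 :=
    eventually_all.2 fun i => 
      (Measure.tendsto_eval_ae_ae (μ := fun _ : Fin k => Q) (i := i)).eventually hQ
  have hpi : (Measure.pi fun _ : Fin k => uncompactify Q)
      = ((Measure.pi fun _ : Fin k => Q).restrict (Set.univ.pi fun _ => finitePart X d)).map
        (fun v i => unstereo (v i)) := by
    rw [Measure.restrict_pi_pi]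
    have h := Measure.pi_map_pi (μ := fun _ : Fin k => Q.restrict (finitePart X d))
      (f := fun _ => unstereo)
      (hμ := fun _ => inferInstanceAs (SigmaFinite (uncompactify Q)))
      (fun _ => measurable_unstereo.aemeasurable)
    exact h.symm
  have hmeas : Measurable fun v : Fin k → X × (E d × ℝ) => fun i => unstereo (v i) :=
    measurable_pi_lambda _ fun i => measurable_unstereo.comp (measurable_pi_apply i)
  have hF : Measurable fun z : Fin k → X × E d => (∏ i, f (z i).1) * Ψ (fun i => (z i).2) := by
    have h1 : Measurable fun z : Fin k → X × E d => ∏ i, f (z i).1 :=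
      Finset.measurable_prod _ fun i _ =>
        f.continuous.measurable.comp (measurable_fst.comp (measurable_pi_apply i))
    exact h1.mul (Ψ.continuous.measurable.comp
      (measurable_pi_lambda _ fun i => measurable_snd.comp (measurable_pi_apply i)))
  rw [hpi, integral_map hmeas.aemeasurable hF.aestronglyMeasurable,
    ← integral_indicator (MeasurableSet.univ_pi fun _ => measurableSet_finitePart)]
  refine integral_congr_ae ?_
  filter_upwards [hae] with v hv
  exact extendKernel_eq_indicator f hΨ hc hcR hv

/-- A sub-probability measure on `X × ℝᵈ`, pushed to the compactification; the missing mass is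
put at infinity. -/
def compactify (l : SubProb X d) (b : ProbabilityMeasure X) : Measure (X × (E d × ℝ)) :=
  l.1.map (fun z => (z.1, stereo z.2)) + (1 - l.1 Set.univ) • (b : Measure X).map fun x => (x, 0)

lemma measurable_stereo : Measurable fun z : X × E d => (z.1, stereo z.2) :=
  measurable_fst.prodMk (continuous_stereo.measurable.comp measurable_snd)

lemma measurable_infinity : Measurable fun x : X => (x, (0 : E d × ℝ)) :=
  measurable_id.prodMk measurable_const

lemma compactify_apply (l : SubProb X d) (b : ProbabilityMeasure X) {A : Set (X × (E d × ℝ))}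
    (hA : MeasurableSet A) : compactify l b A = l.1 ((fun z => (z.1, stereo z.2)) ⁻¹' A)
      + (1 - l.1 Set.univ) * (b : Measure X) ((fun x => (x, 0)) ⁻¹' A) := by
  unfold compactify
  rw [Measure.add_apply, Measure.smul_apply, Measure.map_apply measurable_stereo hA,
    Measure.map_apply measurable_infinity hA, smul_eq_mul]

instance (l : SubProb X d) (b : ProbabilityMeasure X) : IsProbabilityMeasure (compactify l b) :=
  ⟨by
    rw [compactify_apply l b MeasurableSet.univ]
    simp only [Set.preimage_univ, measure_univ, mul_one]
    exact add_tsub_cancel_of_le l.2⟩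

lemma ae_compactify_sphere (l : SubProb X d) (b : ProbabilityMeasure X) :
    ∀ᵐ z ∂(compactify l b), ‖z.2.1‖ ^ 2 + z.2.2 ^ 2 = z.2.2 := by
  have hm : MeasurableSet {z : X × (E d × ℝ) | ‖z.2.1‖ ^ 2 + z.2.2 ^ 2 = z.2.2}ᶜ :=
    (isClosed_eq (by fun_prop) (by fun_prop)).measurableSet.compl
  change compactify l b _ = 0
  rw [compactify_apply l b hm]
  have h1 : (fun z : X × E d => (z.1, stereo z.2)) ⁻¹'
      {z : X × (E d × ℝ) | ‖z.2.1‖ ^ 2 + z.2.2 ^ 2 = z.2.2}ᶜ = ∅ :=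
    Set.eq_empty_of_forall_notMem fun z hz => hz (stereo_sphere z.2)
  have h2 : (fun x : X => (x, (0 : E d × ℝ))) ⁻¹'
      {z : X × (E d × ℝ) | ‖z.2.1‖ ^ 2 + z.2.2 ^ 2 = z.2.2}ᶜ = ∅ :=
    Set.eq_empty_of_forall_notMem fun x hx => hx (by simp)
  rw [h1, h2]
  simp

lemma uncompactify_compactify (l : SubProb X d) (b : ProbabilityMeasure X) :
    uncompactify (compactify l b) = l.1 := by
  ext A hA
  unfold uncompactify
  rw [Measure.map_apply measurable_unstereo hA,
    Measure.restrict_apply (measurable_unstereo hA),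
    compactify_apply l b ((measurable_unstereo hA).inter measurableSet_finitePart)]
  have h1 : (fun z : X × E d => (z.1, stereo z.2)) ⁻¹' (unstereo ⁻¹' A ∩ finitePart X d) = A := by
    ext z
    have h : 0 < 1 + ‖z.2‖ ^ 2 := by positivity
    have h2 : unstereo (z.1, stereo z.2) = z := by
      simp only [unstereo, stereo]
      rw [inv_inv, smul_smul, mul_inv_cancel₀ h.ne', one_smul]
    change unstereo (z.1, stereo z.2) ∈ A ∧ 0 < (1 + ‖z.2‖ ^ 2)⁻¹ ↔ z ∈ A
    rw [h2]
    exact and_iff_left (inv_pos.2 h)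
  have h2 : (fun x : X => (x, (0 : E d × ℝ))) ⁻¹' (unstereo ⁻¹' A ∩ finitePart X d) = ∅ :=
    Set.eq_empty_of_forall_notMem fun x hx => by simpa [finitePart] using hx.2
  rw [h1, h2, measure_empty, mul_zero, add_zero]

/-- The mass at infinity is distributed over `X` according to `b`, so both parts have marginals
dominated by `b`; the second factor stays in the unit ball. -/
lemma isTight_compactify {b : ℕ → ProbabilityMeasure X}
    (hb : IsTightMeasureSet (Set.range fun n => (b n : Measure X))) {l : ℕ → SubProb X d}
    (hl : ∀ n A, MeasurableSet A → (l n).1.map Prod.fst A ≤ (b n : Measure X) A) :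
    IsTightMeasureSet (Set.range fun n => compactify (l n) (b n)) := by
  rw [isTightMeasureSet_iff_exists_isCompact_measure_compl_le] at hb ⊢
  intro ε hε
  obtain ⟨K, hK, hKb⟩ := hb (ε / 2) (ENNReal.half_pos hε.ne')
  refine ⟨K ×ˢ Metric.closedBall 0 1, hK.prod (isCompact_closedBall 0 1), ?_⟩
  rintro _ ⟨n, rfl⟩
  have hb' := hKb _ ⟨n, rfl⟩
  simp only at hb' ⊢
  rw [compactify_apply _ _ (hK.prod (isCompact_closedBall 0 1)).measurableSet.compl]
  have h1 : (fun z : X × E d => (z.1, stereo z.2)) ⁻¹' (K ×ˢ Metric.closedBall 0 1)ᶜ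
      ⊆ Prod.fst ⁻¹' Kᶜ := by
    intro z hz hzK
    exact hz ⟨hzK, by simpa using norm_stereo_le z.2⟩
  have h2 : (fun x : X => (x, (0 : E d × ℝ))) ⁻¹' (K ×ˢ Metric.closedBall 0 1)ᶜ ⊆ Kᶜ := by
    intro x hx hxK
    exact hx ⟨hxK, by simp⟩
  have h3 : (l n).1 (Prod.fst ⁻¹' Kᶜ) ≤ (b n : Measure X) Kᶜ := by
    have := hl n _ hK.measurableSet.compl
    rwa [Measure.map_apply measurable_fst hK.measurableSet.compl] at this
  calc _ ≤ (b n : Measure X) Kᶜ + 1 * (b n : Measure X) Kᶜ :=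
        add_le_add ((measure_mono h1).trans h3) (mul_le_mul' tsub_le_self (measure_mono h2))
    _ ≤ ε / 2 + ε / 2 := by rw [one_mul]; exact add_le_add hb' hb'
    _ = ε := ENNReal.add_halves ε

/-- Vague limits along an ultrafilter of measures with tight `X`-marginals. -/
lemma exists_vague_limit {b : ℕ → ProbabilityMeasure X}
    (hb : IsTightMeasureSet (Set.range fun n => (b n : Measure X))) {l : ℕ → SubProb X d}
    (hl : ∀ n A, MeasurableSet A → (l n).1.map Prod.fst A ≤ (b n : Measure X) A)
    (𝒰 : Ultrafilter ℕ) :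
    ∃ m : SubProb X d, ∀ (f : X →ᵇ ℝ) (k : ℕ) (Ψ : (Fin k → E d) →ᵇ ℝ) (R : ℝ),
      (∀ y i, R < ‖y i‖ → Ψ y = 0) →
      Tendsto (fun n => (l n).integral f Ψ) 𝒰 (𝓝 (m.integral f Ψ)) := by
  -- Prokhorov's theorem gives a weak limit of the compactified measures; dropping its part at
  -- infinity gives `m`.
  let P : ℕ → ProbabilityMeasure (X × (E d × ℝ)) := fun n => ⟨compactify (l n) (b n), inferInstance⟩
  have hcomp : IsCompact (closure (Set.range P)) := by
    refine isCompact_closure_of_isTightMeasureSet ?_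
    have : {((μ : ProbabilityMeasure (X × (E d × ℝ))) : Measure (X × (E d × ℝ))) | μ ∈ Set.range P}
        = Set.range fun n => compactify (l n) (b n) := by
      ext μ
      constructor
      · rintro ⟨_, ⟨n, rfl⟩, rfl⟩
        exact ⟨n, rfl⟩
      · rintro ⟨n, rfl⟩
        exact ⟨P n, ⟨n, rfl⟩, rfl⟩
    rw [this]
    exact isTight_compactify hb hl
  obtain ⟨Q, -, hQ⟩ := hcomp.ultrafilter_le_nhds' (𝒰.map P)
    (Filter.mem_map.2 (Eventually.of_forall fun n => subset_closure ⟨n, rfl⟩))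
  have hlim : Tendsto P 𝒰 (𝓝 Q) := hQ
  -- The sphere is the zero set of the bounded continuous function `g ≥ 0`, so the limit is still
  -- carried by it.
  have hsphere : ∀ᵐ z ∂(Q : Measure (X × (E d × ℝ))), ‖z.2.1‖ ^ 2 + z.2.2 ^ 2 = z.2.2 := by
    let g : (X × (E d × ℝ)) →ᵇ ℝ := BoundedContinuousFunction.ofNormedAddCommGroup
      (fun z => min 1 |‖z.2.1‖ ^ 2 + z.2.2 ^ 2 - z.2.2|) (by fun_prop) 1 (fun z => by
        rw [Real.norm_of_nonneg (le_min zero_le_one (abs_nonneg _))]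
        exact min_le_left _ _)
    have hg := (ProbabilityMeasure.tendsto_iff_forall_integral_tendsto.1 hlim) g
    have hg0 : ∀ n, ∫ z, g z ∂(P n : Measure (X × (E d × ℝ))) = 0 := by
      intro n
      refine integral_eq_zero_of_ae ?_
      filter_upwards [ae_compactify_sphere (l n) (b n)] with z hz
      simp [g, hz]
    simp only [hg0] at hg
    have hg1 : ∫ z, g z ∂(Q : Measure (X × (E d × ℝ))) = 0 :=
      tendsto_nhds_unique hg tendsto_const_nhds
    have hg2 := (integral_eq_zero_iff_of_nonneg (f := fun z => g z)
      (fun z => le_min zero_le_one (abs_nonneg _)) (g.integrable _)).1 hg1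
    filter_upwards [hg2] with z hz
    have hz' : min 1 |‖z.2.1‖ ^ 2 + z.2.2 ^ 2 - z.2.2| = 0 := hz
    rcases min_choice 1 |‖z.2.1‖ ^ 2 + z.2.2 ^ 2 - z.2.2| with h | h
    · rw [h] at hz'
      norm_num at hz'
    · rw [h, abs_eq_zero] at hz'
      linarith
  refine ⟨⟨uncompactify (Q : Measure (X × (E d × ℝ))), ?_⟩, fun f k Ψ R hΨ => ?_⟩
  · unfold uncompactify
    rw [Measure.map_apply measurable_unstereo MeasurableSet.univ]
    exact (Measure.restrict_apply_le _ _).trans prob_le_one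
  · have hΨ' : ∀ y i, max R 0 < ‖y i‖ → Ψ y = 0 := fun y i h => hΨ y i ((le_max_left _ _).trans_lt h)
    have hc : 0 < (1 + max R 0 ^ 2)⁻¹ := by positivity
    -- Having probability measures lets weak convergence pass to the `k`-fold products.
    have hpi : Tendsto (fun n => ProbabilityMeasure.pi fun _ : Fin k => P n) 𝒰
        (𝓝 (ProbabilityMeasure.pi fun _ : Fin k => Q)) :=
      (ProbabilityMeasure.continuous_pi.tendsto _).comp (tendsto_pi_nhds.2 fun _ => hlim)
    have h := (ProbabilityMeasure.tendsto_iff_forall_integral_tendsto.1 hpi) (extendKernel f Ψ hc)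
    simp only [ProbabilityMeasure.toMeasure_pi] at h
    rw [integral_extendKernel f hΨ' hc rfl _ hsphere] at h
    have h2 : ∀ n, ∫ v, extendKernel f Ψ hc v ∂(Measure.pi fun _ : Fin k =>
        (P n : Measure (X × (E d × ℝ)))) = (l n).integral f Ψ := by
      intro n
      change ∫ v, extendKernel f Ψ hc v ∂(Measure.pi fun _ : Fin k => compactify (l n) (b n)) = _
      rw [integral_extendKernel f hΨ' hc rfl _
        (ae_compactify_sphere (l n) (b n))]
      rw [uncompactify_compactify]
      rfl
    simp only [h2] at h
    exact h

end Compactification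

/-! ### Greedy exhaustion of mass -/

section Greedy

variable {Ω P : Type*} [MeasurableSpace Ω]

lemma exists_half_maximizer [Nonempty P] (F : P → ℝ) {C : ℝ} (h0 : ∀ q, 0 ≤ F q)
    (hC : ∀ q, F q ≤ C) : ∃ p, ∀ q, F q ≤ 2 * F p := by
  have hbdd : BddAbove (Set.range F) := ⟨C, by rintro _ ⟨q, rfl⟩; exact hC q⟩
  rcases (Real.iSup_nonneg h0).eq_or_lt with h | h
  · refine ⟨Classical.arbitrary P, fun q => ?_⟩
    have := le_ciSup hbdd q
    linarith [h0 (Classical.arbitrary P)]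
  · obtain ⟨p, hp⟩ := exists_lt_of_lt_ciSup (half_lt_self h)
    exact ⟨p, fun q => by linarith [le_ciSup hbdd q]⟩

/-- What is left after the functions `φ (p 0), …, φ (p (I - 1))` have been split off. -/
def residual (φ : P → Ω → ℝ) (p : ℕ → P) (I : ℕ) (ω : Ω) : ℝ :=
  ∏ i ∈ Finset.range I, (1 - φ (p i) ω)

/-- Greedy choice: if each `φ (p i)` nearly maximises the mass taken from the residual, no `φ q`
sees much of the residual. -/
lemma exists_greedy [Nonempty P] (M : Measure Ω) (hM : M Set.univ ≤ 1) {φ : P → Ω → ℝ}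
    (hφ : ∀ p, Measurable (φ p)) (h0 : ∀ p ω, 0 ≤ φ p ω) (h1 : ∀ p ω, φ p ω ≤ 1) :
    ∃ p : ℕ → P, ∀ (I : ℕ) (q : P), (I : ℝ) * ∫ ω, φ q ω * residual φ p I ω ∂M ≤ 2 := by
  classical
  have : IsFiniteMeasure M := ⟨hM.trans_lt ENNReal.one_lt_top⟩
  have hM1 : M.real Set.univ ≤ 1 := by
    simpa [Measure.real] using ENNReal.toReal_mono ENNReal.one_ne_top hM
  have hres_meas : ∀ p I, Measurable (residual φ p I) := fun p I =>
    Finset.measurable_prod _ fun i _ => measurable_const.sub (hφ _)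
  have hres0 : ∀ p I ω, 0 ≤ residual φ p I ω := fun p I ω =>
    Finset.prod_nonneg fun i _ => sub_nonneg.2 (h1 _ _)
  have hres1 : ∀ p I ω, residual φ p I ω ≤ 1 := fun p I ω =>
    Finset.prod_le_one (fun i _ => sub_nonneg.2 (h1 _ _)) fun i _ => by linarith [h0 (p i) ω]
  have hint : ∀ q p I, Integrable (fun ω => φ q ω * residual φ p I ω) M := fun q p I =>
    Integrable.of_bound (C := 1) ((hφ q).mul (hres_meas p I)).aestronglyMeasurable
      (ae_of_all _ fun ω => by
        rw [Real.norm_of_nonneg (mul_nonneg (h0 _ _) (hres0 _ _ _))]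
        exact mul_le_one₀ (h1 _ _) (hres0 _ _ _) (hres1 _ _ _))
  have hle1 : ∀ q p I, ∫ ω, φ q ω * residual φ p I ω ∂M ≤ 1 := fun q p I => by
    have := norm_integral_le_of_norm_le_const (μ := M) (C := 1)
      (f := fun ω => φ q ω * residual φ p I ω) (ae_of_all _ fun ω => by
        rw [Real.norm_of_nonneg (mul_nonneg (h0 _ _) (hres0 _ _ _))]
        exact mul_le_one₀ (h1 _ _) (hres0 _ _ _) (hres1 _ _ _))
    exact (le_abs_self _).trans (this.trans (by linarith))
  have hstep : ∀ (I : ℕ) (p : ℕ → P), ∃ c, ∀ q,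
      ∫ ω, φ q ω * residual φ p I ω ∂M ≤ 2 * ∫ ω, φ c ω * residual φ p I ω ∂M := fun I p =>
    exists_half_maximizer _ (fun q => integral_nonneg fun ω =>
      mul_nonneg (h0 _ _) (hres0 _ _ _)) (fun q => hle1 q p I)
  choose next hnext using hstep
  -- Each choice depends on the preceding ones. Stage `I + 1` changes only the value at `I`, so
  -- earlier values persist and the diagonal `p` agrees with every stage on its initial segment.
  let s : ℕ → ℕ → P := fun I => Nat.rec (fun _ => Classical.arbitrary P)
    (fun I p => Function.update p I (next I p)) I
  have hs : ∀ I, s (I + 1) = Function.update (s I) I (next I (s I)) := fun I => rfl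
  let p : ℕ → P := fun i => s (i + 1) i
  have hagree : ∀ I, ∀ i < I, s I i = p i := by
    intro I
    induction I with
    | zero => intro i hi; omega
    | succ I ih =>
      intro i hi
      rcases Nat.lt_succ_iff_lt_or_eq.1 hi with h | rfl
      · rw [hs, Function.update_of_ne h.ne, ih i h]
      · rfl
  have hres : ∀ I, residual φ (s I) I = residual φ p I := fun I => by
    funext ω
    exact Finset.prod_congr rfl fun i hi => by rw [hagree I i (Finset.mem_range.1 hi)]
  have hp : ∀ I q, ∫ ω, φ q ω * residual φ p I ω ∂M
      ≤ 2 * ∫ ω, φ (p I) ω * residual φ p I ω ∂M := by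
    intro I q
    have h := hnext I (s I) q
    have hpI : p I = next I (s I) := by
      change s (I + 1) I = _
      rw [hs, Function.update_self]
    rwa [hres, ← hpI] at h
  have hsum : ∀ I ω, ∑ i ∈ Finset.range I, φ (p i) ω * residual φ p i ω
      = 1 - residual φ p I ω := by
    intro I ω
    induction I with
    | zero => simp [residual]
    | succ I ih =>
      rw [Finset.sum_range_succ, ih]
      unfold residual
      rw [Finset.prod_range_succ]
      ring
  refine ⟨p, fun I q => ?_⟩
  have hanti : ∀ i < I, ∀ ω, residual φ p I ω ≤ residual φ p i ω := by
    intro i hi ω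
    unfold residual
    rw [← Finset.prod_range_mul_prod_Ico _ hi.le]
    exact mul_le_of_le_one_right (hres0 p i ω)
      (Finset.prod_le_one (fun i _ => sub_nonneg.2 (h1 _ _)) fun i _ => by linarith [h0 (p i) ω])
  have htot : ∑ i ∈ Finset.range I, ∫ ω, φ (p i) ω * residual φ p i ω ∂M ≤ 1 := by
    rw [← integral_finsetSum _ fun i _ => hint _ _ _]
    simp only [hsum]
    have := norm_integral_le_of_norm_le_const (μ := M) (C := 1)
      (f := fun ω => 1 - residual φ p I ω) (ae_of_all _ fun ω => by
        rw [Real.norm_of_nonneg (sub_nonneg.2 (hres1 _ _ _))]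
        linarith [hres0 p I ω])
    exact (le_abs_self _).trans (this.trans (by linarith))
  -- The residual decreases with `I`, so what `q` would take at time `I` is at most twice what was
  -- taken at every earlier step; by telescoping, the amounts taken sum to at most `1`.
  calc (I : ℝ) * ∫ ω, φ q ω * residual φ p I ω ∂M
      = ∑ i ∈ Finset.range I, ∫ ω, φ q ω * residual φ p I ω ∂M := by simp
    _ ≤ ∑ i ∈ Finset.range I, 2 * ∫ ω, φ (p i) ω * residual φ p i ω ∂M := by
        refine Finset.sum_le_sum fun i hi => le_trans ?_ (hp i q)
        exact integral_mono (hint _ _ _) (hint _ _ _) fun ω =>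
          mul_le_mul_of_nonneg_left (hanti i (Finset.mem_range.1 hi) ω) (h0 _ _)
    _ ≤ 2 := by rw [← Finset.mul_sum]; linarith

end Greedy

/-! ### Splitting a finite-range kernel along its first point -/

section Split

variable {X : Type*} [TopologicalSpace X] [MeasurableSpace X] [OpensMeasurableSpace X] {d : ℕ}

/-- The kernel `W`, weighted by a function of the first point. -/
def weightFirst {m : ℕ} (ρ : E d →ᵇ ℝ) (W : (Fin (m + 1) → E d) →ᵇ ℝ) :
    (Fin (m + 1) → E d) →ᵇ ℝ :=
  ρ.compContinuous ⟨fun y => y 0, continuous_apply 0⟩ * W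

@[simp] lemma weightFirst_apply {m : ℕ} (ρ : E d →ᵇ ℝ) (W : (Fin (m + 1) → E d) →ᵇ ℝ)
    (y : Fin (m + 1) → E d) : weightFirst ρ W y = ρ (y 0) * W y := rfl

lemma exists_cover (d : ℕ) (R : ℝ) : ∃ t : Finset (E d), ∀ y : E d, ‖y‖ ≤ R →
    1 ≤ ∑ p ∈ t, bump d (y - p) := by
  obtain ⟨t, -, ht, hcov⟩ := (isCompact_closedBall (0 : E d) R).finite_cover_balls zero_lt_one
  lift t to Finset (E d) using ht
  refine ⟨t, fun y hy => ?_⟩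
  have h := hcov (mem_closedBall_zero_iff.2 hy)
  simp only [Set.mem_iUnion, Finset.mem_coe, Metric.mem_ball, exists_prop] at h
  obtain ⟨p, hp, hyp⟩ := h
  rw [dist_eq_norm] at hyp
  calc (1 : ℝ) = bump d (y - p) := (bump_eq_one hyp.le).symm
    _ ≤ _ := Finset.single_le_sum (f := fun p => bump d (y - p)) (fun _ _ => bump_nonneg _) hp

/-- For a fixed second point, the first sees only a bump centred at that point plus `p`, hence mass
at most `δ`. -/
lemma integral_pair_le (l : SubProb X d) {ρ : E d →ᵇ ℝ} (hρ0 : ∀ y, 0 ≤ ρ y) {δ : ℝ}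
    (hδ : ∀ p, ∫ z, bump d (z.2 - p) * ρ z.2 ∂l.1 ≤ δ) (m : ℕ) (p : E d) :
    ∫ z : Fin (m + 2) → X × E d, bump d ((z 0).2 - (z 1).2 - p) * ρ (z 0).2
      ∂(Measure.pi fun _ => l.1) ≤ δ * l.mass := by
  have hδ0 : 0 ≤ δ := le_trans (integral_nonneg fun z => mul_nonneg (bump_nonneg _) (hρ0 _)) (hδ 0)
  have hmp := (measurePreserving_piFinSuccAbove (fun _ : Fin (m + 2) => l.1) 0).symm
  rw [← hmp.integral_comp']
  have hcont : Measurable fun v : (X × E d) × (Fin (m + 1) → X × E d) =>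
      bump d (v.1.2 - (v.2 0).2 - p) * ρ v.1.2 := by
    have h1 : Measurable fun v : (X × E d) × (Fin (m + 1) → X × E d) => v.1.2 :=
      measurable_snd.comp measurable_fst
    have h2 : Measurable fun v : (X × E d) × (Fin (m + 1) → X × E d) => (v.2 0).2 :=
      measurable_snd.comp ((measurable_pi_apply 0).comp measurable_snd)
    exact ((bump d).continuous.measurable.comp ((h1.sub h2).sub_const p)).mul
      (ρ.continuous.measurable.comp h1)
  have hI : Integrable (fun v : (X × E d) × (Fin (m + 1) → X × E d) =>
      bump d (v.1.2 - (v.2 0).2 - p) * ρ v.1.2)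
      (l.1.prod (Measure.pi fun _ : Fin (m + 1) => l.1)) := by
    refine Integrable.of_bound (C := 1 * ‖ρ‖) hcont.aestronglyMeasurable (ae_of_all _ fun v => ?_)
    rw [norm_mul]
    exact mul_le_mul (abs_bump_le _) (ρ.norm_coe_le_norm _) (norm_nonneg _) zero_le_one
  change ∫ v : (X × E d) × (Fin (m + 1) → X × E d),
      bump d (v.1.2 - (v.2 0).2 - p) * ρ v.1.2
      ∂(l.1.prod (Measure.pi fun _ : Fin (m + 1) => l.1)) ≤ _
  rw [integral_prod_symm _ hI]
  have h2 := norm_integral_le_of_norm_le_const (μ := Measure.pi fun _ : Fin (m + 1) => l.1) (C := δ)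
    (f := fun w => ∫ z, bump d (z.2 - (w 0).2 - p) * ρ z.2 ∂l.1) (ae_of_all _ fun w => by
      rw [Real.norm_of_nonneg (integral_nonneg fun z => mul_nonneg (bump_nonneg _) (hρ0 _))]
      simp only [sub_sub]
      exact hδ _)
  exact ((le_abs_self _).trans h2).trans
    (mul_le_mul_of_nonneg_left (l.mass_pi_le (Nat.succ_pos m)) hδ0)

/-- The kernel forces the difference of the first two points into a ball of radius `R`; covering
this ball by bumps reduces to `integral_pair_le`. -/
lemma abs_integral_weightFirst_le {f : X →ᵇ ℝ} (hf : ∀ x, |f x| ≤ 1) {R : ℝ} {t : Finset (E d)}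
    (ht : ∀ y : E d, ‖y‖ ≤ R → 1 ≤ ∑ p ∈ t, bump d (y - p)) {m : ℕ}
    {W : (Fin (m + 2) → E d) →ᵇ ℝ} {C : ℝ} (hC : ∀ y, |W y| ≤ C)
    (hW : ∀ y, R < ‖y 0 - y 1‖ → W y = 0) (l : SubProb X d) {ρ : E d →ᵇ ℝ} (hρ0 : ∀ y, 0 ≤ ρ y)
    {δ : ℝ} (hδ : ∀ p, ∫ z, bump d (z.2 - p) * ρ z.2 ∂l.1 ≤ δ) :
    |l.integral f (weightFirst ρ W)| ≤ C * (t.card * (δ * l.mass)) := by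
  have hC0 : 0 ≤ C := (abs_nonneg _).trans (hC 0)
  have hint : ∀ p, Integrable (fun z : Fin (m + 2) → X × E d =>
      bump d ((z 0).2 - (z 1).2 - p) * ρ (z 0).2) (Measure.pi fun _ => l.1) := fun p => by
    have h1 : Measurable fun z : Fin (m + 2) → X × E d => (z 0).2 :=
      measurable_snd.comp (measurable_pi_apply 0)
    have h2 : Measurable fun z : Fin (m + 2) → X × E d => (z 1).2 :=
      measurable_snd.comp (measurable_pi_apply 1)
    refine Integrable.of_bound (C := 1 * ‖ρ‖) (((bump d).continuous.measurable.comp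
      ((h1.sub h2).sub_const p)).mul (ρ.continuous.measurable.comp h1)).aestronglyMeasurable
      (ae_of_all _ fun v => ?_)
    rw [norm_mul]
    exact mul_le_mul (abs_bump_le _) (ρ.norm_coe_le_norm _) (norm_nonneg _) zero_le_one
  calc |l.integral f (weightFirst ρ W)|
      ≤ ∫ z : Fin (m + 2) → X × E d, C * ∑ p ∈ t, bump d ((z 0).2 - (z 1).2 - p) * ρ (z 0).2
        ∂(Measure.pi fun _ => l.1) := by
        rw [← Real.norm_eq_abs]
        unfold SubProb.integral
        refine norm_integral_le_of_norm_le ((integrable_finsetSum _ fun p _ => hint p).const_mul C)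
          (ae_of_all _ fun z => ?_)
        rw [norm_mul, Real.norm_eq_abs, Finset.abs_prod, weightFirst_apply, norm_mul,
          Real.norm_of_nonneg (hρ0 _), Real.norm_eq_abs, ← Finset.sum_mul]
        have h1 : ∏ i, |f (z i).1| ≤ 1 :=
          Finset.prod_le_one (fun _ _ => abs_nonneg _) fun _ _ => hf _
        have h2 : |W fun i => (z i).2| ≤ C * ∑ p ∈ t, bump d ((z 0).2 - (z 1).2 - p) := by
          by_cases h : R < ‖(z 0).2 - (z 1).2‖
          · rw [hW (fun i => (z i).2) h, abs_zero]
            exact mul_nonneg hC0 (Finset.sum_nonneg fun _ _ => bump_nonneg _)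
          · exact (hC _).trans (le_mul_of_one_le_right hC0 (ht _ (not_lt.1 h)))
        calc (∏ i, |f (z i).1|) * (ρ (z 0).2 * |W fun i => (z i).2|)
            ≤ 1 * (ρ (z 0).2 * (C * ∑ p ∈ t, bump d ((z 0).2 - (z 1).2 - p))) :=
              mul_le_mul h1 (mul_le_mul_of_nonneg_left h2 (hρ0 _))
                (mul_nonneg (hρ0 _) (abs_nonneg _)) zero_le_one
          _ = _ := by ring
    _ = C * ∑ p ∈ t, ∫ z : Fin (m + 2) → X × E d, bump d ((z 0).2 - (z 1).2 - p) * ρ (z 0).2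
        ∂(Measure.pi fun _ => l.1) := by
        rw [integral_const_mul, integral_finsetSum _ fun p _ => hint p]
    _ ≤ C * ∑ p ∈ t, δ * l.mass :=
        mul_le_mul_of_nonneg_left
          (Finset.sum_le_sum fun p _ => integral_pair_le l hρ0 hδ m p) hC0
    _ = _ := by rw [Finset.sum_const, nsmul_eq_mul]

/-- Splitting a kernel along a sequence of functions of the first point. -/
lemma abs_integral_sub_split_le {f : X →ᵇ ℝ} (hf : ∀ x, |f x| ≤ 1) {R : ℝ} {t : Finset (E d)}
    (ht : ∀ y : E d, ‖y‖ ≤ R → 1 ≤ ∑ p ∈ t, bump d (y - p)) {m : ℕ}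
    {W : (Fin (m + 2) → E d) →ᵇ ℝ} {C : ℝ} (hC : ∀ y, |W y| ≤ C)
    (hW : ∀ y, R < ‖y 0 - y 1‖ → W y = 0) (l : SubProb X d) {b : ℕ → E d →ᵇ ℝ}
    (hb1 : ∀ i y, b i y ≤ 1) {I : ℕ} {δ : ℝ}
    (hδ : ∀ p, ∫ z, bump d (z.2 - p) * (∏ i ∈ Finset.range I, (1 - b i)) z.2 ∂l.1 ≤ δ) :
    |l.integral f W - ∑ i ∈ Finset.range I,
        l.integral f (weightFirst (b i * ∏ i' ∈ Finset.range i, (1 - b i')) W)|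
      ≤ C * (t.card * (δ * l.mass)) := by
  -- Telescoping: the factor of the `i`-th piece is the drop of the residual product at step `i`.
  have hsum : ∀ I, ∑ i ∈ Finset.range I, weightFirst (b i * ∏ i' ∈ Finset.range i, (1 - b i')) W
      = W - weightFirst (∏ i ∈ Finset.range I, (1 - b i)) W := by
    intro I
    induction I with
    | zero => ext y; simp
    | succ I ih =>
      rw [Finset.sum_range_succ, ih, Finset.prod_range_succ]
      ext y
      simp
      ring
  rw [← SubProb.integral_sum, hsum, SubProb.integral_sub, sub_sub_cancel]
  refine abs_integral_weightFirst_le hf ht hC hW l (fun y => ?_) hδ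
  rw [BoundedContinuousFunction.coe_prod, Finset.prod_apply]
  exact Finset.prod_nonneg fun i _ => sub_nonneg.2 (hb1 i y)

end Split

/-! ### Classes of centres at bounded distance -/

section Clusters

variable {d : ℕ}

/-- The bump centred at `a`. -/
def bumpAt (a : E d) : E d →ᵇ ℝ := (bump d).compContinuous ⟨fun y => y - a, by fun_prop⟩

@[simp] lemma bumpAt_apply (a y : E d) : bumpAt a y = bump d (y - a) := rfl

lemma bumpAt_eq_zero {a y : E d} (h : ‖a‖ + 2 ≤ ‖y‖) : bumpAt a y = 0 :=
  bump_eq_zero (y := y - a) (by linarith [norm_sub_norm_le y a])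

lemma abs_bump_sub_le (y z : E d) : |bump d y - bump d z| ≤ ‖y - z‖ := by
  simp only [bump_apply]
  have h1 := abs_max_sub_max_le_max 0 (min 1 (2 - ‖y‖)) 0 (min 1 (2 - ‖z‖))
  have h2 := abs_min_sub_min_le_max 1 (2 - ‖y‖) 1 (2 - ‖z‖)
  rw [sub_self, abs_zero, max_eq_right (abs_nonneg (min 1 (2 - ‖y‖) - min 1 (2 - ‖z‖)))] at h1
  rw [sub_self, abs_zero, sub_sub_sub_cancel_left, max_eq_right (abs_nonneg (‖z‖ - ‖y‖))] at h2
  exact (h1.trans h2).trans ((abs_norm_sub_norm_le z y).trans (norm_sub_rev z y).le)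

lemma continuous_bumpAt : Continuous (bumpAt : E d → E d →ᵇ ℝ) := by
  refine LipschitzWith.continuous (K := 1) (LipschitzWith.of_dist_le_mul fun a c => ?_)
  rw [NNReal.coe_one, one_mul, BoundedContinuousFunction.dist_le dist_nonneg]
  intro y
  rw [Real.dist_eq]
  refine (abs_bump_sub_le (y - a) (y - c)).trans (le_of_eq ?_)
  rw [sub_sub_sub_cancel_left, dist_eq_norm, norm_sub_rev]

variable (𝒰 : Ultrafilter ℕ) (j : ℕ → ℕ → ℕ) (a : ℕ → ℕ → E d)

/-- The `i`-th bump of the `n`-th collection, seen from the centre of the `c`-th one. -/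
def frame (n c i : ℕ) : E d →ᵇ ℝ := if j n i = j n c then bumpAt (a n i - a n c) else 0

/-- The `c`-th and the `i`-th centre stay at bounded distance in the same measure. -/
def Linked (c i : ℕ) : Prop := ∃ R : ℝ, ∀ᶠ n in 𝒰, j n i = j n c ∧ ‖a n i - a n c‖ ≤ R

variable {𝒰 j a}

lemma Linked.refl (c : ℕ) : Linked 𝒰 j a c c := ⟨0, Eventually.of_forall fun n => by simp⟩

lemma Linked.symm {c i : ℕ} (h : Linked 𝒰 j a c i) : Linked 𝒰 j a i c := by
  obtain ⟨R, hR⟩ := h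
  exact ⟨R, hR.mono fun n hn => ⟨hn.1.symm, by rw [norm_sub_rev]; exact hn.2⟩⟩

lemma Linked.trans {c i k : ℕ} (h : Linked 𝒰 j a c i) (h' : Linked 𝒰 j a i k) :
    Linked 𝒰 j a c k := by
  obtain ⟨R, hR⟩ := h
  obtain ⟨R', hR'⟩ := h'
  refine ⟨R' + R, ?_⟩
  filter_upwards [hR, hR'] with n hn hn'
  refine ⟨hn'.1.trans hn.1, ?_⟩
  rw [← sub_add_sub_cancel (a n k) (a n i) (a n c)]
  exact (norm_add_le _ _).trans (add_le_add hn'.2 hn.2)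

lemma Linked.exists_offset {c i : ℕ} (h : Linked 𝒰 j a c i) :
    ∃ v, Tendsto (fun n => a n i - a n c) 𝒰 (𝓝 v) := by
  obtain ⟨R, hR⟩ := h
  obtain ⟨v, -, hv⟩ := (isCompact_closedBall (0 : E d) R).ultrafilter_le_nhds'
    (𝒰.map fun n => a n i - a n c)
    (hR.mono fun n hn => mem_closedBall_zero_iff.2 hn.2)
  exact ⟨v, hv⟩

lemma eventually_not_of_not_linked {c i : ℕ} (h : ¬ Linked 𝒰 j a c i) (R : ℝ) :
    ∀ᶠ n in 𝒰, j n i = j n c → R < ‖a n i - a n c‖ := by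
  have h1 : ¬ ∀ᶠ n in 𝒰, j n i = j n c ∧ ‖a n i - a n c‖ ≤ R := fun h2 => h ⟨R, h2⟩
  filter_upwards [Ultrafilter.eventually_not.2 h1] with n hn hj
  exact not_le.1 fun h3 => hn ⟨hj, h3⟩

open Classical in
variable (𝒰 j a) in
/-- The limit of `frame`. -/
def limitFrame (c i : ℕ) : E d →ᵇ ℝ :=
  if h : Linked 𝒰 j a c i then bumpAt h.exists_offset.choose else 0

lemma limitFrame_of_not {c i : ℕ} (h : ¬ Linked 𝒰 j a c i) : limitFrame 𝒰 j a c i = 0 :=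
  dif_neg h

lemma limitFrame_le_one (c i : ℕ) (y : E d) : limitFrame 𝒰 j a c i y ≤ 1 := by
  unfold limitFrame
  split_ifs
  · exact bump_le_one _
  · exact zero_le_one

lemma Linked.tendsto_frame {c i : ℕ} (h : Linked 𝒰 j a c i) :
    Tendsto (fun n => frame j a n c i) 𝒰 (𝓝 (limitFrame 𝒰 j a c i)) := by
  have h1 : limitFrame 𝒰 j a c i = bumpAt h.exists_offset.choose := dif_pos h
  rw [h1]
  refine ((continuous_bumpAt.tendsto _).comp h.exists_offset.choose_spec).congr' ?_
  obtain ⟨R, hR⟩ := h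
  filter_upwards [hR] with n hn
  exact (if_pos hn.1).symm

lemma Linked.frame_support {c i : ℕ} (h : Linked 𝒰 j a c i) :
    ∃ R, ∀ᶠ n in 𝒰, ∀ y, R ≤ ‖y‖ → frame j a n c i y = 0 := by
  obtain ⟨R, hR⟩ := h
  refine ⟨R + 2, hR.mono fun n hn y hy => ?_⟩
  rw [frame, if_pos hn.1]
  exact bumpAt_eq_zero (by linarith [hn.2])

lemma limitFrame_support (c i : ℕ) :
    ∃ R, ∀ y, R ≤ ‖y‖ → limitFrame 𝒰 j a c i y = 0 := by
  unfold limitFrame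
  split_ifs with h
  · exact ⟨_, fun y hy => bumpAt_eq_zero hy⟩
  · exact ⟨0, fun _ _ => rfl⟩

/-- An unlinked bump belongs to another measure or leaves every ball, so it eventually misses the
support of `D`. -/
lemma eventually_frame_mul_eq_zero {c i : ℕ} (h : ¬ Linked 𝒰 j a c i) {D : ℕ → E d →ᵇ ℝ} {R : ℝ}
    (hD : ∀ᶠ n in 𝒰, ∀ y, R ≤ ‖y‖ → D n y = 0) : ∀ᶠ n in 𝒰, D n * frame j a n c i = 0 := by
  filter_upwards [hD, eventually_not_of_not_linked h (R + 2)] with n hn hn'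
  ext y
  change D n y * frame j a n c i y = 0
  by_cases hy : R ≤ ‖y‖
  · rw [hn y hy, zero_mul]
  · rw [frame]
    split_ifs with hj
    · have h1 := hn' hj
      have h2 := norm_sub_norm_le (a n i - a n c) y
      rw [norm_sub_rev (a n i - a n c) y] at h2
      rw [bumpAt_apply, bump_eq_zero (by linarith [not_le.1 hy]), mul_zero]
    · simp

/-- Escaping bumps need not converge in norm by themselves; the factor `D` of bounded support
removes them. -/
lemma tendsto_mul_prod_frame (c : ℕ) {D : ℕ → E d →ᵇ ℝ} {D' : E d →ᵇ ℝ} {R : ℝ}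
    (hD : ∀ᶠ n in 𝒰, ∀ y, R ≤ ‖y‖ → D n y = 0) (hD' : Tendsto D 𝒰 (𝓝 D')) (I : ℕ) :
    Tendsto (fun n => D n * ∏ i ∈ Finset.range I, (1 - frame j a n c i)) 𝒰
      (𝓝 (D' * ∏ i ∈ Finset.range I, (1 - limitFrame 𝒰 j a c i))) := by
  induction I with
  | zero => simpa using hD'
  | succ I ih =>
    simp only [Finset.prod_range_succ, ← mul_assoc]
    by_cases h : Linked 𝒰 j a c I
    · exact ih.mul (tendsto_const_nhds.sub h.tendsto_frame)
    · rw [limitFrame_of_not h, sub_zero, mul_one]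
      refine ih.congr' ?_
      filter_upwards [eventually_frame_mul_eq_zero h hD] with n hn
      rw [mul_sub, mul_one, mul_right_comm, hn, zero_mul, sub_zero]

open Classical in
variable (𝒰 j a) in
/-- The smallest index linked to `i`. -/
def leader (i : ℕ) : ℕ := Nat.find (⟨i, Linked.refl i⟩ : ∃ c, Linked 𝒰 j a c i)

lemma linked_leader (i : ℕ) : Linked 𝒰 j a (leader 𝒰 j a i) i := by
  classical
  exact Nat.find_spec (⟨i, Linked.refl i⟩ : ∃ c, Linked 𝒰 j a c i)

lemma leader_eq {c i : ℕ} (h : Linked 𝒰 j a c i) : leader 𝒰 j a c = leader 𝒰 j a i := by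
  classical
  refine le_antisymm ?_ ?_
  · exact Nat.find_min' _ ((linked_leader i).trans h.symm)
  · exact Nat.find_min' _ ((linked_leader c).trans h)

lemma leader_leader (i : ℕ) : leader 𝒰 j a (leader 𝒰 j a i) = leader 𝒰 j a i :=
  leader_eq (linked_leader i)

end Clusters

/-! ### Choice of centres and convergence with varying kernels -/

section Families

variable {X : Type*} [TopologicalSpace X] [MeasurableSpace X] [OpensMeasurableSpace X] {d : ℕ}

/-- The disjoint union of a sequence of measures. -/
def disjointUnion (l : ℕ → SubProb X d) : Measure (ℕ × (X × E d)) :=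
  Measure.sum fun c => (l c).1.map (Prod.mk c)

lemma disjointUnion_apply (l : ℕ → SubProb X d) {A : Set (ℕ × (X × E d))} (hA : MeasurableSet A) :
    disjointUnion l A = ∑' c, (l c).1 (Prod.mk c ⁻¹' A) := by
  unfold disjointUnion
  rw [Measure.sum_apply _ hA]
  exact tsum_congr fun c => Measure.map_apply measurable_prodMk_left hA

/-- A choice of centres `(j i, a i)` that exhausts all sufficiently concentrated mass. -/
lemma exists_centres (l : ℕ → SubProb X d) (hl : ∑' c, (l c).1 Set.univ ≤ 1) :
    ∃ (j : ℕ → ℕ) (a : ℕ → E d), ∀ (I c : ℕ) (p : E d),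
      (I : ℝ) * ∫ z, bump d (z.2 - p) *
        (∏ i ∈ Finset.range I, (1 - if j i = c then bumpAt (a i) else 0)) z.2 ∂(l c).1 ≤ 2 := by
  have hM : disjointUnion l Set.univ ≤ 1 := by
    rw [disjointUnion_apply l MeasurableSet.univ]
    exact hl
  have : IsFiniteMeasure (disjointUnion l) := ⟨hM.trans_lt ENNReal.one_lt_top⟩
  -- On the disjoint union a single greedy procedure selects the measure and the position together.
  let φ : ℕ × E d → ℕ × (X × E d) → ℝ := fun q ω => if q.1 = ω.1 then bump d (ω.2.2 - q.2) else 0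
  have hφ : ∀ q, Measurable (φ q) := fun q => by
    refine measurable_from_prod_countable_right fun c => ?_
    by_cases h : q.1 = c
    · simp only [φ, h, if_true]
      exact (bump d).continuous.measurable.comp (measurable_snd.sub_const q.2)
    · simp only [φ, h, if_false]
      exact measurable_const
  have h0 : ∀ q ω, 0 ≤ φ q ω := fun q ω => by
    simp only [φ]; split_ifs; exacts [bump_nonneg _, le_rfl]
  have h1 : ∀ q ω, φ q ω ≤ 1 := fun q ω => by
    simp only [φ]; split_ifs; exacts [bump_le_one _, zero_le_one]
  obtain ⟨p, hp⟩ := exists_greedy _ hM hφ h0 h1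
  refine ⟨fun i => (p i).1, fun i => (p i).2, fun I c q => ?_⟩
  refine le_trans (le_of_eq ?_) (hp I (c, q))
  congr 1
  have hint : Integrable (fun ω => φ (c, q) ω * residual φ p I ω) (disjointUnion l) := by
    refine Integrable.of_bound (C := 1) ((hφ _).mul (Finset.measurable_prod _ fun i _ =>
      measurable_const.sub (hφ _))).aestronglyMeasurable (ae_of_all _ fun ω => ?_)
    have h2 : 0 ≤ residual φ p I ω := Finset.prod_nonneg fun i _ => sub_nonneg.2 (h1 _ _)
    rw [Real.norm_of_nonneg (mul_nonneg (h0 _ _) h2)]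
    exact mul_le_one₀ (h1 _ _) h2 (Finset.prod_le_one (fun i _ => sub_nonneg.2 (h1 _ _))
      fun i _ => by linarith [h0 (p i) ω])
  have h2 := hasSum_integral_measure hint
  have h3 : ∀ c', ∫ ω, φ (c, q) ω * residual φ p I ω ∂((l c').1.map (Prod.mk c'))
      = ∫ z, φ (c, q) (c', z) * residual φ p I (c', z) ∂(l c').1 := fun c' =>
    integral_map measurable_prodMk_left.aemeasurable ((hφ _).mul (Finset.measurable_prod _
      fun i _ => measurable_const.sub (hφ _))).aestronglyMeasurable
  simp only [h3] at h2
  have h4 := h2.unique (hasSum_single c fun c' hc' => by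
    simp [φ, Ne.symm hc'])
  refine Eq.trans ?_ h4.symm
  refine integral_congr_ae (ae_of_all _ fun z => ?_)
  simp only [φ, if_true, residual, BoundedContinuousFunction.coe_prod, Finset.prod_apply]
  congr 1
  refine Finset.prod_congr rfl fun i _ => ?_
  split_ifs <;> simp

/-- The kernel translated by `a` in all variables. -/
def shiftKernel {k : ℕ} (a : E d) (W : (Fin k → E d) →ᵇ ℝ) : (Fin k → E d) →ᵇ ℝ :=
  W.compContinuous ⟨fun y i => y i + a, by fun_prop⟩

@[simp] lemma shiftKernel_apply {k : ℕ} (a : E d) (W : (Fin k → E d) →ᵇ ℝ) (y : Fin k → E d) :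
    shiftKernel a W y = W fun i => y i + a := rfl

lemma SubProb.integral_translate_eq (f : X →ᵇ ℝ) {k : ℕ} (W : (Fin k → E d) →ᵇ ℝ)
    (l : SubProb X d) (a : E d) :
    (l.translate a).integral f W = l.integral f (shiftKernel a W) := by
  have hpi : (Measure.pi fun _ : Fin k => (l.translate a).1)
      = (Measure.pi fun _ : Fin k => l.1).map
          (MeasurableEquiv.piCongrRight fun _ : Fin k => shift (X := X) a) := by
    have h := Measure.pi_map_pi (μ := fun _ : Fin k => l.1)
      (f := fun _ : Fin k => (shift (X := X) a : X × E d → X × E d))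
      (hμ := fun _ => inferInstanceAs (SigmaFinite (l.translate a).1))
      (fun _ => (shift (X := X) a).measurable.aemeasurable)
    exact h.symm
  unfold SubProb.integral
  rw [hpi, integral_map_equiv]
  rfl

lemma SubProb.integral_fin_one (f : X →ᵇ ℝ) (ρ : E d →ᵇ ℝ) (l : SubProb X d) :
    l.integral f (weightFirst ρ (1 : (Fin 1 → E d) →ᵇ ℝ)) = ∫ z, f z.1 * ρ z.2 ∂l.1 := by
  have h := (measurePreserving_funUnique l.1 (Fin 1)).integral_comp'
    (g := fun z => f z.1 * ρ z.2)
  rw [← h]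
  unfold SubProb.integral
  congr 1
  funext z
  simp

/-- The kernels converge uniformly and all masses are at most `1`, so `Ψ n` may be replaced by its
limit. -/
lemma SubProb.tendsto_integral_of_vague {𝒰 : Ultrafilter ℕ} {l : ℕ → SubProb X d} {m : SubProb X d}
    {f : X →ᵇ ℝ} (hf : ∀ x, |f x| ≤ 1) {k : ℕ} (hk : 0 < k) {Ψ : ℕ → (Fin k → E d) →ᵇ ℝ}
    {Ψ' : (Fin k → E d) →ᵇ ℝ} (hΨ : Tendsto Ψ 𝒰 (𝓝 Ψ'))
    (h : Tendsto (fun n => (l n).integral f Ψ') 𝒰 (𝓝 (m.integral f Ψ'))) :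
    Tendsto (fun n => (l n).integral f (Ψ n)) 𝒰 (𝓝 (m.integral f Ψ')) := by
  have h1 : Tendsto (fun n => ‖Ψ n - Ψ'‖) 𝒰 (𝓝 0) := tendsto_iff_norm_sub_tendsto_zero.1 hΨ
  have h2 : Tendsto (fun n => (l n).integral f (Ψ n - Ψ')) 𝒰 (𝓝 0) := by
    refine squeeze_zero_norm (fun n => ?_) h1
    refine ((l n).abs_integral_le hf hk (abs_le_norm_apply _)).trans ?_
    exact mul_le_of_le_one_right (norm_nonneg _) (l n).mass_le_one
  have h3 := h2.add h
  rw [zero_add] at h3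
  refine h3.congr fun n => ?_
  rw [SubProb.integral_sub, sub_add_cancel]

lemma norm_weightFirst_le {m : ℕ} (ρ : E d →ᵇ ℝ) (W : (Fin (m + 1) → E d) →ᵇ ℝ) :
    ‖weightFirst ρ W‖ ≤ ‖ρ‖ * ‖W‖ := by
  rw [BoundedContinuousFunction.norm_le (by positivity)]
  intro y
  rw [weightFirst_apply, norm_mul]
  exact mul_le_mul (ρ.norm_coe_le_norm _) (W.norm_coe_le_norm _) (norm_nonneg _) (norm_nonneg _)

lemma tendsto_weightFirst {ι : Type*} {F : Filter ι} {m : ℕ} {ρ : ι → E d →ᵇ ℝ} {ρ' : E d →ᵇ ℝ}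
    (h : Tendsto ρ F (𝓝 ρ')) (W : (Fin (m + 1) → E d) →ᵇ ℝ) :
    Tendsto (fun n => weightFirst (ρ n) W) F (𝓝 (weightFirst ρ' W)) := by
  rw [tendsto_iff_norm_sub_tendsto_zero] at h ⊢
  have h1 := h.mul_const ‖W‖
  rw [zero_mul] at h1
  refine squeeze_zero (fun _ => norm_nonneg _) (fun n => ?_) h1
  have h2 : weightFirst (ρ n) W - weightFirst ρ' W = weightFirst (ρ n - ρ') W := by
    ext y
    simp [sub_mul]
  rw [h2]
  exact norm_weightFirst_le _ _

end Families

/-! ### Comparing measures through continuous functions -/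

section Comparison

variable {X : Type*} [PseudoMetricSpace X] [MeasurableSpace X] [BorelSpace X]

/-- The thickened indicator of a set as a real function. -/
def softIndicator {δ : ℝ} (hδ : 0 < δ) (F : Set X) : X →ᵇ ℝ :=
  BoundedContinuousFunction.ofNormedAddCommGroup (fun x => (thickenedIndicator hδ F x : ℝ))
    (by fun_prop) 1 (fun x => by simpa using thickenedIndicator_le_one hδ F x)

lemma softIndicator_apply {δ : ℝ} (hδ : 0 < δ) (F : Set X) (x : X) :
    softIndicator hδ F x = (thickenedIndicator hδ F x : ℝ) := rfl

lemma softIndicator_nonneg {δ : ℝ} (hδ : 0 < δ) (F : Set X) (x : X) : 0 ≤ softIndicator hδ F x :=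
  NNReal.coe_nonneg _

lemma softIndicator_le_one {δ : ℝ} (hδ : 0 < δ) (F : Set X) (x : X) : softIndicator hδ F x ≤ 1 := by
  rw [softIndicator_apply]
  exact_mod_cast thickenedIndicator_le_one hδ F x

/-- Thickened indicators treat closed sets; inner regularity does the rest. -/
lemma measure_le_of_integral_le {μ ν : Measure X} [IsFiniteMeasure μ] [IsFiniteMeasure ν]
    (h : ∀ g : X →ᵇ ℝ, (∀ x, 0 ≤ g x) → ∫ x, g x ∂μ ≤ ∫ x, g x ∂ν) {A : Set X}
    (hA : MeasurableSet A) : μ A ≤ ν A := by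
  have hclosed : ∀ F : Set X, IsClosed F → μ F ≤ ν F := by
    intro F hF
    have hpos : ∀ n : ℕ, (0 : ℝ) < 1 / ((n : ℝ) + 1) := fun n => by positivity
    have h1 := tendsto_integral_thickenedIndicator_of_isClosed μ hF hpos
      tendsto_one_div_add_atTop_nhds_zero_nat
    have h2 := tendsto_integral_thickenedIndicator_of_isClosed ν hF hpos
      tendsto_one_div_add_atTop_nhds_zero_nat
    have h3 := le_of_tendsto_of_tendsto' h1 h2 fun n =>
      h (softIndicator (hpos n) F) (softIndicator_nonneg _ _)
    exact (ENNReal.toReal_le_toReal (measure_ne_top _ _) (measure_ne_top _ _)).1 h3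
  refine ENNReal.le_of_forall_pos_le_add fun ε hε _ => ?_
  obtain ⟨K, hKA, hK, hlt⟩ := hA.exists_isClosed_lt_add (measure_ne_top μ A)
    (ENNReal.coe_ne_zero.2 hε.ne')
  exact hlt.le.trans (add_le_add ((hclosed K hK).trans (measure_mono hKA)) le_rfl)

end Comparison

/-! ### Pieces of a sum of integrals, and reduction to finite range -/

section Decomposition

variable {X : Type*} [TopologicalSpace X] [MeasurableSpace X] [OpensMeasurableSpace X] {d : ℕ}

/-- If each piece lives on a single measure, the sum over all measures is a sum over the pieces,
up to the residual. -/
lemma abs_tsum_sub_pieces_le {f : X →ᵇ ℝ} (hf : ∀ x, |f x| ≤ 1) {R : ℝ} {t : Finset (E d)}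
    (ht : ∀ y : E d, ‖y‖ ≤ R → 1 ≤ ∑ p ∈ t, bump d (y - p)) {m : ℕ}
    {W : (Fin (m + 2) → E d) →ᵇ ℝ} {C : ℝ} (hC : ∀ y, |W y| ≤ C)
    (hW : ∀ y, R < ‖y 0 - y 1‖ → W y = 0) {l : ℕ → SubProb X d}
    (hl : ∑' c, (l c).1 Set.univ ≤ 1) {b : ℕ → ℕ → E d →ᵇ ℝ} (hb1 : ∀ c i y, b c i y ≤ 1)
    {owner : ℕ → ℕ} (ho : ∀ c i, c ≠ owner i → l c = 0 ∨ b c i = 0) {I : ℕ} {δ : ℝ}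
    (hδ : ∀ c p, ∫ z, bump d (z.2 - p) * (∏ i ∈ Finset.range I, (1 - b c i)) z.2 ∂(l c).1 ≤ δ) :
    |∑' c, (l c).integral f W - ∑ i ∈ Finset.range I, (l (owner i)).integral f
        (weightFirst (b (owner i) i * ∏ i' ∈ Finset.range i, (1 - b (owner i) i')) W)|
      ≤ C * (t.card * δ) := by
  have hC0 : 0 ≤ C := (abs_nonneg _).trans (hC 0)
  have h1 : HasSum (fun c => ∑ i ∈ Finset.range I, (l c).integral f
      (weightFirst (b c i * ∏ i' ∈ Finset.range i, (1 - b c i')) W))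
      (∑ i ∈ Finset.range I, (l (owner i)).integral f
        (weightFirst (b (owner i) i * ∏ i' ∈ Finset.range i, (1 - b (owner i) i')) W)) := by
    refine hasSum_sum fun i _ => hasSum_single (owner i) fun c hc => ?_
    rcases ho c i hc with h | h
    · rw [h]
      have h2 := (0 : SubProb X d).abs_integral_le hf (Nat.succ_pos (m + 1))
        (abs_le_norm_apply (weightFirst (b c i * ∏ i' ∈ Finset.range i, (1 - b c i')) W))
      have h3 : (0 : SubProb X d).mass = 0 := by simp [SubProb.mass]
      rw [h3, mul_zero] at h2
      exact abs_eq_zero.1 (le_antisymm h2 (abs_nonneg _))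
    · have h2 : weightFirst (b c i * ∏ i' ∈ Finset.range i, (1 - b c i')) W = 0 := by
        rw [h, zero_mul]
        ext y
        simp
      rw [h2, SubProb.integral_zero]
  rw [← h1.tsum_eq, ← (summable_integral hl hf (Nat.succ_pos (m + 1)) W).tsum_sub h1.summable]
  have h2 := tsum_of_norm_bounded (((summable_mass hl).1.mul_left (C * (t.card * δ))).hasSum)
    (f := fun c => (l c).integral f W - ∑ i ∈ Finset.range I, (l c).integral f
      (weightFirst (b c i * ∏ i' ∈ Finset.range i, (1 - b c i')) W)) (fun c => by
      refine (abs_integral_sub_split_le hf ht hC hW (l c) (hb1 c) (hδ c)).trans (le_of_eq ?_)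
      ring)
  have hδ0 : 0 ≤ δ := le_trans (integral_nonneg fun z => mul_nonneg (bump_nonneg _) (by
    rw [BoundedContinuousFunction.coe_prod, Finset.prod_apply]
    exact Finset.prod_nonneg fun i _ => sub_nonneg.2 (hb1 0 i _))) (hδ 0 0)
  rw [tsum_mul_left] at h2
  exact h2.trans (mul_le_of_le_one_right (by positivity) (summable_mass hl).2)

lemma tendsto_of_uniform_approx {ι : Type*} {F : Filter ι} {S : ι → ℝ} {S' : ℝ}
    {A : ℕ → ι → ℝ} {A' e : ℕ → ℝ} (h : ∀ I n, |S n - A I n| ≤ e I)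
    (h' : ∀ I, |S' - A' I| ≤ e I) (he : Tendsto e atTop (𝓝 0))
    (hA : ∀ I, Tendsto (A I) F (𝓝 (A' I))) : Tendsto S F (𝓝 S') := by
  rw [Metric.tendsto_nhds]
  intro ε hε
  obtain ⟨I, hI⟩ := (he.eventually_lt_const (show 0 < ε / 3 by positivity)).exists
  filter_upwards [Metric.tendsto_nhds.1 (hA I) (ε / 3) (by positivity)] with n hn
  rw [Real.dist_eq] at hn ⊢
  have h1 := h I n
  have h2 := h' I
  rw [abs_lt] at hn ⊢
  rw [abs_le] at h1 h2
  constructor <;> linarith [hn.1, hn.2, h1.1, h1.2, h2.1, h2.2]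

/-- The kernel obtained by pulling all values towards zero by `ε`. -/
def softThreshold {Y : Type*} [TopologicalSpace Y] (ε : ℝ) (W : Y →ᵇ ℝ) : Y →ᵇ ℝ :=
  BoundedContinuousFunction.ofNormedAddCommGroup (fun y => W y - max (-ε) (min ε (W y)))
    (by fun_prop) (‖W‖ + |ε|) (fun y => by
      refine (norm_sub_le _ _).trans (add_le_add (W.norm_coe_le_norm y) ?_)
      rw [Real.norm_eq_abs, abs_le]
      constructor
      · exact (neg_le_neg (le_abs_self ε)).trans (le_max_left _ _)
      · exact max_le (neg_le_abs ε) ((min_le_left _ _).trans (le_abs_self ε)))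

lemma softThreshold_apply {Y : Type*} [TopologicalSpace Y] (ε : ℝ) (W : Y →ᵇ ℝ) (y : Y) :
    softThreshold ε W y = W y - max (-ε) (min ε (W y)) := rfl

lemma softThreshold_eq_zero {Y : Type*} [TopologicalSpace Y] {ε : ℝ} {W : Y →ᵇ ℝ} {y : Y}
    (h : |W y| ≤ ε) : softThreshold ε W y = 0 := by
  rw [abs_le] at h
  rw [softThreshold_apply, min_eq_right h.2, max_eq_right h.1, sub_self]

lemma abs_sub_softThreshold_le {Y : Type*} [TopologicalSpace Y] {ε : ℝ} (hε : 0 ≤ ε) (W : Y →ᵇ ℝ)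
    (y : Y) : |W y - softThreshold ε W y| ≤ ε := by
  rw [softThreshold_apply, sub_sub_cancel, abs_le]
  exact ⟨le_max_left _ _, max_le (by linarith) (min_le_left _ _)⟩

/-- A kernel in `ℭ_k` is below `ε` once two points are far apart, and such values are cut to zero:
finite range costs only a uniform error `ε`. -/
lemma exists_range_softThreshold {k : ℕ} {W : (Fin k → E d) →ᵇ ℝ} (hW : W ∈ transInv d k) {ε : ℝ}
    (hε : 0 < ε) : ∃ R, 0 ≤ R ∧ ∀ y : Fin k → E d, (∃ i j, R ≤ ‖y i - y j‖) →
      softThreshold ε W y = 0 := by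
  obtain ⟨R, hR⟩ := hW.2 ε hε
  exact ⟨max R 0, le_max_right _ _, fun y ⟨i, j, h⟩ =>
    softThreshold_eq_zero (hR y ⟨i, j, (le_max_left _ _).trans h⟩)⟩

lemma softThreshold_shift {k : ℕ} {W : (Fin k → E d) →ᵇ ℝ} (hW : W ∈ transInv d k) (ε : ℝ)
    (a : E d) (y : Fin k → E d) :
    softThreshold ε W (fun i => y i + a) = softThreshold ε W y := by
  rw [softThreshold_apply, softThreshold_apply, hW.1]

end Decomposition

/-! ### Convergence of the functionals to those of the limit family -/

section Limit

variable {X : Type*} [MetricSpace X] [SecondCountableTopology X] [CompleteSpace X]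
  [MeasurableSpace X] [BorelSpace X] {d : ℕ}

/-- No unit ball carries much of what is left after removing the bumps at the centres. -/
def Exhausts (l : ℕ → SubProb X d) (j : ℕ → ℕ) (a : ℕ → E d) : Prop :=
  ∀ (I c : ℕ) (p : E d), (I : ℝ) * ∫ z, bump d (z.2 - p) *
    (∏ i ∈ Finset.range I, (1 - if j i = c then bumpAt (a i) else 0)) z.2 ∂(l c).1 ≤ 2

/-- Vague convergence of measures and of their powers. -/
def VagueLimit (𝒰 : Ultrafilter ℕ) (l : ℕ → SubProb X d) (m : SubProb X d) : Prop :=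
  ∀ (f : X →ᵇ ℝ) (k : ℕ) (Ψ : (Fin k → E d) →ᵇ ℝ) (R : ℝ), (∀ y i, R < ‖y i‖ → Ψ y = 0) →
    Tendsto (fun n => (l n).integral f Ψ) 𝒰 (𝓝 (m.integral f Ψ))

/-- The measure containing the `c`-th centre, recentred there. -/
def cluster (l : ℕ → ℕ → SubProb X d) (j : ℕ → ℕ → ℕ) (a : ℕ → ℕ → E d) (n c : ℕ) : SubProb X d :=
  (l n (j n c)).translate (-a n c)

lemma cluster_apply (l : ℕ → ℕ → SubProb X d) (j : ℕ → ℕ → ℕ) (a : ℕ → ℕ → E d) (n c : ℕ)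
    (A : Set (X × E d)) :
    (cluster l j a n c).1 A = (l n (j n c)).1 (shift (-a n c) ⁻¹' A) :=
  (shift (-a n c)).map_apply A

lemma frame_translate (j : ℕ → ℕ → ℕ) (a : ℕ → ℕ → E d) (n c i : ℕ) (y : E d) :
    frame j a n c i (y + -a n c) = (if j n i = j n c then bumpAt (a n i) else 0 : E d →ᵇ ℝ) y := by
  unfold frame
  split_ifs
  · simp only [bumpAt_apply]
    congr 1
    abel
  · rfl

variable {𝒰 : Ultrafilter ℕ} {j : ℕ → ℕ → ℕ} {a : ℕ → ℕ → E d} {l : ℕ → ℕ → SubProb X d}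
  {lam : ℕ → SubProb X d}

/-- The test function has bounded support, so the exhaustion bound survives the vague limit; bumps
not linked to `c` disappear from the product. -/
lemma limit_residual_le
    (hc : ∀ n, Exhausts (l n) (j n) (a n))
    (hlam : ∀ c, VagueLimit 𝒰 (fun n => cluster l j a n c) (lam c))
    (I c : ℕ) (p : E d) : (I : ℝ) * ∫ z, bump d (z.2 - p) *
      (∏ i ∈ Finset.range I, (1 - limitFrame 𝒰 j a c i)) z.2 ∂(lam c).1 ≤ 2 := by
  have hsupp : ∀ y : E d, ‖p‖ + 2 ≤ ‖y‖ → bumpAt p y = 0 := fun y hy => bumpAt_eq_zero hy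
  have h1 := tendsto_mul_prod_frame (𝒰 := 𝒰) (j := j) (a := a) c
    (D := fun _ => bumpAt p) (Eventually.of_forall fun _ => hsupp) tendsto_const_nhds I
  have h2 := SubProb.tendsto_integral_of_vague (f := (1 : X →ᵇ ℝ)) (fun x => by simp) zero_lt_one
    (tendsto_weightFirst h1 (1 : (Fin 1 → E d) →ᵇ ℝ)) (hlam c 1 1 _ (‖p‖ + 2) fun y i hy => by
      rw [Subsingleton.elim i 0] at hy
      simp [-bumpAt_apply, hsupp _ hy.le])
  simp only [SubProb.integral_fin_one] at h2
  have h3 := le_of_tendsto' (h2.const_mul (I : ℝ)) (b := 2) fun n => by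
    refine le_trans (le_of_eq ?_) (hc n I (j n c) (a n c + p))
    congr 1
    have h4 : (cluster l j a n c).1 = (l n (j n c)).1.map (shift (-a n c)) := rfl
    rw [h4, integral_map_equiv]
    refine integral_congr_ae (ae_of_all _ fun z => ?_)
    simp only [BoundedContinuousFunction.coe_one, Pi.one_apply, one_mul, shift_apply,
      BoundedContinuousFunction.mul_apply, BoundedContinuousFunction.coe_prod, Finset.prod_apply,
      bumpAt_apply, BoundedContinuousFunction.coe_sub, Pi.sub_apply, frame_translate]
    congr 2
    abel
  simpa using h3

/-- Seen from centre `c`, the bump confines the first point and the range of `W` confines the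
others, so vague convergence applies. Invariance of `W` allows the recentring. -/
lemma tendsto_piece
    (hlam : ∀ c, VagueLimit 𝒰 (fun n => cluster l j a n c) (lam c))
    {f : X →ᵇ ℝ} (hf : ∀ x, |f x| ≤ 1) {m : ℕ} {W : (Fin (m + 2) → E d) →ᵇ ℝ} {R : ℝ}
    (hW : ∀ a y, W (fun i => y i + a) = W y) (hR : ∀ y i, R < ‖y i - y 0‖ → W y = 0)
    {c i : ℕ} (h : Linked 𝒰 j a c i) :
    Tendsto (fun n => (l n (j n i)).integral f (weightFirst
      ((if j n i = j n i then bumpAt (a n i) else 0) * ∏ i' ∈ Finset.range i,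
        (1 - if j n i' = j n i then bumpAt (a n i') else 0)) W)) 𝒰
      (𝓝 ((lam c).integral f (weightFirst (limitFrame 𝒰 j a c i *
        ∏ i' ∈ Finset.range i, (1 - limitFrame 𝒰 j a c i')) W))) := by
  obtain ⟨r, hr⟩ := h.frame_support
  obtain ⟨r', hr'⟩ := limitFrame_support (𝒰 := 𝒰) (j := j) (a := a) c i
  have h1 := tendsto_mul_prod_frame (j := j) (a := a) c hr h.tendsto_frame i
  have h2 := SubProb.tendsto_integral_of_vague hf (Nat.succ_pos (m + 1))
    (tendsto_weightFirst h1 W) (hlam c f _ _ (r' + R) fun y k hy => by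
      rw [weightFirst_apply, BoundedContinuousFunction.mul_apply]
      by_cases h3 : r' ≤ ‖y 0‖
      · rw [hr' _ h3, zero_mul, zero_mul]
      · rw [hR y k, mul_zero]
        linarith [norm_sub_norm_le (y k) (y 0), not_le.1 h3])
  refine h2.congr' ?_
  obtain ⟨B, hB⟩ := h
  filter_upwards [hB] with n hn
  rw [cluster, SubProb.integral_translate_eq, hn.1]
  congr 1
  ext y
  simp only [shiftKernel_apply, weightFirst_apply, BoundedContinuousFunction.mul_apply, hW,
    BoundedContinuousFunction.coe_prod, Finset.prod_apply, BoundedContinuousFunction.coe_sub,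
    Pi.sub_apply, frame_translate, hn.1, BoundedContinuousFunction.coe_one, Pi.one_apply]

variable (𝒰 j a lam) in
open Classical in
/-- The limit collection: one measure per class of linked centres. -/
def limitFamily (c : ℕ) : SubProb X d := if leader 𝒰 j a c = c then lam c else 0

lemma limitFamily_leader (i : ℕ) :
    limitFamily 𝒰 j a lam (leader 𝒰 j a i) = lam (leader 𝒰 j a i) :=
  if_pos (leader_leader i)

lemma limitFamily_residual_le
    (h : ∀ (I c : ℕ) (p : E d), (I : ℝ) * ∫ z, bump d (z.2 - p) *
      (∏ i ∈ Finset.range I, (1 - limitFrame 𝒰 j a c i)) z.2 ∂(lam c).1 ≤ 2) (I c : ℕ) (p : E d) :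
    (I : ℝ) * ∫ z, bump d (z.2 - p) * (∏ i ∈ Finset.range I, (1 - limitFrame 𝒰 j a c i)) z.2
      ∂(limitFamily 𝒰 j a lam c).1 ≤ 2 := by
  unfold limitFamily
  split_ifs
  · exact h I c p
  · simp

/-- Up to errors of order `1 / (I + 1)`, uniform in `n`, both sides are sums of `I + 1`
corresponding pieces, which converge one by one. -/
lemma tendsto_tsum_integral_of_bounded_range
    (hl : ∀ n, ∑' c, (l n c).1 Set.univ ≤ 1)
    (hl' : ∑' c, (limitFamily 𝒰 j a lam c).1 Set.univ ≤ 1)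
    (hc : ∀ n, Exhausts (l n) (j n) (a n))
    (hlam : ∀ c, VagueLimit 𝒰 (fun n => cluster l j a n c) (lam c))
    {f : X →ᵇ ℝ} (hf : ∀ x, |f x| ≤ 1) {m : ℕ} {W : (Fin (m + 2) → E d) →ᵇ ℝ} {R : ℝ}
    (hW : ∀ a y, W (fun i => y i + a) = W y) (hR : ∀ y i i', R < ‖y i - y i'‖ → W y = 0) :
    Tendsto (fun n => ∑' c, (l n c).integral f W) 𝒰
      (𝓝 (∑' c, (limitFamily 𝒰 j a lam c).integral f W)) := by
  obtain ⟨t, ht⟩ := exists_cover d R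
  have hdiv : ∀ {x : ℝ} (I : ℕ), ((I + 1 : ℕ) : ℝ) * x ≤ 2 → x ≤ 2 / ((I : ℝ) + 1) := by
    intro x I hx
    rw [le_div_iff₀ (by positivity), mul_comm]
    exact_mod_cast hx
  refine tendsto_of_uniform_approx (e := fun I => ‖W‖ * (t.card * (2 / ((I : ℝ) + 1))))
    (fun I n => ?_) (fun I => ?_) ?_ fun I => tendsto_finsetSum (Finset.range (I + 1)) fun i _ =>
      tendsto_piece hlam hf hW (fun y i => hR y i 0) (linked_leader i)
  · refine abs_tsum_sub_pieces_le hf ht (abs_le_norm_apply W) (fun y => hR y 0 1) (hl n)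
      (b := fun c i => if j n i = c then bumpAt (a n i) else 0) (fun c i y => ?_)
      (owner := j n) (fun c i hci => Or.inr (if_neg hci.symm)) (fun c p => hdiv I (hc n (I + 1) c p))
    split_ifs
    · exact bump_le_one _
    · exact zero_le_one
  · have h := abs_tsum_sub_pieces_le hf ht (abs_le_norm_apply W) (fun y => hR y 0 1) hl'
      (b := limitFrame 𝒰 j a) limitFrame_le_one
      (owner := leader 𝒰 j a) (fun c i hci => ?_) (I := I + 1)
      (fun c p => hdiv I (limitFamily_residual_le (limit_residual_le hc hlam) (I + 1) c p))
    · simpa only [limitFamily_leader] using h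
    -- If `c` is linked to `i` without being its leader, `c` leads no class and its limit measure is
    -- zero; if it is not linked, the bump is zero.
    · by_cases hli : Linked 𝒰 j a c i
      · left
        refine if_neg fun h => hci ?_
        rw [← h]
        exact leader_eq hli
      · exact Or.inr (limitFrame_of_not hli)
  · have h := (tendsto_one_div_add_atTop_nhds_zero_nat (𝕜 := ℝ)).const_mul (‖W‖ * (t.card * 2))
    rw [mul_zero] at h
    refine h.congr fun I => ?_
    ring

lemma tendsto_tsum_integral
    (hl : ∀ n, ∑' c, (l n c).1 Set.univ ≤ 1)
    (hl' : ∑' c, (limitFamily 𝒰 j a lam c).1 Set.univ ≤ 1)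
    (hc : ∀ n, Exhausts (l n) (j n) (a n))
    (hlam : ∀ c, VagueLimit 𝒰 (fun n => cluster l j a n c) (lam c))
    {f : X →ᵇ ℝ} (hf : ∀ x, |f x| ≤ 1) {k : ℕ} (hk : 2 ≤ k) {W : (Fin k → E d) →ᵇ ℝ}
    (hW : W ∈ transInv d k) :
    Tendsto (fun n => ∑' c, (l n c).integral f W) 𝒰
      (𝓝 (∑' c, (limitFamily 𝒰 j a lam c).integral f W)) := by
  obtain ⟨m, rfl⟩ := Nat.exists_eq_add_of_le' hk
  have hpos : ∀ I : ℕ, (0 : ℝ) < 1 / ((I : ℝ) + 1) := fun I => by positivity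
  have happrox : ∀ (r : ℕ → SubProb X d), ∑' c, (r c).1 Set.univ ≤ 1 → ∀ I : ℕ,
      |∑' c, (r c).integral f W - ∑' c, (r c).integral f (softThreshold (1 / ((I : ℝ) + 1)) W)|
        ≤ 1 / ((I : ℝ) + 1) := by
    intro r hr I
    rw [← (summable_integral hr hf (Nat.succ_pos _) W).tsum_sub
      (summable_integral hr hf (Nat.succ_pos _) _)]
    simp only [← SubProb.integral_sub]
    exact abs_tsum_integral_le hr hf (Nat.succ_pos _) fun y =>
      abs_sub_softThreshold_le (hpos I).le W y
  refine tendsto_of_uniform_approx (fun I n => happrox _ (hl n) I) (happrox _ hl')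
    tendsto_one_div_add_atTop_nhds_zero_nat fun I => ?_
  obtain ⟨R, -, hR⟩ := exists_range_softThreshold hW (hpos I)
  exact tendsto_tsum_integral_of_bounded_range hl hl' hc hlam hf
    (softThreshold_shift hW _) fun y i i' h => hR y ⟨i, i', h.le⟩

end Limit

/-! ### The limit family is dominated by the limit of `β` -/

section Marginals

variable {X : Type*} [MetricSpace X] [SecondCountableTopology X] [CompleteSpace X]
  [MeasurableSpace X] [BorelSpace X] {d : ℕ}
  {𝒰 : Ultrafilter ℕ} {j : ℕ → ℕ → ℕ} {a : ℕ → ℕ → E d} {l : ℕ → ℕ → SubProb X d}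
  {lam : ℕ → SubProb X d}

/-- The marginal on `X` of the part of a measure in a ball around the origin. -/
def localMarginal (m : SubProb X d) (R : ℝ) : Measure X :=
  (m.1.restrict (Set.univ ×ˢ Metric.closedBall 0 R)).map Prod.fst

instance (m : SubProb X d) (R : ℝ) : IsFiniteMeasure (localMarginal m R) := by
  unfold localMarginal
  infer_instance

lemma localMarginal_apply (m : SubProb X d) (R : ℝ) {A : Set X} (hA : MeasurableSet A) :
    localMarginal m R A = m.1 (A ×ˢ Metric.closedBall 0 R) := by
  unfold localMarginal
  rw [Measure.map_apply measurable_fst hA, Measure.restrict_apply (measurable_fst hA)]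
  congr 1
  ext z
  simp

/-- In the disjoint union the balls around the chosen centres are disjoint: centres in one measure
are more than `2 R` apart, the others lie in different components. -/
lemma sum_localMarginal_le {b : ProbabilityMeasure X} {n : ℕ}
    (hb : ∀ A, MeasurableSet A → ∑' c, (l n c).1.map Prod.fst A ≤ (b : Measure X) A)
    {s : Finset ℕ} {R : ℝ} (hs : ∀ c ∈ s, ∀ c' ∈ s, c ≠ c' → j n c = j n c' →
      2 * R < ‖a n c - a n c'‖) :
    ∑ c ∈ s, localMarginal (cluster l j a n c) R ≤ (b : Measure X) := by
  refine Measure.le_iff.2 fun A hA => ?_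
  rw [Measure.finsetSum_apply]
  let B : ℕ → Set (ℕ × (X × E d)) := fun c => {j n c} ×ˢ (A ×ˢ Metric.closedBall (a n c) R)
  have hB : ∀ c, MeasurableSet (B c) := fun c =>
    (measurableSet_singleton _).prod (hA.prod Metric.isClosed_closedBall.measurableSet)
  have h1 : ∀ c, localMarginal (cluster l j a n c) R A = disjointUnion (l n) (B c) := by
    intro c
    rw [localMarginal_apply _ _ hA, cluster_apply, disjointUnion_apply _ (hB c),
      tsum_eq_single (j n c) fun c' hc' => ?_]
    · congr 1
      ext z
      simp [B, dist_eq_norm, sub_eq_add_neg]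
    · have : Prod.mk c' ⁻¹' B c = ∅ := by
        ext z
        simp [B, hc']
      rw [this, measure_empty]
  have hdisj : (s : Set ℕ).PairwiseDisjoint B := by
    intro c hc c' hc' hne
    refine Set.disjoint_left.2 fun ω hω hω' => ?_
    have h2 : j n c = j n c' := (Set.mem_singleton_iff.1 hω.1).symm.trans hω'.1
    have h3 := hs c hc c' hc' hne h2
    have h4 := Metric.mem_closedBall.1 hω.2.2
    have h5 := Metric.mem_closedBall.1 hω'.2.2
    rw [← dist_eq_norm] at h3
    linarith [dist_triangle_left (a n c) (a n c') ω.2.2]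
  simp only [h1]
  rw [← measure_biUnion_finset hdisj fun c _ => hB c]
  have h2 : (⋃ c ∈ s, B c) ⊆ Set.univ ×ˢ (A ×ˢ Set.univ) := by
    intro ω hω
    simp only [Set.mem_iUnion, exists_prop] at hω
    obtain ⟨c, -, hω⟩ := hω
    exact ⟨trivial, hω.2.1, trivial⟩
  refine (measure_mono h2).trans ?_
  rw [disjointUnion_apply _ (MeasurableSet.univ.prod (hA.prod MeasurableSet.univ))]
  refine le_trans (le_of_eq (tsum_congr fun c => ?_)) (hb A hA)
  rw [Measure.map_apply measurable_fst hA]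
  congr 1
  ext z
  simp

/-- A bump of width of order `N + 1`. -/
def wideBump (d N : ℕ) : E d →ᵇ ℝ :=
  (bump d).compContinuous ⟨fun y => ((N : ℝ) + 1)⁻¹ • y, by fun_prop⟩

lemma wideBump_nonneg (N : ℕ) (y : E d) : 0 ≤ wideBump d N y := bump_nonneg _

lemma wideBump_le_one (N : ℕ) (y : E d) : wideBump d N y ≤ 1 := bump_le_one _

lemma wideBump_eq_zero {N : ℕ} {y : E d} (h : 2 * ((N : ℝ) + 1) ≤ ‖y‖) : wideBump d N y = 0 := by
  have hN : (0 : ℝ) < (N : ℝ) + 1 := by positivity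
  refine bump_eq_zero (y := ((N : ℝ) + 1)⁻¹ • y) ?_
  rw [norm_smul, norm_inv, Real.norm_of_nonneg hN.le, le_inv_mul_iff₀ hN]
  linarith

lemma tendsto_wideBump (y : E d) : Tendsto (fun N => wideBump d N y) atTop (𝓝 1) := by
  refine tendsto_const_nhds.congr' ?_
  filter_upwards [eventually_ge_atTop ⌈‖y‖⌉₊] with N hN
  have hN' : (0 : ℝ) < (N : ℝ) + 1 := by positivity
  refine (bump_eq_one (y := ((N : ℝ) + 1)⁻¹ • y) ?_).symm
  rw [norm_smul, norm_inv, Real.norm_of_nonneg hN'.le, inv_mul_le_iff₀ hN', mul_one]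
  have h2 : ‖y‖ ≤ N := (Nat.le_ceil _).trans (by exact_mod_cast hN)
  linarith

lemma integrable_mul_radial (g : X →ᵇ ℝ) (ρ : E d →ᵇ ℝ) (m : Measure (X × E d)) [IsFiniteMeasure m] :
    Integrable (fun z => g z.1 * ρ z.2) m := by
  refine Integrable.of_bound (C := ‖g‖ * ‖ρ‖) ?_ (ae_of_all _ fun z => ?_)
  · exact ((g.continuous.measurable.comp measurable_fst).mul
      (ρ.continuous.measurable.comp measurable_snd)).aestronglyMeasurable
  · rw [norm_mul]
    exact mul_le_mul (g.norm_coe_le_norm _) (ρ.norm_coe_le_norm _) (norm_nonneg _) (norm_nonneg _)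

lemma integral_wideBump_le (m : SubProb X d) {g : X →ᵇ ℝ} (hg : ∀ x, 0 ≤ g x) (N : ℕ) :
    ∫ z, g z.1 * wideBump d N z.2 ∂m.1 ≤ ∫ x, g x ∂(localMarginal m (2 * ((N : ℝ) + 1))) := by
  have hset : MeasurableSet (Set.univ ×ˢ Metric.closedBall 0 (2 * ((N : ℝ) + 1)) : Set (X × E d)) :=
    MeasurableSet.univ.prod Metric.isClosed_closedBall.measurableSet
  unfold localMarginal
  rw [integral_map measurable_fst.aemeasurable g.continuous.measurable.aestronglyMeasurable,
    ← integral_indicator hset]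
  have hgi : Integrable (fun z : X × E d => g z.1) m.1 := by
    simpa using integrable_mul_radial g (1 : E d →ᵇ ℝ) m.1
  refine integral_mono (integrable_mul_radial g _ m.1) (hgi.indicator hset) fun z => ?_
  by_cases hz : z ∈ (Set.univ ×ˢ Metric.closedBall 0 (2 * ((N : ℝ) + 1)) : Set (X × E d))
  · simp only
    rw [Set.indicator_of_mem hz]
    exact mul_le_of_le_one_right (hg _) (wideBump_le_one _ _)
  · simp only
    rw [Set.indicator_of_notMem hz, wideBump_eq_zero, mul_zero]
    by_contra! h
    exact hz ⟨trivial, mem_closedBall_zero_iff.2 h.le⟩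

/-- Vague convergence sees only bounded regions. For fixed `N` the balls carrying the wide bumps are
eventually disjoint for unlinked centres; `N → ∞` is taken after the limit in `n`. -/
lemma sum_limit_marginal_le {b : ℕ → ProbabilityMeasure X} {b' : ProbabilityMeasure X}
    (hb : ∀ n A, MeasurableSet A → ∑' c, (l n c).1.map Prod.fst A ≤ (b n : Measure X) A)
    (hb' : Tendsto b 𝒰 (𝓝 b'))
    (hlam : ∀ c, VagueLimit 𝒰 (fun n => cluster l j a n c) (lam c))
    {s : Finset ℕ} (hs : ∀ c ∈ s, ∀ c' ∈ s, c ≠ c' → ¬ Linked 𝒰 j a c c')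
    {A : Set X} (hA : MeasurableSet A) :
    ∑ c ∈ s, (lam c).1.map Prod.fst A ≤ (b' : Measure X) A := by
  rw [← Measure.finsetSum_apply]
  refine measure_le_of_integral_le (fun g hg => ?_) hA
  have hmarg : ∀ c, Integrable (fun x => g x) ((lam c).1.map Prod.fst) := fun c => g.integrable _
  rw [integral_finsetSum_measure fun c _ => hmarg c]
  have hmap : ∀ c, ∫ x, g x ∂((lam c).1.map Prod.fst) = ∫ z, g z.1 ∂(lam c).1 := fun c =>
    integral_map measurable_fst.aemeasurable g.continuous.measurable.aestronglyMeasurable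
  simp only [hmap]
  have hlim : ∀ c, Tendsto (fun N => ∫ z, g z.1 * wideBump d N z.2 ∂(lam c).1) atTop
      (𝓝 (∫ z, g z.1 ∂(lam c).1)) := by
    intro c
    refine tendsto_integral_of_dominated_convergence (fun _ => ‖g‖)
      (fun N => (integrable_mul_radial g _ _).aestronglyMeasurable) (integrable_const _)
      (fun N => ae_of_all _ fun z => ?_) (ae_of_all _ fun z => ?_)
    · rw [norm_mul, Real.norm_of_nonneg (wideBump_nonneg _ _)]
      exact (mul_le_of_le_one_right (norm_nonneg _) (wideBump_le_one _ _)).trans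
        (g.norm_coe_le_norm _)
    · simpa using (tendsto_wideBump z.2).const_mul (g z.1)
  refine le_of_tendsto' (tendsto_finsetSum s fun c _ => hlim c) fun N => ?_
  have h1 : ∀ c, Tendsto (fun n => ∫ z, g z.1 * wideBump d N z.2 ∂(cluster l j a n c).1) 𝒰
      (𝓝 (∫ z, g z.1 * wideBump d N z.2 ∂(lam c).1)) := by
    intro c
    have h := hlam c g 1 (weightFirst (wideBump d N) 1) (2 * ((N : ℝ) + 1)) fun y i hy => by
      rw [Subsingleton.elim i 0] at hy
      rw [weightFirst_apply, wideBump_eq_zero hy.le, zero_mul]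
    simpa only [SubProb.integral_fin_one] using h
  have h2 := (ProbabilityMeasure.tendsto_iff_forall_integral_tendsto.1 hb') g
  have hfar : ∀ᶠ n in 𝒰, ∀ c ∈ s, ∀ c' ∈ s, c ≠ c' → j n c = j n c' →
      2 * (2 * ((N : ℝ) + 1)) < ‖a n c - a n c'‖ := by
    refine (Filter.eventually_all_finset s).2 fun c hc => (Filter.eventually_all_finset s).2
      fun c' hc' => ?_
    by_cases hne : c = c'
    · exact Eventually.of_forall fun n h => absurd hne h
    · filter_upwards [eventually_not_of_not_linked (hs c' hc' c hc (Ne.symm hne))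
        (2 * (2 * ((N : ℝ) + 1)))] with n hn _ using hn
  refine le_of_tendsto_of_tendsto (tendsto_finsetSum s fun c _ => h1 c) h2 ?_
  filter_upwards [hfar] with n hn
  have h3 := sum_localMarginal_le (hb n) hn
  calc ∑ c ∈ s, ∫ z, g z.1 * wideBump d N z.2 ∂(cluster l j a n c).1
      ≤ ∑ c ∈ s, ∫ x, g x ∂(localMarginal (cluster l j a n c) (2 * ((N : ℝ) + 1))) :=
        Finset.sum_le_sum fun c _ => integral_wideBump_le _ hg N
    _ = ∫ x, g x ∂(∑ c ∈ s, localMarginal (cluster l j a n c) (2 * ((N : ℝ) + 1))) :=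
        (integral_finsetSum_measure fun c _ => g.integrable _).symm
    _ ≤ ∫ x, g x ∂(b n : Measure X) :=
        integral_mono_measure h3 (ae_of_all _ hg) (g.integrable _)

lemma tsum_limitFamily_marginal_le {b : ℕ → ProbabilityMeasure X} {b' : ProbabilityMeasure X}
    (hb : ∀ n A, MeasurableSet A → ∑' c, (l n c).1.map Prod.fst A ≤ (b n : Measure X) A)
    (hb' : Tendsto b 𝒰 (𝓝 b'))
    (hlam : ∀ c, VagueLimit 𝒰 (fun n => cluster l j a n c) (lam c))
    {A : Set X} (hA : MeasurableSet A) :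
    ∑' c, (limitFamily 𝒰 j a lam c).1.map Prod.fst A ≤ (b' : Measure X) A := by
  classical
  refine ENNReal.tsum_le_of_sum_range_le fun I => ?_
  have h1 : ∑ c ∈ Finset.range I, (limitFamily 𝒰 j a lam c).1.map Prod.fst A
      = ∑ c ∈ (Finset.range I).filter (fun c => leader 𝒰 j a c = c), (lam c).1.map Prod.fst A := by
    rw [Finset.sum_filter]
    refine Finset.sum_congr rfl fun c _ => ?_
    unfold limitFamily
    split_ifs
    · rfl
    · simp
  rw [h1]
  refine sum_limit_marginal_le hb hb' hlam (fun c hc c' hc' hne h => hne ?_) hA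
  rw [← (Finset.mem_filter.1 hc).2, ← (Finset.mem_filter.1 hc').2]
  exact leader_eq h

end Marginals

/-! ### Convergent subsequences in `𝒳` -/

section Compactness

variable {X : Type*} [MetricSpace X] [SecondCountableTopology X] [CompleteSpace X]
  [MeasurableSpace X] [BorelSpace X] {d : ℕ}

/-- An ultrafilter provides the offsets of centres, the vague limits and the limit of `β`
simultaneously, without diagonal subsequences. -/
lemma exists_ultrafilter_limit (T : ℕ → Configuration X d)
    (hT : IsTightMeasureSet (Set.range fun n => ((T n).β : Measure X))) (𝒰 : Ultrafilter ℕ) :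
    ∃ T' : Configuration X d, Tendsto (fun n => (T n).β) 𝒰 (𝓝 T'.β) ∧
      ∀ (f : X →ᵇ ℝ) (k : ℕ) (W : transInv d k), (∀ x, |f x| ≤ 1) → 2 ≤ k →
        Tendsto (fun n => (T n).functional f W) 𝒰 (𝓝 (T'.functional f W)) := by
  choose l hlrep using fun n => exists_represents (T n)
  have hb : ∀ n A, MeasurableSet A → ∑' c, (l n c).1.map Prod.fst A ≤ ((T n).β : Measure X) A :=
    fun n A hA => (hlrep n).tsum_marginal_le hA
  have hl : ∀ n, ∑' c, (l n c).1 Set.univ ≤ 1 := fun n => tsum_mass_le (hb n)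
  choose j a hc using fun n => exists_centres (l n) (hl n)
  have hclus : ∀ c n A, MeasurableSet A →
      (cluster l j a n c).1.map Prod.fst A ≤ ((T n).β : Measure X) A := by
    intro c n A hA
    have h1 : (cluster l j a n c).1.map Prod.fst = (l n (j n c)).1.map Prod.fst := by
      change ((l n (j n c)).1.map (shift (-a n c))).map Prod.fst = _
      rw [Measure.map_map measurable_fst (shift _).measurable]
      rfl
    rw [h1]
    exact (ENNReal.le_tsum (j n c)).trans (hb n A hA)
  choose lam hlam using fun c => exists_vague_limit hT (hclus c) 𝒰
  obtain ⟨b', -, hb'⟩ : ∃ b' ∈ closure (Set.range fun n => (T n).β),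
      ((𝒰.map fun n => (T n).β : Ultrafilter (ProbabilityMeasure X)) : Filter _) ≤ 𝓝 b' := by
    refine IsCompact.ultrafilter_le_nhds' (isCompact_closure_of_isTightMeasureSet ?_) _
      (Filter.mem_map.2 (Eventually.of_forall fun n => subset_closure ⟨n, rfl⟩))
    refine hT.subset ?_
    rintro _ ⟨_, ⟨n, rfl⟩, rfl⟩
    exact ⟨n, rfl⟩
  have hlim : Tendsto (fun n => (T n).β) 𝒰 (𝓝 b') := hb'
  have hmarg : ∀ A, MeasurableSet A →
      ∑' c, (limitFamily 𝒰 j a lam c).1.map Prod.fst A ≤ (b' : Measure X) A := fun A hA =>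
    tsum_limitFamily_marginal_le hb hlim hlam hA
  obtain ⟨T', hβ, hrep⟩ := exists_configuration _ b' hmarg
  refine ⟨T', hβ ▸ hlim, fun f k W hf hk => ?_⟩
  have h := tendsto_tsum_integral hl (tsum_mass_le hmarg) hc hlam hf hk W.2
  rw [hrep.functional_eq hf (by omega)]
  exact h.congr fun n => ((hlrep n).functional_eq hf (by omega) W).symm

/-- Each term is at most twice its geometric weight, so termwise convergence suffices by dominated
convergence. -/
lemma TestFamily.tendsto_of_components (S : TestFamily X d) {ι : Type*} {F : Filter ι}
    {T : ι → S.Space} {T' : S.Space}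
    (h1 : ∀ r, Tendsto (fun n => S.term r (T n)) F (𝓝 (S.term r T')))
    (h2 : ∀ i, Tendsto (fun n => ∫ x, S.f i x ∂((T n).β : Measure X)) F
      (𝓝 (∫ x, S.f i x ∂(T'.β : Measure X)))) : Tendsto T F (𝓝 T') := by
  rw [tendsto_iff_dist_tendsto_zero]
  have hgen : ∀ (u : ι → ℕ → ℝ) (v : ℕ → ℝ), (∀ n r, |u n r| ≤ 1) → (∀ r, |v r| ≤ 1) →
      (∀ r, Tendsto (fun n => u n r) F (𝓝 (v r))) →
      Tendsto (fun n => ∑' r : ℕ, (1 / 2 : ℝ) ^ (r + 1) * |u n r - v r|) F (𝓝 0) := by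
    intro u v hu hv huv
    have hs : Summable fun r : ℕ => (1 / 2 : ℝ) ^ (r + 1) * 2 :=
      ((summable_nat_add_iff 1).2 summable_geometric_two).mul_right 2
    have h := tendsto_tsum_of_dominated_convergence (𝓕 := F)
      (f := fun n r => (1 / 2 : ℝ) ^ (r + 1) * |u n r - v r|) (g := fun _ => (0 : ℝ)) hs
      (fun r => by
        have h3 := ((huv r).sub_const (v r)).abs.const_mul ((1 / 2 : ℝ) ^ (r + 1))
        simpa using h3)
      (Eventually.of_forall fun n r => by
        rw [Real.norm_of_nonneg (by positivity)]
        refine mul_le_mul_of_nonneg_left ?_ (by positivity)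
        have h4 := abs_sub (u n r) (v r)
        linarith [hu n r, hv r])
    simpa using h
  have h3 := (hgen _ _ (fun n r => S.abs_term_le r (T n)) (fun r => S.abs_term_le r T') h1).add
    (hgen _ _ (fun n i => S.abs_integral_le i (T n).β) (fun i => S.abs_integral_le i T'.β) h2)
  rw [add_zero] at h3
  exact h3

/-- Sequences whose `β`-components are tight have convergent subsequences. -/
lemma TestFamily.exists_subseq_tendsto (S : TestFamily X d) (u : ℕ → S.Space)
    (hu : IsTightMeasureSet (Set.range fun n => ((u n).β : Measure X))) :
    ∃ (T : S.Space) (φ : ℕ → ℕ), StrictMono φ ∧ Tendsto (u ∘ φ) atTop (𝓝 T) := by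
  let 𝒰 : Ultrafilter ℕ := hyperfilter ℕ
  obtain ⟨T', hβ, hT'⟩ := exists_ultrafilter_limit (X := X) (d := d) u hu 𝒰
  have hlim : Tendsto u 𝒰 (𝓝 (T' : S.Space)) := by
    refine S.tendsto_of_components (fun r => hT' _ _ _ (S.abs_f_le _) (S.enum r).2.1.2) fun i => ?_
    exact (ProbabilityMeasure.tendsto_iff_forall_integral_tendsto.1 hβ) (S.f i)
  -- A limit along an ultrafilter finer than `atTop` is a cluster point, and a pseudometric space is
  -- first countable.
  have hcl : MapClusterPt (X := S.Space) T' atTop u :=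
    MapClusterPt.mono (F := 𝒰) hlim.mapClusterPt Nat.hyperfilter_le_atTop
  obtain ⟨φ, hφ, h⟩ := hcl.tendsto_subseq
  exact ⟨T', φ, hφ, h⟩

end Compactness

/-! ### Tightness of laws on `𝒳` -/

section Laws

variable {X : Type*} [MetricSpace X] [SecondCountableTopology X] [CompleteSpace X]
  [MeasurableSpace X] [BorelSpace X] {d : ℕ}

/-- Each `∫ f_i dβ` is Lipschitz for `𝒟` with constant `2 ^ (i + 1)`, and these integrals detect
weak convergence. -/
lemma TestFamily.continuous_β (S : TestFamily X d) : Continuous fun T : S.Space => T.β := by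
  rw [continuous_iff_seqContinuous]
  intro u T hu
  refine (S.f_convergence (fun n => (u n).β) T.β).1 fun i => ?_
  rw [tendsto_iff_dist_tendsto_zero] at hu ⊢
  have h1 := hu.const_mul ((2 : ℝ) ^ (i + 1))
  rw [mul_zero] at h1
  refine squeeze_zero (fun _ => dist_nonneg) (fun n => ?_) h1
  rw [Real.dist_eq, S.dist_def]
  have h2 := (TestFamily.summable_weighted (fun r => S.abs_integral_le r (u n).β)
    (fun r => S.abs_integral_le r T.β)).le_tsum i fun r _ => by positivity
  have h3 : (0 : ℝ) ≤ S.orbitDist (u n) T := tsum_nonneg fun r => by positivity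
  calc |∫ x, S.f i x ∂((u n).β : Measure X) - ∫ x, S.f i x ∂(T.β : Measure X)|
      = 2 ^ (i + 1) * ((1 / 2 : ℝ) ^ (i + 1) *
        |∫ x, S.f i x ∂((u n).β : Measure X) - ∫ x, S.f i x ∂(T.β : Measure X)|) := by
        rw [← mul_assoc, ← mul_pow]
        norm_num
    _ ≤ 2 ^ (i + 1) * (S.orbitDist (u n) T + S.probDist (u n).β T.β) :=
        mul_le_mul_of_nonneg_left (h2.trans (le_add_of_nonneg_left h3)) (by positivity)

/-- Measurability is tested by evaluation on closed sets, a π-system; such an evaluation is a limit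
of continuous integrals of thickened indicators. -/
lemma measurable_of_continuous_probabilityMeasure {Y : Type*} [TopologicalSpace Y]
    [MeasurableSpace Y] [BorelSpace Y] {b : Y → ProbabilityMeasure X} (hb : Continuous b) :
    Measurable b := by
  refine Measurable.subtype_mk (f := fun y => (b y : Measure X)) ?_
  refine Measurable.measure_of_isPiSystem_of_isProbabilityMeasure (S := {F : Set X | IsClosed F})
    ?_ isPiSystem_isClosed fun F hF => ?_
  · rw [BorelSpace.measurable_eq (α := X), borel_eq_generateFrom_isClosed]
  · have hpos : ∀ n : ℕ, (0 : ℝ) < 1 / ((n : ℝ) + 1) := fun n => by positivity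
    refine measurable_of_tendsto_metrizable (f := fun (n : ℕ) y =>
      ENNReal.ofReal (∫ x, softIndicator (hpos n) F x ∂(b y : Measure X))) (fun n => ?_) ?_
    · refine (ENNReal.continuous_ofReal.comp ?_).measurable
      exact (ProbabilityMeasure.continuous_integral_boundedContinuousFunction _).comp hb
    · rw [tendsto_pi_nhds]
      intro y
      have h := tendsto_integral_thickenedIndicator_of_isClosed (b y : Measure X) hF hpos
        tendsto_one_div_add_atTop_nhds_zero_nat
      have h2 := (ENNReal.continuous_ofReal.tendsto _).comp h
      rwa [Measure.real, ENNReal.ofReal_toReal (measure_ne_top _ _)] at h2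

/-- By the converse half of Prokhorov's theorem `K` is tight, which yields convergent subsequences;
continuity of `β` keeps the limits in the preimage. -/
lemma TestFamily.isCompact_preimage_β (S : TestFamily X d) {K : Set (ProbabilityMeasure X)}
    (hK : IsCompact K) : IsCompact ((fun T : S.Space => T.β) ⁻¹' K) := by
  refine IsSeqCompact.isCompact fun u hu => ?_
  have htight : IsTightMeasureSet (Set.range fun n => ((u n).β : Measure X)) := by
    have h := isTightMeasureSet_of_isCompact_closure (S := K) (by rwa [hK.isClosed.closure_eq])
    refine h.subset ?_
    rintro _ ⟨n, rfl⟩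
    exact ⟨(u n).β, hu n, rfl⟩
  obtain ⟨T, φ, hφ, hT⟩ := S.exists_subseq_tendsto u htight
  exact ⟨T, (hK.isClosed.preimage S.continuous_β).mem_of_tendsto hT
    (Eventually.of_forall fun n => hu _), φ, hφ, hT⟩

lemma TestFamily.isTight_of_isTight_map_β (S : TestFamily X d) (P : ℕ → ProbabilityMeasure S.Space)
    (h : IsTightMeasureSet (Set.range fun n =>
      (P n : Measure S.Space).map (fun T : S.Space => T.β))) :
    IsTightMeasureSet (Set.range fun n => (P n : Measure S.Space)) := by
  rw [isTightMeasureSet_iff_exists_isCompact_measure_compl_le] at h ⊢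
  intro ε hε
  obtain ⟨K, hK, hKε⟩ := h ε hε
  refine ⟨_, S.isCompact_preimage_β hK, ?_⟩
  rintro _ ⟨n, rfl⟩
  refine le_trans ?_ (hKε _ ⟨n, rfl⟩)
  exact Measure.le_map_apply
    (measurable_of_continuous_probabilityMeasure S.continuous_β).aemeasurable _

end Laws

/-! ### Separability of `ℭ_k` -/

section Kernels

/-- Kernels in `ℭ_k` vanishing as soon as two points are at distance at least `n`. -/
def boundedRange (d k n : ℕ) : Set ((Fin k → E d) →ᵇ ℝ) :=
  {W | W ∈ transInv d k ∧ ∀ y, (∃ i i', (n : ℝ) ≤ ‖y i - y i'‖) → W y = 0}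

/-- Restriction of kernels to bounded sets. -/
def restrictBall (d k n : ℕ) (W : boundedRange d k n) :
    C(Metric.closedBall (0 : Fin k → E d) n, ℝ) :=
  ⟨fun y => W.1 y.1, W.1.continuous.comp continuous_subtype_val⟩

/-- Translating the first point to the origin brings every configuration with a possibly non-zero
value into the ball, so no supremum is lost. -/
lemma isometry_restrictBall {d k n : ℕ} (hk : 0 < k) : Isometry (restrictBall d k n) := by
  refine Isometry.of_dist_eq fun V W => le_antisymm ?_ ?_
  · exact (ContinuousMap.dist_le dist_nonneg).2 fun y =>
      BoundedContinuousFunction.dist_coe_le_dist (f := V.1) (g := W.1) y.1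
  · refine (BoundedContinuousFunction.dist_le dist_nonneg).2 fun y => ?_
    let o : Fin k := ⟨0, hk⟩
    by_cases hy : ∃ i i', (n : ℝ) ≤ ‖y i - y i'‖
    · rw [V.2.2 y hy, W.2.2 y hy, dist_self]
      exact dist_nonneg
    · have h1 : (fun i => y i + -y o) ∈ Metric.closedBall (0 : Fin k → E d) n := by
        rw [mem_closedBall_zero_iff, pi_norm_le_iff_of_nonneg (Nat.cast_nonneg n)]
        intro i
        by_contra! h
        exact hy ⟨i, o, by simpa [sub_eq_add_neg] using h.le⟩
      rw [← V.2.1.1 (-y o) y, ← W.2.1.1 (-y o) y]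
      exact ContinuousMap.dist_apply_le_dist (f := restrictBall d k n V)
        (g := restrictBall d k n W) ⟨_, h1⟩

/-- Kernels of range `n` embed isometrically into continuous functions on a compact ball, and soft
thresholding makes their union dense. -/
lemma isSeparable_transInv {d k : ℕ} (hk : 0 < k) :
    TopologicalSpace.IsSeparable (transInv d k : Set ((Fin k → E d) →ᵇ ℝ)) := by
  have h1 : ∀ n, TopologicalSpace.IsSeparable (boundedRange d k n) := fun n => by
    have : SecondCountableTopology (boundedRange d k n) :=
      (isometry_restrictBall (d := d) (n := n) hk).isEmbedding.secondCountableTopology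
    exact TopologicalSpace.IsSeparable.of_subtype _
  refine (TopologicalSpace.IsSeparable.iUnion h1).closure.mono fun W hW => ?_
  rw [Metric.mem_closure_iff]
  intro ε hε
  obtain ⟨R, -, hR⟩ := exists_range_softThreshold hW (half_pos hε)
  refine ⟨softThreshold (ε / 2) W, Set.mem_iUnion.2 ⟨⌈R⌉₊, ⟨?_, ?_⟩, ?_⟩, ?_⟩
  · exact softThreshold_shift hW _
  · exact fun δ hδ => ⟨R, fun y hy => by rw [hR y hy, abs_zero]; exact hδ.le⟩
  · exact fun y ⟨i, i', h⟩ => hR y ⟨i, i', (Nat.le_ceil R).trans h⟩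
  · refine lt_of_le_of_lt ?_ (half_lt_self hε)
    exact (BoundedContinuousFunction.dist_le (half_pos hε).le).2 fun y =>
      abs_sub_softThreshold_le (half_pos hε).le W y

lemma exists_dense_kernels (d : ℕ) {k : ℕ} (hk : 0 < k) : ∃ W : ℕ → (Fin k → E d) →ᵇ ℝ,
    (∀ i, W i ∈ transInv d k) ∧ (∀ i y, |W i y| ≤ 1) ∧
      transInv d k ≤ (Submodule.span ℝ (Set.range W)).topologicalClosure := by
  obtain ⟨t, hts, htc, hst⟩ := (isSeparable_transInv (d := d) hk).exists_countable_dense_subset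
  have hne : t.Nonempty := by
    by_contra! h
    rw [h, closure_empty] at hst
    exact hst (transInv d k).zero_mem
  obtain ⟨V, rfl⟩ := htc.exists_eq_range hne
  -- Dividing by `max 1 ‖V i‖` enforces the bound `1` without changing the span.
  have hpos : ∀ i, 0 < max 1 ‖V i‖ := fun i => lt_max_of_lt_left one_pos
  refine ⟨fun i => (max 1 ‖V i‖)⁻¹ • V i, fun i => (transInv d k).smul_mem _ (hts ⟨i, rfl⟩),
    fun i y => ?_, fun W hW => ?_⟩
  · rw [BoundedContinuousFunction.smul_apply, smul_eq_mul, abs_mul, abs_inv, abs_of_pos (hpos i),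
      inv_mul_le_iff₀ (hpos i), mul_one]
    exact (abs_le_norm_apply _ _).trans (le_max_right _ _)
  · rw [← SetLike.mem_coe, Submodule.topologicalClosure_coe]
    refine closure_mono ?_ (hst hW)
    rintro _ ⟨i, rfl⟩
    have h := Submodule.smul_mem _ (max 1 ‖V i‖)
      (Submodule.subset_span (R := ℝ) (Set.mem_range_self (f := fun i => (max 1 ‖V i‖)⁻¹ • V i) i))
    rwa [smul_smul, mul_inv_cancel₀ (hpos i).ne', one_smul] at h

end Kernels

/-! ### Closure of a countable set under midpoints -/

section MidpointClosure

variable {V : Type*} [AddCommGroup V] [Module ℝ V]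

/-- Points obtained from a set by iterated midpoints. -/
def iteratedMidpoints (s : Set V) : ℕ → Set V
  | 0 => s
  | n + 1 => iteratedMidpoints s n ∪
      Set.image2 (fun f g => (1 / 2 : ℝ) • (f + g)) (iteratedMidpoints s n) (iteratedMidpoints s n)

lemma countable_iteratedMidpoints {s : Set V} (hs : s.Countable) (n : ℕ) :
    (iteratedMidpoints s n).Countable := by
  induction n with
  | zero => exact hs
  | succ n ih => exact ih.union (ih.image2 ih _)

lemma monotone_iteratedMidpoints (s : Set V) : Monotone (iteratedMidpoints s) :=
  monotone_nat_of_le_succ fun _ => Set.subset_union_left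

lemma midpoint_mem_iUnion_iteratedMidpoints {s : Set V} {f g : V}
    (hf : f ∈ ⋃ n, iteratedMidpoints s n) (hg : g ∈ ⋃ n, iteratedMidpoints s n) :
    (1 / 2 : ℝ) • (f + g) ∈ ⋃ n, iteratedMidpoints s n := by
  rw [Set.mem_iUnion] at hf hg ⊢
  obtain ⟨n, hn⟩ := hf
  obtain ⟨m, hm⟩ := hg
  exact ⟨max n m + 1, Or.inr ⟨f, monotone_iteratedMidpoints s (le_max_left _ _) hn, g,
    monotone_iteratedMidpoints s (le_max_right _ _) hm, rfl⟩⟩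

lemma iteratedMidpoints_subset_convex {s t : Set V} (ht : Convex ℝ t) (hst : s ⊆ t) (n : ℕ) :
    iteratedMidpoints s n ⊆ t := by
  induction n with
  | zero => exact hst
  | succ n ih =>
    refine Set.union_subset ih ?_
    rintro _ ⟨f, hf, g, hg, rfl⟩
    have h := ht (ih hf) (ih hg) (a := 1 / 2) (b := 1 / 2) (by norm_num) (by norm_num) (by norm_num)
    rwa [← smul_add] at h

end MidpointClosure

/-! ### A countable convergence-determining set -/

section ConvergenceDetermining

variable {X : Type*} [MetricSpace X] [SecondCountableTopology X] [MeasurableSpace X] [BorelSpace X]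

lemma exists_basis_sequence (X : Type*) [TopologicalSpace X] [SecondCountableTopology X] :
    ∃ B : ℕ → Set X, (∀ i, IsOpen (B i)) ∧ ∀ U, IsOpen U → ∀ x ∈ U, ∃ i, x ∈ B i ∧ B i ⊆ U := by
  -- Adjoining `∅` guarantees a non-empty countable set, which can be listed by `ℕ`.
  obtain ⟨B, hB⟩ := ((TopologicalSpace.countable_countableBasis X).insert ∅).exists_eq_range
    (Set.insert_nonempty _ _)
  refine ⟨B, fun i => ?_, fun U hU x hx => ?_⟩
  · have h : B i ∈ insert ∅ (TopologicalSpace.countableBasis X) := hB ▸ Set.mem_range_self i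
    rcases h with h | h
    · rw [h]; exact isOpen_empty
    · exact TopologicalSpace.isOpen_of_mem_countableBasis h
  · obtain ⟨v, hv, hxv, hvU⟩ :=
      (TopologicalSpace.isBasis_countableBasis X).exists_subset_of_mem_open hx hU
    have h : v ∈ Set.range B := hB ▸ Set.mem_insert_of_mem _ hv
    obtain ⟨i, rfl⟩ := h
    exact ⟨i, hxv, hvU⟩

/-- Portmanteau: finite unions of basis sets exhaust an open set from inside, and soft indicators of
their complements control their measures from below. -/
lemma tendsto_of_softIndicator {B : ℕ → Set X} (hB : ∀ i, IsOpen (B i))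
    (hbasis : ∀ U, IsOpen U → ∀ x ∈ U, ∃ i, x ∈ B i ∧ B i ⊆ U)
    {b : ℕ → ProbabilityMeasure X} {b' : ProbabilityMeasure X}
    (h : ∀ (s : Finset ℕ) (m : ℕ),
      Tendsto (fun n => ∫ x, softIndicator (Nat.one_div_pos_of_nat (α := ℝ) (n := m))
        (⋃ i ∈ s, B i)ᶜ x ∂(b n : Measure X)) atTop
        (𝓝 (∫ x, softIndicator (Nat.one_div_pos_of_nat (α := ℝ) (n := m))
          (⋃ i ∈ s, B i)ᶜ x ∂(b' : Measure X)))) : Tendsto b atTop (𝓝 b') := by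
  classical
  have hfin : ∀ s : Finset ℕ, ∀ r : ℝ, r < (b' : Measure X).real (⋃ i ∈ s, B i) →
      ∀ᶠ n in atTop, r < (b n : Measure X).real (⋃ i ∈ s, B i) := by
    intro s r hr
    have hopen : IsOpen (⋃ i ∈ s, B i) := isOpen_biUnion fun i _ => hB i
    have h1 := tendsto_integral_thickenedIndicator_of_isClosed (b' : Measure X)
      hopen.isClosed_compl (fun m => Nat.one_div_pos_of_nat (α := ℝ) (n := m))
      tendsto_one_div_add_atTop_nhds_zero_nat
    rw [probReal_compl_eq_one_sub hopen.measurableSet] at h1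
    obtain ⟨m, hm⟩ := (h1.eventually_lt_const (show _ < 1 - r by linarith)).exists
    filter_upwards [(h s m).eventually_lt_const hm] with n hn
    have h2 : (b n : Measure X).real (⋃ i ∈ s, B i)ᶜ ≤ ∫ x, softIndicator
        (Nat.one_div_pos_of_nat (α := ℝ) (n := m)) (⋃ i ∈ s, B i)ᶜ x ∂(b n : Measure X) := by
      rw [← integral_indicator_one hopen.measurableSet.compl]
      refine integral_mono ((integrable_const (1 : ℝ)).indicator hopen.measurableSet.compl)
        ((softIndicator _ _).integrable _) fun x => ?_
      by_cases hx : x ∈ (⋃ i ∈ s, B i)ᶜ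
      · rw [Set.indicator_of_mem hx, softIndicator_apply, thickenedIndicator_one _ _ hx]
        simp
      · rw [Set.indicator_of_notMem hx]
        exact softIndicator_nonneg _ _ _
    rw [probReal_compl_eq_one_sub hopen.measurableSet] at h2
    linarith
  refine tendsto_of_forall_isOpen_le_liminf' fun U hU => ?_
  let s : ℕ → Finset ℕ := fun N => (Finset.range N).filter fun i => B i ⊆ U
  have hsU : ∀ N, (⋃ i ∈ s N, B i) ⊆ U := fun N =>
    Set.iUnion₂_subset fun i hi => (Finset.mem_filter.1 hi).2
  have hmono : Monotone fun N => ⋃ i ∈ s N, B i := fun N N' hN =>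
    Set.biUnion_subset_biUnion_left fun i hi =>
      Finset.filter_subset_filter _ (Finset.range_mono hN) hi
  have hunion : ⋃ N, ⋃ i ∈ s N, B i = U := by
    refine Set.Subset.antisymm (Set.iUnion_subset hsU) fun x hx => ?_
    obtain ⟨i, hxi, hi⟩ := hbasis U hU x hx
    refine Set.mem_iUnion.2 ⟨i + 1, Set.mem_iUnion₂.2 ⟨i, ?_, hxi⟩⟩
    exact Finset.mem_filter.2 ⟨Finset.mem_range.2 (Nat.lt_succ_self i), hi⟩
  have hlim := tendsto_measure_iUnion_atTop (μ := (b' : Measure X)) hmono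
  rw [hunion] at hlim
  refine le_of_tendsto' hlim fun N => ?_
  refine le_of_forall_lt fun r hr => ?_
  have hr' : r ≠ ∞ := hr.ne_top
  obtain ⟨r', hrr', hr''⟩ := exists_between hr
  have h3 := hfin (s N) r'.toReal ((ENNReal.toReal_lt_toReal hr''.ne_top (measure_ne_top _ _)).2 hr'')
  refine lt_of_lt_of_le hrr' (le_liminf_of_le (by isBoundedDefault) ?_)
  filter_upwards [h3] with n hn
  have h4 := (ENNReal.toReal_lt_toReal hr''.ne_top (measure_ne_top _ _)).1 hn
  exact h4.le.trans (measure_mono (hsU N))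

end ConvergenceDetermining

/-! ### Existence of suitable test families -/

section Existence

variable (X : Type*) [MetricSpace X] [SecondCountableTopology X] [MeasurableSpace X]
  [BorelSpace X] (d : ℕ)

/-- The midpoint closure of `1` and the soft indicators stays countable and bounded by `1`. The
added functions are harmless for convergence, being bounded and continuous. -/
lemma exists_midpointClosed : ∃ S : TestFamily X d, S.MidpointClosed := by
  obtain ⟨B, hB, hbasis⟩ := exists_basis_sequence X
  let G : Finset ℕ × ℕ → X →ᵇ ℝ := fun p =>
    softIndicator (Nat.one_div_pos_of_nat (α := ℝ) (n := p.2)) (⋃ i ∈ p.1, B i)ᶜ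
  let s : Set (X →ᵇ ℝ) := insert 1 (Set.range G)
  have hs : s.Countable := (Set.countable_range G).insert 1
  have hcount : (⋃ n, iteratedMidpoints s n).Countable :=
    Set.countable_iUnion (countable_iteratedMidpoints hs)
  have hsub : ∀ {g}, g ∈ s → g ∈ ⋃ n, iteratedMidpoints s n := fun hg =>
    Set.mem_iUnion.2 ⟨0, hg⟩
  obtain ⟨f, hf⟩ := hcount.exists_eq_range ⟨1, hsub (Set.mem_insert _ _)⟩
  have hle : ∀ j x, |f j x| ≤ 1 := by
    intro j x
    have hconv : Convex ℝ {g : X →ᵇ ℝ | ∀ x, |g x| ≤ 1} := by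
      intro g hg g' hg' p q hp hq hpq x
      have h1 := abs_le.1 (hg x)
      have h2 := abs_le.1 (hg' x)
      simp only [BoundedContinuousFunction.coe_add, BoundedContinuousFunction.coe_smul,
        Pi.add_apply, smul_eq_mul]
      rw [abs_le]
      constructor <;> nlinarith
    have hst : s ⊆ {g : X →ᵇ ℝ | ∀ x, |g x| ≤ 1} := by
      rintro g (rfl | ⟨p, rfl⟩) x
      · simp
      · rw [abs_of_nonneg (softIndicator_nonneg _ _ _)]
        exact softIndicator_le_one _ _ _
    have hmem : f j ∈ ⋃ n, iteratedMidpoints s n := hf ▸ Set.mem_range_self j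
    obtain ⟨n, hn⟩ := Set.mem_iUnion.1 hmem
    exact iteratedMidpoints_subset_convex hconv hst n hn x
  choose W hWmem hWle hWdense using fun k : {k : ℕ // 2 ≤ k} =>
    exists_dense_kernels d (show 0 < k.1 from lt_of_lt_of_le two_pos k.2)
  have : Nonempty {k : ℕ // 2 ≤ k} := ⟨⟨2, le_rfl⟩⟩
  obtain ⟨enum, henum⟩ := exists_surjective_nat (ℕ × {k : ℕ // 2 ≤ k} × ℕ)
  have hrange : ∀ g ∈ ⋃ n, iteratedMidpoints s n, ∃ j, f j = g := fun g hg => by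
    rw [hf] at hg
    exact hg
  refine ⟨⟨f, hle, fun b b' => ⟨fun h => ?_, fun h j => ?_⟩, W, hWmem, hWle, hWdense, enum, henum⟩,
    ?_, fun i j => ?_⟩
  · refine tendsto_of_softIndicator hB hbasis fun t m => ?_
    obtain ⟨j, hj⟩ := hrange (G (t, m)) (hsub (Set.mem_insert_of_mem _ ⟨_, rfl⟩))
    have h1 := h j
    rw [hj] at h1
    exact h1
  · exact (ProbabilityMeasure.tendsto_iff_forall_integral_tendsto.1 h) (f j)
  · obtain ⟨j, hj⟩ := hrange 1 (hsub (Set.mem_insert _ _))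
    exact ⟨j, fun x => DFunLike.congr_fun hj x⟩
  · have hmem : ∀ j, f j ∈ ⋃ n, iteratedMidpoints s n := fun j => hf ▸ Set.mem_range_self j
    obtain ⟨l, hl⟩ := hrange _ (midpoint_mem_iUnion_iteratedMidpoints (hmem i) (hmem j))
    refine ⟨l, fun x => ?_⟩
    refine (DFunLike.congr_fun hl x).trans ?_
    change 1 / 2 * (f i x + f j x) = (f i x + f j x) / 2
    ring

end Existence

end OrbitCompactification

end

theorem mainTheorem5 {X : Type*} [MetricSpace X] [CompleteSpace X]
    [TopologicalSpace.SeparableSpace X] [MeasurableSpace X] [BorelSpace X] (d : ℕ) :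
    -- suitable test families exist
    (∃ S : OrbitCompactification.TestFamily X d, S.MidpointClosed) ∧
    -- for these, `𝒟` is a metric
    (∀ S : OrbitCompactification.TestFamily X d, S.MidpointClosed →
      ∀ T₁ T₂ : S.Space, dist T₁ T₂ = 0 ↔ T₁ = T₂) ∧
    -- for all test families, tightness of the `β`-components gives convergent subsequences
    (∀ (S : OrbitCompactification.TestFamily X d) (K : Set S.Space),
      IsTightMeasureSet ((fun T : S.Space => (T.β : Measure X)) '' K) →
      ∀ u : ℕ → S.Space, (∀ n, u n ∈ K) →
        ∃ (T : S.Space) (φ : ℕ → ℕ), StrictMono φ ∧ Tendsto (u ∘ φ) atTop (𝓝 T)) ∧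
    -- tightness of the laws of `β` lifts to probability measures on `𝒳`
    (∀ (S : OrbitCompactification.TestFamily X d) (P : ℕ → ProbabilityMeasure S.Space),
      IsTightMeasureSet (Set.range fun n =>
        (P n : Measure S.Space).map (fun T : S.Space => T.β)) →
      IsTightMeasureSet (Set.range fun n => (P n : Measure S.Space))) := by
  have : SecondCountableTopology X := UniformSpace.secondCountable_of_separable X
  refine ⟨OrbitCompactification.exists_midpointClosed X d, fun S hS T₁ T₂ => ⟨?_, ?_⟩,
    fun S K hK u hu => ?_, fun S P hP => S.isTight_of_isTight_map_β P hP⟩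
  · exact S.eq_of_dist_zero hS
  · rintro rfl
    exact dist_self _
  · refine S.exists_subseq_tendsto u (hK.subset ?_)
    rintro _ ⟨n, rfl⟩
    exact ⟨u n, hu n, rfl⟩
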